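/- Let $p>2$ be prime, $q=p^2$, let $\mathbb{Z}_q$ be the ring of integers of the unramified quadratic extension $\mathbb{Q}_q=\mathbb{Q}_{p^2}$ of $\mathbb{Q}_p$, and let $\mathrm{Fr}$ be the Frobenius automorphism of $\mathbb{Z}_q$. Put $G=\mathrm{GL}_2(\mathbb{Q}_q)$, $K=\mathrm{GL}_2(\mathbb{Z}_q)$, $KZ=p^{\mathbb{Z}}K$ and $\alpha=\begin{pmatrix}1&0\\0&p\end{pmatrix}$. Let $E$ be a finite extension of $\mathbb{Q}_q$ with ring of integers $\mathcal{O}$ and residue field $k_E$, and let $v$ be its valuation, normalized by $v(p)=1$. For a $\mathbb{Z}_q$-algebra $R$, integers $r_0,r_1\ge 0$ and $s\ge0$, let $(r_0,r_1)\otimes D^s$ denote the space of polynomials over $R$ that are homogeneous of degree $r_i$ in $(X_i,Y_i)$ for $i=0,1$, on which $g=\begin{pmatrix}a&b\\c&d\end{pmatrix}\in K$ acts by $$X_i\mapsto a^{\mathrm{Fr}^i}X_i+c^{\mathrm{Fr}^i}Y_i,\qquad Y_i\mapsto b^{\mathrm{Fr}^i}X_i+d^{\mathrm{Fr}^i}Y_i,$$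 multiplied by $\det(g)^s$, and the scalar matrix $p$ acts trivially. Write $\mathrm{ind}_{KZ}^G$ for compact induction, realized on functions $f:G\to V$ with $f(hg)=h\cdot f(g)$ for $h\in KZ$ and support in finitely many cosets $KZg$. The Hecke operator $T$ on $\mathrm{ind}_{KZ}^G((r_0,r_1)\otimes D^s)$ is $$(Tf)(g)=\sum_{y\in G/KZ}\varphi(y)f(y^{-1}g),$$ where $\varphi:G\to\mathrm{End}(V)$ is supported on $KZ\alpha^{-1}KZ$, satisfies $\varphi(h\alpha^{-1}h')=h\,\varphi(\alpha^{-1})\,h'$ for $h,h'\in KZ$, and $\varphi(\alpha^{-1})$ is the map $P(X_i,Y_i)\mapsto P(pX_i,Y_i)$. Let $r_0,r_1\ge q$ and let $a_p\in\mathcal{O}$. With $k_i=r_i+2$ put $$\Pi_{k,a_p}=\mathrm{ind}_{KZ}^G\big(\mathrm{Sym}^{r_0}E^2\otimes\mathrm{Sym}^{r_1}E^2\big)/(T-a_p),$$ let $\Theta_{k,a_p}$ be the image of $\mathrm{ind}_{KZ}^G(\mathrm{Sym}^{r_0}\mathcal{O}^2\otimes\mathrm{Sym}^{r_1}\mathcal{O}^2)$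 in $\Pi_{k,a_p}$, and put $\bar\Theta_{k,a_p}=\Theta_{k,a_p}\otimes_{\mathcal{O}}k_E$. Let $V_r=\mathrm{Sym}^{r_0}k_E^2\otimes\mathrm{Sym}^{r_1}k_E^2$. Let $V_r^*\subset V_r$ be the subspace of the polynomials in $V_r$ that lie in the ideal generated by $\theta_0=X_0Y_1^p-Y_0X_1^p$ and $\theta_1=X_1Y_0^p-Y_1X_0^p$. Let $X_r\subset V_r$ be the $K$-subrepresentation generated by $X_0^{r_0}X_1^{r_1}$. Put $$Q=V_r/(V_r^*+X_r),$$ and let $\mathrm{soc}(Q)$ be its socle, the sum of its irreducible $K$-subrepresentations. **Theorem.** Assume that $r_0+pr_1\equiv pa_1 \pmod{q-1}$ with $1\le a_1\le p-1$, that $p\nmid r_0$, that $p\mid r_1$ if $a_1=1$, and that $v(a_p)\in(\tfrac12,1)$. Then: 1. the canonical map $\mathrm{ind}_{KZ}^G(\mathrm{Sym}^{r_0}\mathcal{O}^2\otimes\mathrm{Sym}^{r_1}\mathcal{O}^2)\to\bar\Theta_{k,a_p}$ factors through $\mathrm{ind}_{KZ}^GQ$; 2. $\mathrm{soc}(Q)\cong(p-2,a_1-1)\otimes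 D$ over $k_E$, so that the Hecke operator $T$ is defined on $\mathrm{ind}_{KZ}^G\mathrm{soc}(Q)$ through any such isomorphism; 3. the resulting map $\mathrm{ind}_{KZ}^G\mathrm{soc}(Q)\to\bar\Theta_{k,a_p}$ factors through $T$: it kills the image of $T$, so it factors through $\mathrm{ind}_{KZ}^G\mathrm{soc}(Q)/T(\mathrm{ind}_{KZ}^G\mathrm{soc}(Q))$. -/

import Mathlib

open scoped TensorProduct

namespace HeckeGL2

section Groups

variable (p : ℕ) [Fact p.Prime]

/-- The ring of integers `ℤ_{p²} = W(𝔽_{p²})` of the unramified quadratic extension of `ℚ_p`. -/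
abbrev Zq : Type := WittVector p (GaloisField p 2)

/-- The unramified quadratic extension `ℚ_{p²}` of `ℚ_p`. -/
abbrev Qq : Type := FractionRing (Zq p)

/-- `G = GL₂(ℚ_{p²})`. -/
abbrev G : Type := Matrix.GeneralLinearGroup (Fin 2) (Qq p)

/-- `K = GL₂(ℤ_{p²})`. -/
abbrev K : Type := Matrix.GeneralLinearGroup (Fin 2) (Zq p)

/-- The inclusion `K → G`. -/
noncomputable def toG : K p →* G p :=
  Matrix.GeneralLinearGroup.map (algebraMap (Zq p) (Qq p))

theorem p_ne_zero : (p : Qq p) ≠ 0 := by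
  intro h
  apply WittVector.p_nonzero p (GaloisField p 2)
  apply IsFractionRing.injective (Zq p) (Qq p)
  simpa using h

/-- The scalar matrix `p`, as an element of the centre of `G`. -/
noncomputable def pScalar : G p :=
  Matrix.GeneralLinearGroup.scalar (Fin 2) (Units.mk0 (p : Qq p) (p_ne_zero p))

theorem pScalar_zpow_comm (n : ℤ) (g : G p) : pScalar p ^ n * g = g * pScalar p ^ n :=
  (Commute.zpow_left (Matrix.GeneralLinearGroup.scalar_commute _ g : Commute (pScalar p) g) n)

/-- The subgroup `KZ` of `G`, where `Z = ℚ_{p²}ˣ` is the centre: as `Z = p^ℤ × ℤ_{p²}ˣ` and the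
scalar matrices with entry in `ℤ_{p²}ˣ` lie in `K`, its elements are the `pⁿ k`, `n ∈ ℤ`,
`k ∈ K`. -/
noncomputable def KZ : Subgroup (G p) where
  carrier := {g | ∃ (n : ℤ) (k : K p), g = pScalar p ^ n * toG p k}
  one_mem' := ⟨0, 1, by simp⟩
  mul_mem' := by
    rintro _ _ ⟨n, k, rfl⟩ ⟨n', k', rfl⟩
    refine ⟨n + n', k * k', ?_⟩
    rw [zpow_add, map_mul, mul_assoc, ← mul_assoc (toG p k), ← pScalar_zpow_comm]
    simp only [mul_assoc]
  inv_mem' := by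
    rintro _ ⟨n, k, rfl⟩
    refine ⟨-n, k⁻¹, ?_⟩
    rw [mul_inv_rev, map_inv, zpow_neg, ← zpow_neg, pScalar_zpow_comm]

/-- `α = diag(1, p)`. -/
noncomputable def alpha : G p :=
  Matrix.GeneralLinearGroup.mkOfDetNeZero !![1, 0; 0, (p : Qq p)]
    (by simpa [Matrix.det_fin_two] using p_ne_zero p)

end Groups

section SymmetricPowers

variable {p : ℕ} [Fact p.Prime] (R : Type*) [CommRing R] [Algebra (Zq p) R]

/-- Polynomials over `R` in `X₀, Y₀, X₁, Y₁`, where `X_i` is the variable `(i, 0)` and `Y_i` is the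
variable `(i, 1)`. -/
abbrev Poly (R : Type*) [CommRing R] : Type _ := MvPolynomial (Fin 2 × Fin 2) R

/-- The bidegree: `X_i` and `Y_i` have bidegree the `i`-th unit vector. -/
def bideg (x : Fin 2 × Fin 2) : Fin 2 → ℕ := Pi.single x.1 1

/-- `Sym^{r₀} R² ⊗ Sym^{r₁} R²`, modelled on the polynomials that are homogeneous of degree `r_i` in
`X_i, Y_i` for `i = 0, 1`. -/
abbrev symSubmodule (R : Type*) [CommRing R] (r : Fin 2 → ℕ) : Submodule R (Poly R) :=
  MvPolynomial.weightedHomogeneousSubmodule R bideg r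

/-- `symSubmodule` as a type. -/
def Sym (R : Type*) [CommRing R] (r : Fin 2 → ℕ) : Type _ := symSubmodule R r

noncomputable instance (R : Type*) [CommRing R] (r : Fin 2 → ℕ) : AddCommGroup (Sym R r) :=
  inferInstanceAs (AddCommGroup (symSubmodule R r))

noncomputable instance (S R : Type*) [CommRing S] [CommRing R] [Algebra S R] (r : Fin 2 → ℕ) :
    Module S (Sym R r) :=
  inferInstanceAs (Module S (symSubmodule R r))

instance (S R : Type*) [CommRing S] [CommRing R] [Algebra S R] (r : Fin 2 → ℕ) :
    IsScalarTower S R (Sym R r) :=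
  inferInstanceAs (IsScalarTower S R (symSubmodule R r))

/-- The inclusion of `Sym^{r₀} R² ⊗ Sym^{r₁} R²` into the polynomials. -/
noncomputable def Sym.toPoly (R : Type*) [CommRing R] (r : Fin 2 → ℕ) : Sym R r →ₗ[R] Poly R :=
  (symSubmodule R r).subtype

/-- The substitution `X_i ↦ a^{Fr^i} X_i + c^{Fr^i} Y_i`, `Y_i ↦ b^{Fr^i} X_i + d^{Fr^i} Y_i` attached
to a matrix `m = (a b; c d)` over `ℤ_{p²}` (invertible or not). -/
noncomputable def subst (m : Matrix (Fin 2) (Fin 2) (Zq p)) : Poly R →ₐ[R] Poly R :=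
  MvPolynomial.aeval fun x => ∑ l : Fin 2,
    MvPolynomial.C (algebraMap (Zq p) R
      (((WittVector.frobenius : Zq p →+* Zq p) ^ (x.1 : ℕ)) (m l x.2))) * MvPolynomial.X (x.1, l)

theorem subst_one : subst R (1 : Matrix (Fin 2) (Fin 2) (Zq p)) = AlgHom.id R _ := by
  apply MvPolynomial.algHom_ext
  rintro ⟨i, j⟩
  fin_cases j <;> simp [subst]

theorem subst_mul (m n : Matrix (Fin 2) (Fin 2) (Zq p)) :
    subst R (m * n) = (subst R m).comp (subst R n) := by
  apply MvPolynomial.algHom_ext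
  rintro ⟨i, j⟩
  simp only [subst, MvPolynomial.aeval_X, AlgHom.comp_apply, map_mul,
    MvPolynomial.algHom_C, Matrix.mul_apply, Fin.sum_univ_two, map_add, MvPolynomial.algebraMap_eq]
  ring

theorem subst_mem {r : Fin 2 → ℕ} (m : Matrix (Fin 2) (Fin 2) (Zq p)) {v : Poly R}
    (hv : v ∈ symSubmodule R r) : subst R m v ∈ symSubmodule R r := by
  rw [v.as_sum, map_sum]
  refine Submodule.sum_mem _ fun d hd => ?_
  have hd' : Finsupp.weight bideg d = r := hv (MvPolynomial.mem_support_iff.mp hd)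
  rw [MvPolynomial.monomial_eq, map_mul, MvPolynomial.algHom_C, MvPolynomial.algebraMap_eq,
    MvPolynomial.mem_weightedHomogeneousSubmodule]
  refine MvPolynomial.IsWeightedHomogeneous.C_mul ?_ _
  rw [Finsupp.prod, map_prod, ← hd', Finsupp.weight_apply, Finsupp.sum]
  refine MvPolynomial.IsWeightedHomogeneous.prod _ _ _ fun x _ => ?_
  rw [map_pow]
  refine MvPolynomial.IsWeightedHomogeneous.pow ?_ _
  rw [subst, MvPolynomial.aeval_X]
  refine MvPolynomial.IsWeightedHomogeneous.sum _ _ _ fun l _ => ?_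
  exact MvPolynomial.IsWeightedHomogeneous.C_mul
    (MvPolynomial.isWeightedHomogeneous_X R bideg (x.1, l)) _

/-- The action of the multiplicative monoid of `2 × 2` matrices over `ℤ_{p²}` on
`Sym^{r₀} R² ⊗ Sym^{r₁} R²`. -/
noncomputable def matAct (r : Fin 2 → ℕ) :
    Matrix (Fin 2) (Fin 2) (Zq p) →* Module.End R (Sym R r) where
  toFun m := ((subst R m).toLinearMap.restrict fun _ hv => subst_mem R m hv :
    symSubmodule R r →ₗ[R] symSubmodule R r)
  map_one' := LinearMap.ext fun v => Subtype.ext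
    (congrArg (fun F : Poly R →ₐ[R] Poly R => F v.1) (subst_one R))
  map_mul' m n := LinearMap.ext fun v => Subtype.ext
    (congrArg (fun F : Poly R →ₐ[R] Poly R => F v.1) (subst_mul R m n))

/-- The representation `(Sym^{r₀} R² ⊗ Sym^{r₁} R²) ⊗ D^s` of `K`, with `D` the determinant. It is
regarded as a representation of `KZ` on which the scalar matrix `p` acts trivially. -/
noncomputable def symRep (r : Fin 2 → ℕ) (s : ℕ) : Representation R (K p) (Sym R r) where
  toFun k := (algebraMap (Zq p) R (k : Matrix (Fin 2) (Fin 2) (Zq p)).det) ^ s •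
    matAct R r (k : Matrix (Fin 2) (Fin 2) (Zq p))
  map_one' := by simp
  map_mul' k k' := by
    simp only [Units.val_mul, Matrix.det_mul, map_mul, mul_pow, smul_mul_smul_comm]

end SymmetricPowers

section Induction

variable {p : ℕ} [Fact p.Prime]

/-- The compact induction `ind_{KZ}^G V` of a representation `ρ` of `K` on `V`, extended to `KZ` by
letting `p` act trivially: functions `f : G → V` with `f (h g) = h · f g` for `h ∈ KZ` whose support
is contained in a finite union of cosets `KZ s`. -/
def ind {R V : Type*} [CommRing R] [AddCommGroup V] [Module R V] (ρ : Representation R (K p) V) :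
    Submodule R (G p → V) where
  carrier := {f | (∀ (n : ℤ) (k : K p) (g : G p), f (pScalar p ^ n * toG p k * g) = ρ k (f g)) ∧
    ∃ S : Finset (G p), ∀ g, f g ≠ 0 → ∃ s ∈ S, g * s⁻¹ ∈ KZ p}
  zero_mem' := ⟨fun _ _ _ => by simp, ∅, fun g h => absurd rfl h⟩
  add_mem' := by
    classical
    rintro f f' ⟨h, S, hS⟩ ⟨h', S', hS'⟩
    refine ⟨fun n k g => by simp [h, h'], S ∪ S', fun g hg => ?_⟩
    by_cases hf : f g = 0
    · by_cases hf' : f' g = 0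
      · exact absurd (by simp [hf, hf']) hg
      · obtain ⟨s, hs, hs'⟩ := hS' g hf'
        exact ⟨s, Finset.mem_union_right _ hs, hs'⟩
    · obtain ⟨s, hs, hs'⟩ := hS g hf
      exact ⟨s, Finset.mem_union_left _ hs, hs'⟩
  smul_mem' := by
    rintro a f ⟨h, S, hS⟩
    refine ⟨fun n k g => by simp [h], S, fun g hg => hS g fun h0 => hg (by simp [h0])⟩

/-- The map `ind_{KZ}^G V → ind_{KZ}^G V'`, `f ↦ φ ∘ f`, induced by a `K`-equivariant map
`φ : V → V'`. The coefficient rings `R` of `V` and `R'` of `V'` may differ; `φ` is linear over a ring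
`S` over which both are algebras. -/
def indMap {S R R' V V' : Type*} [CommRing S] [CommRing R] [CommRing R'] [Algebra S R] [Algebra S R']
    [AddCommGroup V] [Module R V] [Module S V] [IsScalarTower S R V]
    [AddCommGroup V'] [Module R' V'] [Module S V'] [IsScalarTower S R' V']
    (ρ : Representation R (K p) V) (ρ' : Representation R' (K p) V') (φ : V →ₗ[S] V')
    (hφ : ∀ (k : K p) (v : V), φ (ρ k v) = ρ' k (φ v)) : ind ρ →ₗ[S] ind ρ' where
  toFun f := ⟨fun g => φ (f.1 g), fun n k g => by simp only [f.2.1, hφ], by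
    obtain ⟨S, hS⟩ := f.2.2
    exact ⟨S, fun g hg => hS g fun h0 => hg (by simp only [h0, map_zero])⟩⟩
  map_add' f f' := by
    ext g
    simp
  map_smul' a f := by
    ext g
    simp

end Induction

section DoubleCoset

variable {A F : Type*} [CommRing A] [Field F] [Algebra A F]

theorem coe_doubleCoset_aux (x : F) (hx : x ≠ 0) (y : A) (hy : algebraMap A F y = x)
    (h : (!![1, 0; 0, x] : Matrix (Fin 2) (Fin 2) F).det ≠ 0)
    (n : ℤ) (k k' : Matrix.GeneralLinearGroup (Fin 2) A) :
    ((Matrix.GeneralLinearGroup.scalar (Fin 2) (Units.mk0 x hx) ^ n *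
        Matrix.GeneralLinearGroup.map (algebraMap A F) k *
        (Matrix.GeneralLinearGroup.mkOfDetNeZero !![1, 0; 0, x] h)⁻¹ *
        Matrix.GeneralLinearGroup.map (algebraMap A F) k' : Matrix.GeneralLinearGroup (Fin 2) F) :
        Matrix (Fin 2) (Fin 2) F) =
      x ^ (n - 1) • (k.1 * !![y, 0; 0, 1] * k'.1).map (algebraMap A F) := by
  have h' : (!![x, 0; 0, 1] : Matrix (Fin 2) (Fin 2) F).det ≠ 0 := by
    simpa [Matrix.det_fin_two] using hx
  set ϖ := Matrix.GeneralLinearGroup.scalar (Fin 2) (Units.mk0 x hx) with hϖ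
  have hc : ∀ (m : ℤ) (g : Matrix.GeneralLinearGroup (Fin 2) F), ϖ ^ m * g = g * ϖ ^ m :=
    fun m g => Commute.zpow_left
      (Matrix.GeneralLinearGroup.scalar_commute _ g : Commute ϖ g) m
  have ha : (Matrix.GeneralLinearGroup.mkOfDetNeZero !![1, 0; 0, x] h)⁻¹ = ϖ ^ (-1 : ℤ) *
      Matrix.GeneralLinearGroup.mkOfDetNeZero !![x, 0; 0, 1] h' := by
    rw [inv_eq_iff_mul_eq_one, ← mul_assoc, ← hc, mul_assoc, zpow_neg_one, inv_mul_eq_one]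
    ext i j
    fin_cases i <;> fin_cases j <;>
      simp [hϖ, Matrix.GeneralLinearGroup.mkOfDetNeZero, Matrix.mul_apply, Fin.sum_univ_two]
  have hd : (!![y, 0; 0, 1] : Matrix (Fin 2) (Fin 2) A).map (algebraMap A F) = !![x, 0; 0, 1] := by
    ext i j
    fin_cases i <;> fin_cases j <;> simp [hy]
  have hz : ∀ (m : ℤ) (g : Matrix.GeneralLinearGroup (Fin 2) F),
      ((ϖ ^ m * g : Matrix.GeneralLinearGroup (Fin 2) F) : Matrix (Fin 2) (Fin 2) F) =
        x ^ m • g.1 := by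
    intro m g
    rw [hϖ, ← map_zpow, Units.val_mul, Matrix.GeneralLinearGroup.coe_scalar,
      Units.val_zpow_eq_zpow_val, Units.val_mk0, Matrix.scalar_apply, Matrix.smul_eq_diagonal_mul]
  rw [ha, mul_assoc (ϖ ^ n), mul_assoc (ϖ ^ n), ← mul_assoc _ (ϖ ^ (-1 : ℤ)),
    ← hc, mul_assoc (ϖ ^ (-1 : ℤ)), mul_assoc (ϖ ^ (-1 : ℤ)),
    ← mul_assoc, ← zpow_add, ← sub_eq_add_neg, hz, Matrix.map_mul, Matrix.map_mul, hd]
  rfl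

/-- The integral matrices in a double coset, and the power of `y`, are determined by their
product. -/
theorem smul_map_inj [IsFractionRing A F] (y : A) (hy : Prime y) (m m' : ℤ) (u u' : Aˣ)
    (M M' : Matrix (Fin 2) (Fin 2) A) (hM : M.det = y * u) (hM' : M'.det = y * u')
    (h : (algebraMap A F y) ^ m • M.map (algebraMap A F) =
      (algebraMap A F y) ^ m' • M'.map (algebraMap A F)) : m = m' ∧ M = M' := by
  have hinj := IsFractionRing.injective A F
  have hx : algebraMap A F y ≠ 0 := fun h0 => hy.ne_zero (hinj (by simpa using h0))
  have key : ∀ (n : ℕ) (v v' : Aˣ), algebraMap A F y ^ n * algebraMap A F v = algebraMap A F v' →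
      n = 0 := by
    intro n v v' hv
    by_contra hn
    apply hy.not_isUnit
    rw [← map_pow, ← map_mul] at hv
    have := hinj hv
    have h1 : y ∣ (v' : A) := this ▸ Dvd.dvd.mul_right (dvd_pow_self y hn) _
    exact isUnit_of_dvd_unit h1 v'.isUnit
  have hdet := congrArg Matrix.det h
  rw [Matrix.det_smul, Matrix.det_smul, ← RingHom.mapMatrix_apply, ← RingHom.mapMatrix_apply,
    ← RingHom.map_det, ← RingHom.map_det, hM, hM', map_mul, map_mul, Fintype.card_fin] at hdet
  have hdet' : algebraMap A F y ^ (2 * m) * algebraMap A F u =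
      algebraMap A F y ^ (2 * m') * algebraMap A F u' := by
    have e : ∀ a : ℤ, algebraMap A F y ^ (2 * a) = (algebraMap A F y ^ a) ^ 2 := by
      intro a
      rw [mul_comm, zpow_mul]
      norm_cast
    rw [e, e]
    apply mul_right_cancel₀ hx
    linear_combination hdet
  have hmm : m = m' := by
    rcases le_total m m' with hl | hl
    · obtain ⟨n, hn⟩ := Int.le.dest hl
      have := key (2 * n) u' u (by
        rw [← hn, mul_add, zpow_add₀ hx, mul_assoc] at hdet'
        have h2 := mul_left_cancel₀ (zpow_ne_zero _ hx) hdet'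
        rw [h2]
        norm_cast)
      omega
    · obtain ⟨n, hn⟩ := Int.le.dest hl
      have := key (2 * n) u u' (by
        rw [← hn, mul_add, zpow_add₀ hx, mul_assoc] at hdet'
        have h2 := mul_left_cancel₀ (zpow_ne_zero _ hx) hdet'
        rw [← h2]
        norm_cast)
      omega
  subst hmm
  refine ⟨rfl, ?_⟩
  have h3 := smul_right_injective _ (zpow_ne_zero m hx) h
  exact Matrix.map_injective hinj h3

/-- Two integral matrices of determinant `y` times a unit that agree modulo `y` differ by left
multiplication by an invertible integral matrix. -/
theorem exists_unit_mul_eq [IsDomain A] (y : A) (hy : y ≠ 0) (u u' : Aˣ)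
    (M M' N : Matrix (Fin 2) (Fin 2) A) (hM : M.det = y * u) (hM' : M'.det = y * u')
    (hN : M = M' + y • N) : ∃ k : Matrix.GeneralLinearGroup (Fin 2) A, M = k.1 * M' := by
  set B : Matrix (Fin 2) (Fin 2) A := 1 + (↑u'⁻¹ : A) • (N * M'.adjugate) with hB
  have hBM : M = B * M' := by
    rw [hB, add_mul, one_mul, Matrix.smul_mul, Matrix.mul_assoc, Matrix.adjugate_mul, hM', hN,
      Matrix.mul_smul, Matrix.mul_one, smul_smul]
    congr 2
    rw [mul_comm y, ← mul_assoc, Units.inv_mul, one_mul]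
  have hdet : IsUnit B.det := by
    have h1 := congrArg Matrix.det hBM
    rw [Matrix.det_mul, hM, hM', mul_left_comm] at h1
    have h2 : (u : A) = B.det * u' := mul_left_cancel₀ hy h1
    exact isUnit_of_mul_isUnit_left (h2 ▸ u.isUnit)
  exact ⟨Matrix.GeneralLinearGroup.mk'' B hdet, hBM⟩

end DoubleCoset

section HeckeOperator

variable {p : ℕ} [Fact p.Prime]

/-- The matrix `diag(p, 1)`: it acts on polynomials by `v(X_i, Y_i) ↦ v(p X_i, Y_i)`. -/
noncomputable def diagP (p : ℕ) [Fact p.Prime] : Matrix (Fin 2) (Fin 2) (Zq p) :=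
  !![(p : Zq p), 0; 0, 1]

theorem det_diagP (k k' : K p) :
    (k.1 * diagP p * k'.1).det =
    (p : Zq p) * ((Matrix.GeneralLinearGroup.det (k * k') : (Zq p)ˣ) : Zq p) := by
  rw [Matrix.det_mul, Matrix.det_mul, map_mul, Units.val_mul]
  simp only [diagP, Matrix.det_fin_two_of, mul_one, mul_zero, sub_zero,
    Matrix.GeneralLinearGroup.val_det_apply]
  ring

theorem coe_doubleCoset (n : ℤ) (k k' : K p) :
    ((pScalar p ^ n * toG p k * (alpha p)⁻¹ * toG p k' : G p) : Matrix (Fin 2) (Fin 2) (Qq p)) =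
      (algebraMap (Zq p) (Qq p) p) ^ (n - 1) •
        (k.1 * diagP p * k'.1).map (algebraMap (Zq p) (Qq p)) := by
  have h := coe_doubleCoset_aux (A := Zq p) (p : Qq p) (p_ne_zero p) (p : Zq p) (map_natCast _ _)
    (by simpa [Matrix.det_fin_two] using p_ne_zero p) n k k'
  rw [map_natCast]
  exact h

theorem doubleCoset_inj {n m : ℤ} {k k' l l' : K p}
    (h : pScalar p ^ n * toG p k * (alpha p)⁻¹ * toG p k' =
      pScalar p ^ m * toG p l * (alpha p)⁻¹ * toG p l') :
    n = m ∧ k.1 * diagP p * k'.1 = l.1 * diagP p * l'.1 := by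
  have h1 := congrArg (fun g : G p => (g : Matrix (Fin 2) (Fin 2) (Qq p))) h
  simp only [coe_doubleCoset] at h1
  have h2 := smul_map_inj (p : Zq p) (WittVector.irreducible p).prime _ _ _ _ _ _
    (det_diagP k k') (det_diagP l l') h1
  exact ⟨by omega, h2.2⟩

variable (R : Type*) [CommRing R] [Algebra (Zq p) R] (r : Fin 2 → ℕ) (s : ℕ)

open Classical in
/-- The function `φ : G → End_R(V)`, `V = (Sym^{r₀} R² ⊗ Sym^{r₁} R²) ⊗ D^s`, supported on
`KZ α⁻¹ KZ`, with `φ(h α⁻¹ h') = h ∘ φ(α⁻¹) ∘ h'` for `h, h' ∈ KZ` and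
`φ(α⁻¹) v(X_i, Y_i) = v(p X_i, Y_i)`. -/
noncomputable def heckeFun (g : G p) : Module.End R (Sym R r) :=
  if h : ∃ x : ℤ × K p × K p,
      g = pScalar p ^ x.1 * toG p x.2.1 * (alpha p)⁻¹ * toG p x.2.2 then
    symRep R r s h.choose.2.1 * matAct R r (diagP p) * symRep R r s h.choose.2.2
  else 0

theorem heckeFun_apply (n : ℤ) (k k' : K p) :
    heckeFun R r s (pScalar p ^ n * toG p k * (alpha p)⁻¹ * toG p k') =
      symRep R r s k * matAct R r (diagP p) * symRep R r s k' := by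
  have h : ∃ x : ℤ × K p × K p, pScalar p ^ n * toG p k * (alpha p)⁻¹ * toG p k' =
      pScalar p ^ x.1 * toG p x.2.1 * (alpha p)⁻¹ * toG p x.2.2 := ⟨(n, k, k'), rfl⟩
  rw [heckeFun, dif_pos h]
  obtain ⟨-, h2⟩ := doubleCoset_inj h.choose_spec
  have h3 := congrArg Matrix.det h2
  rw [det_diagP, det_diagP] at h3
  have h4 := mul_left_cancel₀ (WittVector.p_nonzero p (GaloisField p 2)) h3
  have e : ∀ l l' : K p, symRep R r s l * matAct R r (diagP p) * symRep R r s l' =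
      (algebraMap (Zq p) R ((Matrix.GeneralLinearGroup.det (l * l') : (Zq p)ˣ) : Zq p)) ^ s •
        matAct R r (l.1 * diagP p * l'.1) := by
    intro l l'
    rw [map_mul (matAct R r), map_mul (matAct R r), map_mul Matrix.GeneralLinearGroup.det,
      Units.val_mul, map_mul (algebraMap (Zq p) R), mul_pow]
    simp only [symRep, MonoidHom.coe_mk, OneHom.coe_mk, smul_mul_assoc, mul_smul_comm, smul_smul,
      Matrix.GeneralLinearGroup.val_det_apply]
    rw [mul_comm]
  rw [e, e, ← h2, ← h4]

theorem heckeFun_mul_left (n : ℤ) (k : K p) (g : G p) :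
    heckeFun R r s (pScalar p ^ n * toG p k * g) = symRep R r s k * heckeFun R r s g := by
  have e : ∀ (n : ℤ) (k : K p) (x : ℤ × K p × K p), pScalar p ^ n * toG p k *
      (pScalar p ^ x.1 * toG p x.2.1 * (alpha p)⁻¹ * toG p x.2.2) =
      pScalar p ^ (n + x.1) * toG p (k * x.2.1) * (alpha p)⁻¹ * toG p x.2.2 := by
    rintro n k ⟨m, l, l'⟩
    simp only [map_mul, zpow_add, mul_assoc]
    rw [← mul_assoc (toG p k) (pScalar p ^ m), ← pScalar_zpow_comm]
    simp only [mul_assoc]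
  by_cases h : ∃ x : ℤ × K p × K p,
      g = pScalar p ^ x.1 * toG p x.2.1 * (alpha p)⁻¹ * toG p x.2.2
  · obtain ⟨x, rfl⟩ := h
    rw [e, heckeFun_apply, heckeFun_apply, map_mul]
    simp only [mul_assoc]
  · have h' : ¬ ∃ x : ℤ × K p × K p, pScalar p ^ n * toG p k * g =
        pScalar p ^ x.1 * toG p x.2.1 * (alpha p)⁻¹ * toG p x.2.2 := by
      rintro ⟨x, hx⟩
      refine h ⟨(-n + x.1, k⁻¹ * x.2.1, x.2.2), ?_⟩
      rw [← e, ← hx, map_inv, pScalar_zpow_comm]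
      simp only [zpow_neg, mul_assoc]
      rw [← mul_assoc _ (pScalar p ^ n), inv_mul_cancel, one_mul, inv_mul_cancel_left]
    rw [heckeFun, heckeFun, dif_neg h, dif_neg h', mul_zero]

theorem heckeFun_mul_right (n : ℤ) (k : K p) (g : G p) :
    heckeFun R r s (g * (pScalar p ^ n * toG p k)) = heckeFun R r s g * symRep R r s k := by
  have e : ∀ (n : ℤ) (k : K p) (x : ℤ × K p × K p),
      (pScalar p ^ x.1 * toG p x.2.1 * (alpha p)⁻¹ * toG p x.2.2) * (pScalar p ^ n * toG p k) =
      pScalar p ^ (n + x.1) * toG p x.2.1 * (alpha p)⁻¹ * toG p (x.2.2 * k) := by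
    rintro n k ⟨m, l, l'⟩
    rw [← mul_assoc, ← pScalar_zpow_comm]
    simp only [map_mul, zpow_add, mul_assoc]
  by_cases h : ∃ x : ℤ × K p × K p,
      g = pScalar p ^ x.1 * toG p x.2.1 * (alpha p)⁻¹ * toG p x.2.2
  · obtain ⟨x, rfl⟩ := h
    rw [e, heckeFun_apply, heckeFun_apply, map_mul]
    simp only [mul_assoc]
  · have h' : ¬ ∃ x : ℤ × K p × K p, g * (pScalar p ^ n * toG p k) =
        pScalar p ^ x.1 * toG p x.2.1 * (alpha p)⁻¹ * toG p x.2.2 := by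
      rintro ⟨x, hx⟩
      refine h ⟨(-n + x.1, x.2.1, x.2.2 * k⁻¹), ?_⟩
      rw [← e, ← hx, map_inv, pScalar_zpow_comm (p := p) (-n)]
      simp only [zpow_neg, mul_assoc]
      rw [mul_inv_cancel_left, mul_inv_cancel, mul_one]
    rw [heckeFun, heckeFun, dif_neg h, dif_neg h', zero_mul]

/-- The double coset `KZ α⁻¹ KZ` is a finite union of cosets `KZ x`. -/
theorem exists_finset_doubleCoset (p : ℕ) [Fact p.Prime] : ∃ S : Finset (G p),
    ∀ (n : ℤ) (k k' : K p), ∃ x ∈ S,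
      (pScalar p ^ n * toG p k * (alpha p)⁻¹ * toG p k') * x⁻¹ ∈ KZ p := by
  classical
  let red : Matrix (Fin 2) (Fin 2) (Zq p) → Matrix (Fin 2) (Fin 2) (GaloisField p 2) :=
    fun M => M.map WittVector.constantCoeff
  have : Fintype (Matrix (Fin 2) (Fin 2) (GaloisField p 2)) := Fintype.ofFinite _
  let rep : Matrix (Fin 2) (Fin 2) (GaloisField p 2) → G p := fun c =>
    if h : ∃ x : K p × K p, red (x.1.1 * diagP p * x.2.1) = c then
      toG p h.choose.1 * (alpha p)⁻¹ * toG p h.choose.2 else 1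
  refine ⟨Finset.univ.image rep, fun n k k' => ?_⟩
  have h : ∃ x : K p × K p, red (x.1.1 * diagP p * x.2.1) = red (k.1 * diagP p * k'.1) :=
    ⟨(k, k'), rfl⟩
  refine ⟨rep (red (k.1 * diagP p * k'.1)), Finset.mem_image_of_mem _ (Finset.mem_univ _), ?_⟩
  have hr : rep (red (k.1 * diagP p * k'.1)) =
      toG p h.choose.1 * (alpha p)⁻¹ * toG p h.choose.2 := dif_pos h
  rw [hr]
  have hspec := h.choose_spec
  set l := h.choose.1
  set l' := h.choose.2
  have hN : ∀ i j, ∃ c : Zq p, (k.1 * diagP p * k'.1) i j - (l.1 * diagP p * l'.1) i j =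
      (p : Zq p) * c := by
    intro i j
    have h1 : WittVector.constantCoeff
        ((k.1 * diagP p * k'.1) i j - (l.1 * diagP p * l'.1) i j) = 0 := by
      rw [map_sub, sub_eq_zero]
      exact (congrFun (congrFun hspec i) j).symm
    have h2 : (k.1 * diagP p * k'.1) i j - (l.1 * diagP p * l'.1) i j ∈
        RingHom.ker (WittVector.constantCoeff : Zq p →+* GaloisField p 2) := h1
    rw [WittVector.ker_constantCoeff, Ideal.mem_span_singleton] at h2
    exact h2
  choose N hN using hN
  obtain ⟨m, hm⟩ := exists_unit_mul_eq (p : Zq p) (WittVector.p_nonzero p (GaloisField p 2)) _ _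
    (k.1 * diagP p * k'.1) (l.1 * diagP p * l'.1) (Matrix.of N) (det_diagP k k') (det_diagP l l')
    (by
      ext i j
      simp only [Matrix.add_apply, Matrix.smul_apply, Matrix.of_apply, smul_eq_mul, ← hN]
      ring_nf)
  refine ⟨n, m, ?_⟩
  rw [mul_inv_eq_iff_eq_mul]
  have e : pScalar p ^ n * toG p m * (toG p l * (alpha p)⁻¹ * toG p l') =
      pScalar p ^ n * toG p (m * l) * (alpha p)⁻¹ * toG p l' := by
    simp only [map_mul, mul_assoc]
  rw [e]
  apply Units.ext
  rw [coe_doubleCoset, coe_doubleCoset, hm, Units.val_mul]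
  simp only [mul_assoc]

theorem heckeSummand_mul (f : ind (symRep (p := p) R r s)) (g : G p) (n : ℤ) (k : K p) (y : G p) :
    heckeFun R r s (y * (pScalar p ^ n * toG p k)) (f.1 ((y * (pScalar p ^ n * toG p k))⁻¹ * g)) =
      heckeFun R r s y (f.1 (y⁻¹ * g)) := by
  have e : (y * (pScalar p ^ n * toG p k))⁻¹ * g =
      pScalar p ^ (-n) * toG p k⁻¹ * (y⁻¹ * g) := by
    rw [mul_inv_rev, mul_inv_rev, pScalar_zpow_comm, map_inv, zpow_neg, mul_assoc]
  rw [heckeFun_mul_right, e, f.2.1, Module.End.mul_apply, ← Module.End.mul_apply (symRep R r s k),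
    ← map_mul, mul_inv_cancel, map_one, Module.End.one_apply]

theorem heckeSummand_congr (f : ind (symRep (p := p) R r s)) (g : G p) {y y' : G p}
    (h : (y : G p ⧸ KZ p) = y') :
    heckeFun R r s y (f.1 (y⁻¹ * g)) = heckeFun R r s y' (f.1 (y'⁻¹ * g)) := by
  obtain ⟨n, k, hk⟩ := QuotientGroup.eq.mp h
  rw [← heckeSummand_mul R r s f g n k y, ← hk, mul_inv_cancel_left]

theorem heckeSummand_finite (f : ind (symRep (p := p) R r s)) (g : G p) :
    (Function.support fun c : G p ⧸ KZ p =>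
      heckeFun R r s c.out (f.1 (c.out⁻¹ * g))).Finite := by
  obtain ⟨S, hS⟩ := f.2.2
  refine (S.finite_toSet.image fun x => ((g * x⁻¹ : G p) : G p ⧸ KZ p)).subset ?_
  intro c hc
  have h0 : f.1 (c.out⁻¹ * g) ≠ 0 := fun h0 => hc (by simp only [h0, map_zero])
  obtain ⟨x, hx, hx'⟩ := hS _ h0
  refine ⟨x, hx, ?_⟩
  conv_rhs => rw [← QuotientGroup.out_eq' c]
  refine (QuotientGroup.eq.mpr ?_).symm
  rwa [← mul_assoc]

/-- The Hecke operator `T` on `ind_{KZ}^G V`, `V = (Sym^{r₀} R² ⊗ Sym^{r₁} R²) ⊗ D^s`, attached to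
the function `φ = heckeFun R r s`: it is given by
`(T f)(g) = ∑_{y ∈ G/KZ} φ(y) f(y⁻¹ g)`, that is by
`T [g, v] = ∑_{y ∈ G/KZ} [g y, φ(y⁻¹) v]`, where `[g, v]` is supported on `KZ g⁻¹` and
`[g, v](h g⁻¹) = h v` for `h ∈ KZ`. -/
noncomputable def heckeT : Module.End R (ind (symRep (p := p) R r s)) where
  toFun f := ⟨fun g => ∑ᶠ c : G p ⧸ KZ p, heckeFun R r s c.out (f.1 (c.out⁻¹ * g)), by
    constructor
    · intro n k g
      have h1 := (symRep R r s k).toAddMonoidHom.map_finsum (heckeSummand_finite R r s f g)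
      simp only [LinearMap.toAddMonoidHom_coe] at h1
      beta_reduce
      rw [h1, ← finsum_comp_equiv
        (MulAction.toPerm (pScalar p ^ n * toG p k : G p) : Equiv.Perm (G p ⧸ KZ p))
        (f := fun c : G p ⧸ KZ p => heckeFun R r s c.out
          (f.1 (c.out⁻¹ * (pScalar p ^ n * toG p k * g))))]
      refine finsum_congr fun c => ?_
      rw [← Module.End.mul_apply, ← heckeFun_mul_left R r s n k]
      have e : c.out⁻¹ * g =
          (pScalar p ^ n * toG p k * c.out)⁻¹ * (pScalar p ^ n * toG p k * g) := by
        rw [mul_inv_rev, mul_assoc, inv_mul_cancel_left]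
      rw [e]
      apply heckeSummand_congr
      rw [QuotientGroup.out_eq', MulAction.toPerm_apply]
      conv_lhs => rw [← QuotientGroup.out_eq' c]
      rfl
    · classical
      obtain ⟨S, hS⟩ := f.2.2
      obtain ⟨S', hS'⟩ := exists_finset_doubleCoset p
      refine ⟨Finset.image₂ (· * ·) S' S, fun g hg => ?_⟩
      obtain ⟨c, hc⟩ : ∃ c : G p ⧸ KZ p, heckeFun R r s c.out (f.1 (c.out⁻¹ * g)) ≠ 0 := by
        by_contra! h0
        exact hg ((finsum_congr h0).trans finsum_zero)
      have h0 : f.1 (c.out⁻¹ * g) ≠ 0 := fun h0 => hc (by simp only [h0, map_zero])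
      obtain ⟨x, hx, n, k, hxk⟩ := hS _ h0
      have h1 : heckeFun R r s c.out ≠ 0 := fun h0 => hc (by simp only [h0, LinearMap.zero_apply])
      have h2 : ∃ x : ℤ × K p × K p,
          c.out = pScalar p ^ x.1 * toG p x.2.1 * (alpha p)⁻¹ * toG p x.2.2 := by
        by_contra h2
        exact h1 (dif_neg h2)
      obtain ⟨⟨m, l, l'⟩, hl⟩ := h2
      obtain ⟨x', hx', hxx⟩ := hS' (m + n) l (l' * k)
      refine ⟨x' * x, Finset.mem_image₂_of_mem hx' hx, ?_⟩
      have e : g * (x' * x)⁻¹ =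
          pScalar p ^ (m + n) * toG p l * (alpha p)⁻¹ * toG p (l' * k) * x'⁻¹ := by
        have e1 : g = c.out * (c.out⁻¹ * g * x⁻¹) * x := by
          simp only [mul_assoc, inv_mul_cancel, mul_one, mul_inv_cancel_left]
        rw [e1, hxk, hl, ← mul_assoc _ (pScalar p ^ n), ← pScalar_zpow_comm, add_comm m n, zpow_add,
          map_mul, mul_inv_rev]
        simp only [mul_assoc, mul_inv_cancel_left]
      rwa [e]⟩
  map_add' f f' := by
    ext g : 2
    change ∑ᶠ c : G p ⧸ KZ p, heckeFun R r s c.out (f.1 (c.out⁻¹ * g) + f'.1 (c.out⁻¹ * g)) = _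
    simp only [map_add]
    exact finsum_add_distrib (heckeSummand_finite R r s f g) (heckeSummand_finite R r s f' g)
  map_smul' a f := by
    ext g : 2
    change ∑ᶠ c : G p ⧸ KZ p, heckeFun R r s c.out (a • f.1 (c.out⁻¹ * g)) = _
    simp only [map_smul]
    exact (smul_finsum' a (heckeSummand_finite R r s f g)).symm

end HeckeOperator

section Quotient

/-- The subrepresentation generated by a vector. -/
def generatedBy {k H V : Type*} [CommRing k] [Monoid H] [AddCommGroup V] [Module k V]
    (ρ : Representation k H V) (v : V) : Subrepresentation ρ where
  toSubmodule := Submodule.span k (Set.range fun h : H => ρ h v)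
  apply_mem_toSubmodule g w hw := by
    refine (Submodule.span_le (p := Submodule.comap (ρ g)
      (Submodule.span k (Set.range fun h : H => ρ h v)))).mpr ?_ hw
    rintro _ ⟨g', rfl⟩
    refine Submodule.subset_span ⟨g * g', ?_⟩
    simp only [map_mul, Module.End.mul_apply]

/-- The socle of a representation: the sum of its irreducible subrepresentations. -/
def socle {k H V : Type*} [Field k] [Monoid H] [AddCommGroup V] [Module k V]
    (ρ : Representation k H V) : Subrepresentation ρ where
  toSubmodule := ⨆ W : {W : Subrepresentation ρ // W.toRepresentation.IsIrreducible},
    W.1.toSubmodule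
  apply_mem_toSubmodule h v hv := by
    refine (iSup_le (a := Submodule.comap (ρ h) (⨆ W : {W : Subrepresentation ρ //
      W.toRepresentation.IsIrreducible}, W.1.toSubmodule)) fun W v hv => ?_) hv
    exact (le_iSup (fun W : {W : Subrepresentation ρ // W.toRepresentation.IsIrreducible} =>
      W.1.toSubmodule) W) (W.1.apply_mem_toSubmodule h hv)

variable {p : ℕ} [Fact p.Prime] (k : Type*) [Field k] [Algebra (Zq p) k] [CharP k p]

theorem algebraMap_eq_of_coeff {x y : Zq p}
    (h : WittVector.constantCoeff x = WittVector.constantCoeff y) :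
    algebraMap (Zq p) k x = algebraMap (Zq p) k y := by
  have h2 : x - y ∈ RingHom.ker (WittVector.constantCoeff : Zq p →+* GaloisField p 2) := by
    rw [RingHom.mem_ker, map_sub, h, sub_self]
  rw [WittVector.ker_constantCoeff, Ideal.mem_span_singleton] at h2
  obtain ⟨c, hc⟩ := h2
  rw [← sub_eq_zero, ← map_sub, hc, map_mul, map_natCast, CharP.cast_eq_zero, zero_mul]

theorem algebraMap_frobenius (x : Zq p) :
    algebraMap (Zq p) k (WittVector.frobenius x) = algebraMap (Zq p) k x ^ p := by
  rw [← map_pow]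
  apply algebraMap_eq_of_coeff
  rw [map_pow]
  exact WittVector.coeff_frobenius_charP p x 0

theorem algebraMap_pow_pow (x : Zq p) : (algebraMap (Zq p) k x ^ p) ^ p = algebraMap (Zq p) k x := by
  rw [← map_pow, ← map_pow]
  apply algebraMap_eq_of_coeff
  have : Fintype (GaloisField p 2) := Fintype.ofFinite _
  have hc : Fintype.card (GaloisField p 2) = p ^ 2 := by
    rw [← Nat.card_eq_fintype_card, GaloisField.card p 2 two_ne_zero]
  rw [map_pow, map_pow, ← pow_mul, ← sq, ← hc, FiniteField.pow_card]

/-- The generalized Dickson polynomial `θ_i = X_i Y_{i-1}^p - Y_i X_{i-1}^p`, with the index `i`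
taken modulo `2`. -/
noncomputable def theta (i : Fin 2) : Poly k :=
  MvPolynomial.X (i, 0) * MvPolynomial.X (i - 1, 1) ^ p -
    MvPolynomial.X (i, 1) * MvPolynomial.X (i - 1, 0) ^ p

theorem subst_theta (m : Matrix (Fin 2) (Fin 2) (Zq p)) (i : Fin 2) :
    ∃ c : k, subst k m (theta (p := p) k i) = MvPolynomial.C c * theta (p := p) k i := by
  have : ExpChar (Poly k) p := ExpChar.prime Fact.out
  have h1 : (0 : Fin 2) - 1 = 1 := rfl
  refine ⟨algebraMap (Zq p) k m.det ^ p ^ (i : ℕ), ?_⟩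
  fin_cases i
  · simp only [subst, theta, map_sub, map_mul, map_pow, MvPolynomial.aeval_X, Fin.sum_univ_two,
      Matrix.det_fin_two, add_pow_expChar, mul_pow, Fin.zero_eta, h1,
      Fin.val_zero, Fin.val_one, pow_zero, pow_one, RingHom.one_def, RingHom.id_apply,
      algebraMap_frobenius]
    have key : ∀ x : Zq p, ((MvPolynomial.C (algebraMap (Zq p) k x) : Poly k) ^ p) ^ p =
        MvPolynomial.C (algebraMap (Zq p) k x) := by
      intro x
      rw [← map_pow, ← map_pow, algebraMap_pow_pow]
    simp only [key]
    ring
  · have h2 : (1 : Fin 2) - 1 = 0 := rfl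
    simp only [subst, theta, map_sub, map_mul, map_pow, MvPolynomial.aeval_X, Fin.sum_univ_two,
      Matrix.det_fin_two, add_pow_expChar, mul_pow, Fin.mk_one, h2,
      Fin.val_zero, Fin.val_one, pow_zero, pow_one, RingHom.one_def, RingHom.id_apply,
      algebraMap_frobenius, sub_pow_expChar]
    ring

/-- The residue field of a local ring that is finite over `ℤ_{p²}` has characteristic `p`. -/
theorem charP_residueField (𝒪 : Type*) [CommRing 𝒪] [Algebra (Zq p) 𝒪] [IsLocalRing 𝒪]
    [Module.Finite (Zq p) 𝒪] :
    CharP (IsLocalRing.ResidueField 𝒪) p := by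
  have hp : ¬ IsUnit ((p : ℕ) : 𝒪) := by
    intro hu
    have hle : (⊤ : Submodule (Zq p) 𝒪) ≤ Ideal.span {(p : Zq p)} • (⊤ : Submodule (Zq p) 𝒪) := by
      intro x _
      obtain ⟨y, hy⟩ := hu.exists_right_inv
      have : x = (p : Zq p) • (y * x) := by
        rw [Algebra.smul_def, map_natCast, ← mul_assoc, hy, one_mul]
      rw [this]
      exact Submodule.smul_mem_smul (Ideal.mem_span_singleton_self _) Submodule.mem_top
    have hj : Ideal.span {(p : Zq p)} ≤ Ideal.jacobson ⊥ := by
      rw [IsLocalRing.jacobson_eq_maximalIdeal _ bot_ne_top, Ideal.span_singleton_le_iff_mem]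
      exact (WittVector.irreducible p).not_isUnit
    have h0 := Submodule.eq_bot_of_le_smul_of_le_jacobson_bot _ _ Module.Finite.fg_top hle hj
    have h1 : (1 : 𝒪) ∈ (⊤ : Submodule (Zq p) 𝒪) := Submodule.mem_top
    rw [h0, Submodule.mem_bot] at h1
    exact one_ne_zero h1
  have hz : ((p : ℕ) : IsLocalRing.ResidueField 𝒪) = 0 := by
    rw [← map_natCast (IsLocalRing.residue 𝒪), IsLocalRing.residue_eq_zero_iff]
    exact hp
  exact (CharP.charP_iff_prime_eq_zero Fact.out).mpr hz

/-- The monomial `X₀^{r₀} X₁^{r₁}`. -/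
noncomputable def topMonomial (r : Fin 2 → ℕ) : Sym k r :=
  ⟨∏ i, MvPolynomial.X (i, 0) ^ r i, by
    have h : ∑ i, r i • bideg (i, 0) = r := by
      ext j
      fin_cases j <;> simp [bideg, Fin.sum_univ_two]
    rw [MvPolynomial.mem_weightedHomogeneousSubmodule]
    nth_rw 2 [← h]
    exact MvPolynomial.IsWeightedHomogeneous.prod _ _ _ fun i _ =>
      (MvPolynomial.isWeightedHomogeneous_X k bideg (i, 0)).pow _⟩

open IsLocalRing

variable (𝒪 : Type*) [CommRing 𝒪] [Algebra (Zq p) 𝒪] [IsLocalRing 𝒪] [Module.Finite (Zq p) 𝒪]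

/-- `V_r^*`: the polynomials in `V_r = Sym^{r₀} k² ⊗ Sym^{r₁} k²` that are combinations
`θ₀ P₀ + θ₁ P₁`. -/
noncomputable def Vstar (r : Fin 2 → ℕ) :
    Subrepresentation (symRep (p := p) (ResidueField 𝒪) r 0) where
  toSubmodule := ((Ideal.span (Set.range (theta (p := p) (ResidueField 𝒪)))).restrictScalars
    (ResidueField 𝒪)).comap (Sym.toPoly (ResidueField 𝒪) r)
  apply_mem_toSubmodule g v hv := by
    have := charP_residueField (p := p) 𝒪
    have h : Ideal.span (Set.range (theta (p := p) (ResidueField 𝒪))) ≤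
        (Ideal.span (Set.range (theta (p := p) (ResidueField 𝒪)))).comap
          (subst (ResidueField 𝒪) g.1) := by
      rw [Ideal.span_le]
      rintro _ ⟨i, rfl⟩
      obtain ⟨c, hc⟩ := subst_theta (ResidueField 𝒪) g.1 i
      rw [SetLike.mem_coe, Ideal.mem_comap, hc]
      exact Ideal.mul_mem_left _ _ (Ideal.subset_span ⟨i, rfl⟩)
    have e : ((symRep (p := p) (ResidueField 𝒪) r 0 g v).1 : Poly (ResidueField 𝒪)) =
        subst (ResidueField 𝒪) g.1 v.1 := by
      simp only [symRep, MonoidHom.coe_mk, OneHom.coe_mk, pow_zero, one_smul]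
      rfl
    change (symRep (p := p) (ResidueField 𝒪) r 0 g v).1 ∈
      Ideal.span (Set.range (theta (p := p) (ResidueField 𝒪)))
    rw [e]
    exact h hv

/-- `X_r`: the subrepresentation of `V_r` generated by `X₀^{r₀} X₁^{r₁}`. -/
noncomputable def Xr (r : Fin 2 → ℕ) : Subrepresentation (symRep (p := p) (ResidueField 𝒪) r 0) :=
  generatedBy (symRep (p := p) (ResidueField 𝒪) r 0) (topMonomial (ResidueField 𝒪) r)

/-- `V_r^* + X_r`. -/
noncomputable def kerQ (r : Fin 2 → ℕ) : Subrepresentation (symRep (p := p) (ResidueField 𝒪) r 0) :=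
  Vstar 𝒪 r ⊔ Xr 𝒪 r

/-- The representation `Q = V_r / (V_r^* + X_r)` of `K`. -/
noncomputable def repQ (r : Fin 2 → ℕ) :
    Representation (ResidueField 𝒪) (K p)
      (Sym (ResidueField 𝒪) r ⧸ (kerQ (p := p) 𝒪 r).toSubmodule) :=
  (symRep (ResidueField 𝒪) r 0).quotient (kerQ 𝒪 r).toSubmodule fun g _ hv =>
    (kerQ 𝒪 r).apply_mem_toSubmodule g hv

end Quotient

section Lattice

variable {p : ℕ} [Fact p.Prime]

/-- Extension of coefficients `Sym^{r₀} S² ⊗ Sym^{r₁} S² → Sym^{r₀} R² ⊗ Sym^{r₁} R²` along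
`S → R`. -/
noncomputable def coeffMap (S R : Type*) [CommRing S] [CommRing R] [Algebra S R] (r : Fin 2 → ℕ) :
    Sym S r →ₗ[S] Sym R r where
  toFun v := ⟨MvPolynomial.map (algebraMap S R) v.1, fun d hd => v.2 fun h0 => hd (by
    rw [MvPolynomial.coeff_map, h0, map_zero])⟩
  map_add' v w := Subtype.ext (map_add _ _ _)
  map_smul' a v := Subtype.ext (by
    change MvPolynomial.map (algebraMap S R) (a • v.1) = a • MvPolynomial.map (algebraMap S R) v.1
    rw [MvPolynomial.smul_eq_C_mul, map_mul, MvPolynomial.map_C, ← MvPolynomial.smul_eq_C_mul,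
      algebraMap_smul])

theorem coeffMap_symRep (S R : Type*) [CommRing S] [CommRing R] [Algebra S R] [Algebra (Zq p) S]
    [Algebra (Zq p) R] [IsScalarTower (Zq p) S R] (r : Fin 2 → ℕ) (s : ℕ) (g : K p) (v : Sym S r) :
    coeffMap S R r (symRep S r s g v) = symRep R r s g (coeffMap S R r v) := by
  have h : ∀ w : Poly S, MvPolynomial.map (algebraMap S R) (subst S g.1 w) =
      subst R g.1 (MvPolynomial.map (algebraMap S R) w) := by
    intro w
    induction w using MvPolynomial.induction_on with
    | C a => simp [subst]
    | add a b ha hb => simp only [map_add, ha, hb]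
    | mul_X a x ha =>
      rw [map_mul, map_mul, map_mul, map_mul, ha]
      simp only [subst, MvPolynomial.map_X, MvPolynomial.aeval_X, map_sum, map_mul,
        MvPolynomial.map_C, ← IsScalarTower.algebraMap_apply]
  have e : ∀ a : Zq p, ∀ w : Sym S r, coeffMap S R r (algebraMap (Zq p) S a ^ s • w) =
      algebraMap (Zq p) R a ^ s • coeffMap S R r w := by
    intro a w
    rw [map_smul, IsScalarTower.algebraMap_apply (Zq p) S R, ← map_pow (algebraMap S R),
      algebraMap_smul]
  refine (e _ _).trans (congrArg _ ?_)
  exact Subtype.ext (h v.1)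

variable (𝒪 E : Type*) [CommRing 𝒪] [Field E] [Algebra 𝒪 E] [Algebra (Zq p) 𝒪] [Algebra (Zq p) E]
  [IsScalarTower (Zq p) 𝒪 E]

/-- `Π_{k, a_p} = ind_{KZ}^G (Sym^{r₀} E² ⊗ Sym^{r₁} E²) / (T - a_p)`, where `k_i = r_i + 2`. -/
abbrev PiRep (p : ℕ) [Fact p.Prime] (E : Type*) [Field E] [Algebra (Zq p) E] (r : Fin 2 → ℕ)
    (a : E) : Type _ :=
  ind (symRep (p := p) E r 0) ⧸
    LinearMap.range (heckeT (p := p) E r 0 - a • (1 : Module.End E (ind (symRep (p := p) E r 0))))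

/-- The map `ind_{KZ}^G (Sym^{r₀} 𝒪² ⊗ Sym^{r₁} 𝒪²) → Π_{k, a_p}`. -/
noncomputable def toPi (r : Fin 2 → ℕ) (a : E) : ind (symRep (p := p) 𝒪 r 0) →ₗ[𝒪] PiRep p E r a :=
  ((Submodule.mkQ (LinearMap.range (heckeT (p := p) E r 0 -
    a • (1 : Module.End E (ind (symRep (p := p) E r 0)))))).restrictScalars 𝒪).comp
    (indMap (symRep 𝒪 r 0) (symRep E r 0) (coeffMap 𝒪 E r) (coeffMap_symRep 𝒪 E r 0))

/-- `Θ_{k, a_p}`: the image of `ind_{KZ}^G (Sym^{r₀} 𝒪² ⊗ Sym^{r₁} 𝒪²)` in `Π_{k, a_p}`. -/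
noncomputable abbrev Theta (p : ℕ) [Fact p.Prime] [Algebra (Zq p) 𝒪] [Algebra (Zq p) E]
    [IsScalarTower (Zq p) 𝒪 E] (r : Fin 2 → ℕ) (a : E) : Submodule 𝒪 (PiRep p E r a) :=
  LinearMap.range (toPi (p := p) 𝒪 E r a)

/-- The reduction `Θ̄_{k, a_p} = k_E ⊗_𝒪 Θ_{k, a_p}`, where `k_E` is the residue field of `𝒪`. -/
abbrev ThetaBar (p : ℕ) [Fact p.Prime] [IsLocalRing 𝒪] [Algebra (Zq p) 𝒪] [Algebra (Zq p) E]
    [IsScalarTower (Zq p) 𝒪 E] (r : Fin 2 → ℕ) (a : E) : Type _ :=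
  IsLocalRing.ResidueField 𝒪 ⊗[𝒪] Theta 𝒪 E p r a

/-- The canonical map `ind_{KZ}^G (Sym^{r₀} 𝒪² ⊗ Sym^{r₁} 𝒪²) → Θ̄_{k, a_p}`. -/
noncomputable def toThetaBar [IsLocalRing 𝒪] (r : Fin 2 → ℕ) (a : E) :
    ind (symRep (p := p) 𝒪 r 0) →ₗ[𝒪] ThetaBar 𝒪 E p r a :=
  (TensorProduct.mk 𝒪 (IsLocalRing.ResidueField 𝒪) (Theta 𝒪 E p r a) 1).comp
    (toPi (p := p) 𝒪 E r a).rangeRestrict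

/-- The map `ind_{KZ}^G (Sym^{r₀} 𝒪² ⊗ Sym^{r₁} 𝒪²) → ind_{KZ}^G Q` given by reduction to the residue
field followed by the projection `V_r → Q`. -/
noncomputable def toIndQ (p : ℕ) [Fact p.Prime] [Algebra (Zq p) 𝒪] [IsLocalRing 𝒪]
    [Module.Finite (Zq p) 𝒪] (r : Fin 2 → ℕ) :
    ind (symRep (p := p) 𝒪 r 0) →ₗ[𝒪] ind (repQ (p := p) 𝒪 r) :=
  indMap _ _
    (((kerQ (p := p) 𝒪 r).toSubmodule.mkQ.restrictScalars 𝒪).comp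
      (coeffMap 𝒪 (IsLocalRing.ResidueField 𝒪) r)) fun g v => by
    simp only [LinearMap.comp_apply, coeffMap_symRep]
    rfl

/-- The map `ind_{KZ}^G W → ind_{KZ}^G V` for a subrepresentation `W` of `V` and a `K`-equivariant
isomorphism `ι` from `W'` to `W`. -/
noncomputable def indSub {k V W' : Type*} [CommRing k] [AddCommGroup V] [Module k V]
    [AddCommGroup W'] [Module k W'] {ρ : Representation k (K p) V} {ρ' : Representation k (K p) W'}
    (W : Subrepresentation ρ) (ι : ρ'.Equiv W.toRepresentation) : ind ρ' →ₗ[k] ind ρ :=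
  (indMap W.toRepresentation ρ W.toSubmodule.subtype fun _ _ => rfl).comp
    (indMap ρ' W.toRepresentation ι.toLinearMap fun g v =>
      LinearMap.congr_fun (ι.isIntertwining' g) v)

/-- The valuation on a discrete valuation ring, normalized so that `p` has valuation `1`. -/
noncomputable def normVal (p : ℕ) {𝒪 : Type*} [CommRing 𝒪] [IsDomain 𝒪]
    [IsDiscreteValuationRing 𝒪] (x : 𝒪) : ENNReal :=
  (IsDiscreteValuationRing.addVal 𝒪 x : ENNReal) /
    (IsDiscreteValuationRing.addVal 𝒪 (p : 𝒪) : ENNReal)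

end Lattice

end HeckeGL2

/-! Write `q = p²`, `w` for the permutation matrix, `u(x)` for the lower unipotent matrix with entry
the Teichmüller lift of `x`, `[g, v]` for the function supported on `KZ g⁻¹` with value `v` at
`g⁻¹`, and `Y^r = Y₀^{r₀} Y₁^{r₁}`, `X^r = X₀^{r₀} X₁^{r₁}`. The Hecke operator sends `[g, v]` to
the sum of the `[g κ α, diag(p,1) κ⁻¹ v]` for `κ = w` and `κ = u(x)`, `x ∈ 𝔽_q`. Modulo `p` the
matrix `diag(p,1) κ⁻¹` turns a polynomial into a value of it times `Y^r`, the value being taken at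
`X_i = x^{p^i}`, `Y_i = y^{p^i}` for a point `(x, y)` of `𝔽_q²`. So modulo `p` the operator sees a
polynomial only as a function on `𝔽_q²`.

Factorization through `Q`. Let `kill` be the kernel of the map from the integral induction to `Θ̄`.
It contains the multiples of the maximal ideal and every `f` with `(T - a) F = c f`, `c ≠ 0`. A
polynomial `δ` that reduces to a function supported on the line `y = 0` gives `T[g, δ] ≡ [g w α,
Y^r]` modulo `p`, so all `[g, Y^r]`, and their translates `[g, h X^r]`, lie in `kill`
(`br_mon_zero_mem_kill`). If `v` lifts an element of `V_r^*`, it vanishes as a function, so `T[g,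
v]` is divisible by `p`; since `v(a) < 1`, dividing `(T - a)[g, v]` by `a` puts `[g, v]` in `kill`
(`br_binom_mem_kill`).

The socle. As `r_i ≥ q`, `V_r^*` is exactly the kernel of the passage to functions
(`mem_Vstar_iff`), and `X_r` yields the functions `x^{pj} y^{p(a₁-j)}`. Hence `Q` is a space of
functions, with a basis of eigenvectors `x^e y^{r₀+pr₁-e}` of the torus. Averaging over the torus
and over unipotents shows that each nonzero subrepresentation contains the vector `e = 1`
(`cls_monB_one_mem`). Integrating `f · (Y₀ dX₀ - X₀ dY₀)` embeds `(p-2, a₁-1) ⊗ D` in `Q`: the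
1-form scales by the determinant, and the constants of integration are functions that vanish in `Q`
(`evSym_antideriv_sub_mem`). The image is generated by the vector `e = 1`, so it is the smallest
nonzero subrepresentation, that is, the socle.

The Hecke operator on the socle. The source of the embedding is generated by `Y₀^{p-2} Y₁^{a₁-1}`,
on which the term of `w` vanishes; so it suffices that `S = ∑_x [g u(x) α, X₀ Y₀^{r₀-1} Y₁^{r₁}]`
lies in `kill` (`sum_br_mem_kill`). Take `P = ∑_μ μ^{q-pa₁} u(μ) X^r` with Teichmüller coefficients.
Power sums over `𝔽_q` show that `T[g, P]` is `-p r₀ S` modulo `p²`, up to `p` times brackets of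
`Y^r`. A correction `a F₂`, with `F₂` built from `δ` and `T F₂ ≡ [g, P]` modulo `p`, cancels `-a [g,
P]` at the price of `a² F₂`, which is harmless after division by `p` because `v(a) > 1/2`. As `r₀`
is a unit, `S` lies in `kill`. -/

namespace HeckeGL2

/-! ### Elementary functions `[g, v]` of the compact induction. -/

section Bracket

variable {p : ℕ} [Fact p.Prime]

/-- This is the directness of `KZ = p^ℤ × K`; it makes the value of `brFun` independent of the
chosen decomposition. -/
theorem pScalar_zpow_mul_toG_inj {n m : ℤ} {k l : K p}
    (h : pScalar p ^ n * toG p k = pScalar p ^ m * toG p l) : n = m ∧ k = l := by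
  have h1 : pScalar p ^ n * toG p k * (alpha p)⁻¹ * toG p 1 =
      pScalar p ^ m * toG p l * (alpha p)⁻¹ * toG p 1 := by rw [h]
  obtain ⟨rfl, -⟩ := doubleCoset_inj h1
  refine ⟨rfl, ?_⟩
  have h2 := mul_left_cancel h
  apply Units.ext
  have h3 := congrArg (fun g : G p => (g : Matrix (Fin 2) (Fin 2) (Qq p))) h2
  exact Matrix.map_injective (IsFractionRing.injective (Zq p) (Qq p)) h3

section
variable {R V : Type*} [CommRing R] [AddCommGroup V] [Module R V] (ρ : Representation R (K p) V)

open Classical in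
/-- The underlying function of `[g, v]`. -/
noncomputable def brFun (g : G p) (v : V) (x : G p) : V :=
  if h : ∃ y : ℤ × K p, x * g = pScalar p ^ y.1 * toG p y.2 then ρ h.choose.2 v else 0

variable {ρ}

theorem brFun_eq {g x : G p} {n : ℤ} {k : K p} (v : V) (hx : x * g = pScalar p ^ n * toG p k) :
    brFun ρ g v x = ρ k v := by
  have h : ∃ y : ℤ × K p, x * g = pScalar p ^ y.1 * toG p y.2 := ⟨(n, k), hx⟩
  rw [brFun, dif_pos h]
  rw [(pScalar_zpow_mul_toG_inj (h.choose_spec.symm.trans hx)).2]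

theorem brFun_eq_zero {g x : G p} (v : V)
    (hx : ∀ (n : ℤ) (k : K p), x * g ≠ pScalar p ^ n * toG p k) : brFun ρ g v x = 0 := by
  rw [brFun, dif_neg]
  rintro ⟨y, hy⟩
  exact hx _ _ hy

theorem zpow_mul_assoc (n m : ℤ) (k l : K p) :
    pScalar p ^ n * toG p k * (pScalar p ^ m * toG p l) =
      pScalar p ^ (n + m) * toG p (k * l) := by
  rw [zpow_add, map_mul, mul_assoc, ← mul_assoc (toG p k), ← pScalar_zpow_comm]
  simp only [mul_assoc]

theorem zpow_inv_mul (n : ℤ) (k : K p) (x : G p) :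
    pScalar p ^ (-n) * toG p k⁻¹ * (pScalar p ^ n * toG p k * x) = x := by
  rw [← mul_assoc, zpow_mul_assoc]
  simp

variable (ρ)

/-- The function `[g, v]` in `ind_{KZ}^G V`, supported on `KZ g⁻¹`, with `[g, v](h g⁻¹) = h v`. -/
noncomputable def br (g : G p) : V →ₗ[R] ind ρ where
  toFun v := ⟨brFun ρ g v, by
    constructor
    · intro n k x
      by_cases h : ∃ (m : ℤ) (l : K p), x * g = pScalar p ^ m * toG p l
      · obtain ⟨m, l, hl⟩ := h
        rw [brFun_eq v hl, brFun_eq (n := n + m) (k := k * l) v, map_mul, Module.End.mul_apply]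
        rw [mul_assoc, hl, zpow_mul_assoc]
      · push Not at h
        rw [brFun_eq_zero v h, map_zero, brFun_eq_zero v]
        intro m l hl
        apply h (-n + m) (k⁻¹ * l)
        rw [← zpow_mul_assoc, ← hl, mul_assoc _ x g, zpow_inv_mul]
    · refine ⟨{g⁻¹}, fun x hx => ⟨g⁻¹, Finset.mem_singleton_self _, ?_⟩⟩
      by_contra h
      refine hx (brFun_eq_zero v fun n k hk => h ⟨n, k, ?_⟩)
      rw [inv_inv, hk]⟩
  map_add' v w := by
    ext x
    change brFun ρ g (v + w) x = brFun ρ g v x + brFun ρ g w x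
    by_cases h : ∃ (m : ℤ) (l : K p), x * g = pScalar p ^ m * toG p l
    · obtain ⟨m, l, hl⟩ := h
      simp only [brFun_eq _ hl, map_add]
    · push Not at h
      simp only [brFun_eq_zero _ h, add_zero]
  map_smul' a v := by
    ext x
    change brFun ρ g (a • v) x = a • brFun ρ g v x
    by_cases h : ∃ (m : ℤ) (l : K p), x * g = pScalar p ^ m * toG p l
    · obtain ⟨m, l, hl⟩ := h
      simp only [brFun_eq _ hl, map_smul]
    · push Not at h
      simp only [brFun_eq_zero _ h, smul_zero]

theorem br_apply_of_eq {g x : G p} {n : ℤ} {k : K p} (v : V)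
    (hx : x * g = pScalar p ^ n * toG p k) : (br ρ g v).1 x = ρ k v :=
  brFun_eq v hx

theorem br_apply_of_ne {g x : G p} (v : V)
    (hx : ∀ (n : ℤ) (k : K p), x * g ≠ pScalar p ^ n * toG p k) : (br ρ g v).1 x = 0 :=
  brFun_eq_zero v hx

theorem br_mul (g : G p) (n : ℤ) (k : K p) (v : V) :
    br ρ (g * (pScalar p ^ n * toG p k)) v = br ρ g (ρ k v) := by
  ext x
  by_cases h : ∃ (m : ℤ) (l : K p), x * g = pScalar p ^ m * toG p l
  · obtain ⟨m, l, hl⟩ := h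
    rw [br_apply_of_eq ρ _ hl, br_apply_of_eq (n := m + n) (k := l * k), map_mul,
      Module.End.mul_apply]
    rw [← mul_assoc, hl, zpow_mul_assoc]
  · push Not at h
    rw [br_apply_of_ne ρ _ h, br_apply_of_ne]
    intro m l hl
    apply h (m + -n) (l * k⁻¹)
    rw [← zpow_mul_assoc, ← hl, mul_assoc, mul_assoc, zpow_mul_assoc]
    simp

theorem br_mul_toG (g : G p) (k : K p) (v : V) : br ρ (g * toG p k) v = br ρ g (ρ k v) := by
  simpa using br_mul ρ g 0 k v

/-- An additive subgroup of `ind_{KZ}^G V` contains `f` as soon as it contains all `[g, f g⁻¹]`. -/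
theorem mem_of_br_mem (N : AddSubgroup (ind ρ)) (f : ind ρ)
    (hf : ∀ g, br ρ g (f.1 g⁻¹) ∈ N) : f ∈ N := by
  classical
  obtain ⟨S, hS⟩ := f.2.2
  induction S using Finset.induction_on generalizing f with
  | empty =>
    have : f = 0 := by
      ext x
      by_contra h
      obtain ⟨s, hs, -⟩ := hS x h
      exact absurd hs (Finset.notMem_empty s)
    rw [this]
    exact N.zero_mem
  | insert s S _ ih =>
    -- The function `[s⁻¹, f s]` agrees with `f` on the coset `KZ s` and vanishes elsewhere, so
    -- subtracting it removes that coset from the support.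
    have key : ∀ x, (br ρ s⁻¹ (f.1 s)).1 x = f.1 x ∨ (br ρ s⁻¹ (f.1 s)).1 x = 0 := by
      intro x
      by_cases h : ∃ (m : ℤ) (l : K p), x * s⁻¹ = pScalar p ^ m * toG p l
      · obtain ⟨m, l, hl⟩ := h
        left
        rw [br_apply_of_eq ρ _ hl, ← f.2.1 m l s, ← hl, inv_mul_cancel_right]
      · push Not at h
        exact Or.inr (br_apply_of_ne ρ _ h)
    have h1 : br ρ s⁻¹ (f.1 s) ∈ N := by simpa using hf s⁻¹
    have h2 : f - br ρ s⁻¹ (f.1 s) ∈ N := by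
      apply ih
      · intro g
        change br ρ g (f.1 g⁻¹ - (br ρ s⁻¹ (f.1 s)).1 g⁻¹) ∈ N
        rcases key g⁻¹ with h | h
        · rw [h, sub_self, map_zero]
          exact N.zero_mem
        · rw [h, sub_zero]
          exact hf g
      · intro x hx
        change f.1 x - (br ρ s⁻¹ (f.1 s)).1 x ≠ 0 at hx
        have hfx : f.1 x ≠ 0 := by
          intro h0
          rcases key x with h | h
          · rw [h, sub_self] at hx
            exact hx rfl
          · rw [h, h0, sub_zero] at hx
            exact hx rfl
        obtain ⟨t, ht, htK⟩ := hS x hfx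
        rcases Finset.mem_insert.mp ht with rfl | ht
        · obtain ⟨m, l, hl⟩ := htK
          refine absurd ?_ hx
          rw [br_apply_of_eq ρ _ hl, ← f.2.1 m l t, ← hl, inv_mul_cancel_right, sub_self]
        · exact ⟨t, ht, htK⟩
    simpa using N.add_mem h2 h1

end

theorem indMap_br {S R R' V V' : Type*} [CommRing S] [CommRing R] [CommRing R'] [Algebra S R]
    [Algebra S R'] [AddCommGroup V] [Module R V] [Module S V] [IsScalarTower S R V]
    [AddCommGroup V'] [Module R' V'] [Module S V'] [IsScalarTower S R' V']
    (ρ : Representation R (K p) V) (ρ' : Representation R' (K p) V') (φ : V →ₗ[S] V')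
    (hφ : ∀ (k : K p) (v : V), φ (ρ k v) = ρ' k (φ v)) (g : G p) (v : V) :
    indMap ρ ρ' φ hφ (br ρ g v) = br ρ' g (φ v) := by
  ext x
  change φ ((br ρ g v).1 x) = _
  by_cases h : ∃ (m : ℤ) (l : K p), x * g = pScalar p ^ m * toG p l
  · obtain ⟨m, l, hl⟩ := h
    rw [br_apply_of_eq ρ _ hl, br_apply_of_eq ρ' _ hl, hφ]
  · push Not at h
    rw [br_apply_of_ne ρ _ h, br_apply_of_ne ρ' _ h, map_zero]

end Bracket

/-! ### The Hecke operator on `[g, v]`. -/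

section HeckeBracket

variable {p : ℕ} [Fact p.Prime]

/-- The lower triangular unipotent matrix with entry `c`. -/
noncomputable def lowerUnip (c : Zq p) : K p :=
  ⟨!![1, 0; c, 1], !![1, 0; -c, 1], by simp [Matrix.one_fin_two], by simp [Matrix.one_fin_two]⟩

/-- The permutation matrix. -/
noncomputable def swapMat : K p :=
  ⟨!![0, 1; 1, 0], !![0, 1; 1, 0], by simp [Matrix.one_fin_two], by simp [Matrix.one_fin_two]⟩

/-- Representatives of `K / (K ∩ α K α⁻¹)`. -/
noncomputable def cosetRep : Option (GaloisField p 2) → K p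
  | none => swapMat
  | some c => lowerUnip (WittVector.teichmuller p c)

theorem diagP_mul_lowerUnip_inv (c : Zq p) :
    diagP p * (lowerUnip c)⁻¹.1 = !![(p : Zq p), 0; -c, 1] := by
  change diagP p * !![1, 0; -c, 1] = _
  simp [diagP]

theorem diagP_mul_swapMat_inv : diagP p * (swapMat (p := p))⁻¹.1 = !![0, (p : Zq p); 1, 0] := by
  change diagP p * !![0, 1; 1, 0] = _
  simp [diagP]

theorem p_not_isUnit : ¬ IsUnit (p : Zq p) := (WittVector.irreducible p).not_isUnit

theorem constantCoeff_eq_zero_iff (x : Zq p) :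
    WittVector.constantCoeff x = 0 ↔ (p : Zq p) ∣ x := by
  rw [← RingHom.mem_ker, WittVector.ker_constantCoeff, Ideal.mem_span_singleton]

theorem constantCoeff_teichmuller (c : GaloisField p 2) :
    WittVector.constantCoeff (WittVector.teichmuller p c) = c :=
  WittVector.teichmuller_coeff_zero p c

theorem isUnit_iff_constantCoeff (x : Zq p) : IsUnit x ↔ WittVector.constantCoeff x ≠ 0 := by
  constructor
  · intro h
    exact (h.map (WittVector.constantCoeff : Zq p →+* GaloisField p 2)).ne_zero
  · intro h
    exact WittVector.isUnit_of_coeff_zero_ne_zero x h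

/-- Modulo `p`, the matrix `diag(p,1) κ⁻¹` has rank one, and left multiplication by `K` does not
change its row space. This row space is a point of the projective line over `𝔽_q`, and it determines
the representative `κ`. -/
theorem cosetRep_injective {m m' : K p} {i j : Option (GaloisField p 2)}
    (h : m.1 * (diagP p * (cosetRep i)⁻¹.1) = m'.1 * (diagP p * (cosetRep j)⁻¹.1)) : i = j := by
  have key : ∀ (g : K p) (i j : Option (GaloisField p 2)),
      g.1 * (diagP p * (cosetRep i)⁻¹.1) = diagP p * (cosetRep j)⁻¹.1 → i = j := by
    intro g i j h
    have hdet : IsUnit (g.1 0 0 * g.1 1 1 - g.1 0 1 * g.1 1 0) := by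
      rw [← Matrix.det_fin_two]
      exact (Matrix.isUnit_iff_isUnit_det _).mp g.isUnit
    rcases i with _ | c <;> rcases j with _ | d
    · rfl
    · exfalso
      simp only [cosetRep, diagP_mul_lowerUnip_inv, diagP_mul_swapMat_inv] at h
      have h1 := congrFun (congrFun h 1) 1
      simp [Matrix.mul_apply, Fin.sum_univ_two] at h1
      exact p_not_isUnit (IsUnit.of_mul_eq_one_right _ h1)
    · exfalso
      simp only [cosetRep, diagP_mul_lowerUnip_inv, diagP_mul_swapMat_inv] at h
      have h1 := congrFun (congrFun h 0) 1
      have h2 := congrFun (congrFun h 1) 1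
      simp [Matrix.mul_apply, Fin.sum_univ_two] at h1 h2
      rw [h1, h2] at hdet
      apply p_not_isUnit (p := p)
      refine isUnit_of_mul_isUnit_left (y := -g.1 1 0) ?_
      simpa using hdet
    · simp only [cosetRep, diagP_mul_lowerUnip_inv] at h
      have h1 := congrFun (congrFun h 1) 1
      have h2 := congrFun (congrFun h 1) 0
      simp [Matrix.mul_apply, Fin.sum_univ_two] at h1 h2
      rw [h1, one_mul] at h2
      have h3 := congrArg (WittVector.constantCoeff : Zq p →+* GaloisField p 2) h2
      have h4 : (WittVector.constantCoeff : Zq p →+* GaloisField p 2) (p : Zq p) = 0 :=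
        (constantCoeff_eq_zero_iff _).mpr dvd_rfl
      rw [map_add, map_mul, h4, mul_zero, zero_add, map_neg, map_neg, constantCoeff_teichmuller,
        constantCoeff_teichmuller] at h3
      rw [neg_injective h3]
  refine key (m'⁻¹ * m) i j ?_
  rw [Units.val_mul, mul_assoc, h, ← mul_assoc, Units.inv_mul, one_mul]

/-- The bottom row of `k` modulo `p` is a point of the projective line, which selects `κ`. After
rescaling the second row the two matrices agree modulo `p`, and `exists_unit_mul_eq` applies. -/
theorem exists_cosetRep (k : K p) : ∃ (i : Option (GaloisField p 2)) (m : K p),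
    diagP p * k.1 = m.1 * (diagP p * (cosetRep i)⁻¹.1) := by
  have hdet : IsUnit (k.1 0 0 * k.1 1 1 - k.1 0 1 * k.1 1 0) := by
    rw [← Matrix.det_fin_two]
    exact (Matrix.isUnit_iff_isUnit_det _).mp k.isUnit
  have hu : (diagP p * k.1).det = (p : Zq p) * (hdet.unit : Zq p) := by
    rw [Matrix.det_mul, IsUnit.unit_spec, diagP, Matrix.det_fin_two_of, Matrix.det_fin_two]
    ring
  by_cases hd : IsUnit (k.1 1 1)
  · obtain ⟨d, hd⟩ := hd
    -- With this `c`, the rescaled row `d · (-[c], 1)` is congruent to the bottom row of `k`.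
    let c : GaloisField p 2 := -WittVector.constantCoeff (k.1 1 0 * ↑d⁻¹ : Zq p)
    have hc : (p : Zq p) ∣ k.1 1 0 + WittVector.teichmuller p c * d := by
      rw [← constantCoeff_eq_zero_iff, map_add, map_mul, constantCoeff_teichmuller]
      simp only [c]
      rw [neg_mul, ← map_mul, mul_assoc, Units.inv_mul, mul_one, add_neg_cancel]
    obtain ⟨n, hn⟩ := hc
    obtain ⟨m, hm⟩ := exists_unit_mul_eq (p : Zq p) (WittVector.p_nonzero p _) hdet.unit d
      (diagP p * k.1) (!![1, 0; 0, (d : Zq p)] * !![(p : Zq p), 0; -WittVector.teichmuller p c, 1])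
      !![k.1 0 0 - 1, k.1 0 1; n, 0] hu (by simp [Matrix.det_fin_two]) (by
        ext i j : 1
        fin_cases i <;> fin_cases j <;>
          simp [diagP, Matrix.mul_apply, Fin.sum_univ_two, ← hd]
        · ring
        · linear_combination hn)
    refine ⟨some c, m * ⟨!![1, 0; 0, (d : Zq p)], !![1, 0; 0, (↑d⁻¹ : Zq p)],
      by simp [Matrix.one_fin_two], by simp [Matrix.one_fin_two]⟩, ?_⟩
    rw [hm, cosetRep, diagP_mul_lowerUnip_inv, Units.val_mul, mul_assoc]
  · have hd' : (p : Zq p) ∣ k.1 1 1 := by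
      rw [← constantCoeff_eq_zero_iff]
      by_contra h
      exact hd ((isUnit_iff_constantCoeff _).mpr h)
    have hc : IsUnit (k.1 1 0) := by
      rw [isUnit_iff_constantCoeff] at hdet ⊢
      intro h0
      rw [← constantCoeff_eq_zero_iff] at hd'
      apply hdet
      rw [map_sub, map_mul, map_mul, h0, hd', mul_zero, mul_zero, sub_zero]
    obtain ⟨c, hc⟩ := hc
    obtain ⟨n, hn⟩ := hd'
    -- The unit is `-c` because the rescaled matrix has determinant `-p c`.
    obtain ⟨m, hm⟩ := exists_unit_mul_eq (p : Zq p) (WittVector.p_nonzero p _) hdet.unit (-c)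
      (diagP p * k.1) (!![1, 0; 0, (c : Zq p)] * !![0, (p : Zq p); 1, 0])
      !![k.1 0 0, k.1 0 1 - 1; 0, n] hu (by simp [Matrix.det_fin_two]) (by
        ext i j : 1
        fin_cases i <;> fin_cases j <;>
          simp [diagP, Matrix.mul_apply, Fin.sum_univ_two, ← hc]
        · ring
        · linear_combination hn)
    refine ⟨none, m * ⟨!![1, 0; 0, (c : Zq p)], !![1, 0; 0, (↑c⁻¹ : Zq p)],
      by simp [Matrix.one_fin_two], by simp [Matrix.one_fin_two]⟩, ?_⟩
    rw [hm, cosetRep, diagP_mul_swapMat_inv, Units.val_mul, mul_assoc]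

theorem toG_cosetRep_eq {k m : K p} {i : Option (GaloisField p 2)} (n : ℤ)
    (h : diagP p * k.1 = m.1 * (diagP p * (cosetRep i)⁻¹.1)) (l : K p) :
    pScalar p ^ n * toG p l * (alpha p)⁻¹ * toG p k =
      pScalar p ^ n * toG p (l * m) * (alpha p)⁻¹ * toG p (cosetRep i)⁻¹ := by
  apply Units.ext
  rw [coe_doubleCoset, coe_doubleCoset, mul_assoc, h, Units.val_mul]
  simp only [mul_assoc]

variable (R : Type*) [CommRing R] [Algebra (Zq p) R] (r : Fin 2 → ℕ) (s : ℕ)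

/-- The point `y⁻¹ x` lies in the support `KZ g⁻¹` for just one coset `y KZ`, that of `x g`. -/
theorem heckeT_br_apply (g : G p) (v : Sym R r) (x : G p) :
    (heckeT R r s (br (symRep (p := p) R r s) g v)).1 x = heckeFun R r s (x * g) v := by
  change ∑ᶠ c : G p ⧸ KZ p, heckeFun R r s c.out
    ((br (symRep (p := p) R r s) g v).1 (c.out⁻¹ * x)) = _
  rw [finsum_eq_single _ ((x * g : G p) : G p ⧸ KZ p)]
  · rw [heckeSummand_congr R r s _ x (QuotientGroup.out_eq' ((x * g : G p) : G p ⧸ KZ p)),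
      br_apply_of_eq (n := 0) (k := 1)]
    · simp
    · simp [mul_assoc]
  · intro c hc
    rw [br_apply_of_ne, map_zero]
    intro n k hk
    apply hc
    conv_lhs => rw [← QuotientGroup.out_eq' c]
    refine QuotientGroup.eq.mpr ⟨n, k, ?_⟩
    rw [← hk, mul_assoc]

noncomputable instance : Fintype (GaloisField p 2) := Fintype.ofFinite _

/-- The formula for the Hecke operator on `[g, v]`. -/
theorem heckeT_br (g : G p) (v : Sym R r) :
    heckeT R r s (br (symRep (p := p) R r s) g v) =
      ∑ i, br (symRep (p := p) R r s) (g * toG p (cosetRep i) * alpha p)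
        (matAct R r (diagP p) (symRep R r s (cosetRep i)⁻¹ v)) := by
  ext x
  rw [heckeT_br_apply]
  have hsum : (∑ i, br (symRep (p := p) R r s) (g * toG p (cosetRep i) * alpha p)
        (matAct R r (diagP p) (symRep R r s (cosetRep i)⁻¹ v))).1 x =
      ∑ i, (br (symRep (p := p) R r s) (g * toG p (cosetRep i) * alpha p)
        (matAct R r (diagP p) (symRep R r s (cosetRep i)⁻¹ v))).1 x := by
    rw [AddSubmonoidClass.coe_finsetSum, Finset.sum_apply]
  rw [hsum]
  have conv : ∀ (n : ℤ) (m : K p) (i : Option (GaloisField p 2)),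
      x * (g * toG p (cosetRep i) * alpha p) = pScalar p ^ n * toG p m ↔
      x * g = pScalar p ^ n * toG p m * (alpha p)⁻¹ * toG p (cosetRep i)⁻¹ := by
    intro n m i
    rw [map_inv, eq_mul_inv_iff_mul_eq, eq_mul_inv_iff_mul_eq]
    simp only [mul_assoc]
  by_cases h : ∃ (n : ℤ) (l k : K p), x * g = pScalar p ^ n * toG p l * (alpha p)⁻¹ * toG p k
  · obtain ⟨n, l, k, h⟩ := h
    obtain ⟨i, m, hm⟩ := exists_cosetRep k
    rw [toG_cosetRep_eq n hm] at h
    rw [Finset.sum_eq_single i]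
    · rw [br_apply_of_eq _ _ ((conv _ _ _).mpr h), h, heckeFun_apply]
      rfl
    · intro j _ hj
      apply br_apply_of_ne
      intro n' m' h'
      rw [conv, h] at h'
      apply hj
      have h2 := (doubleCoset_inj h').2
      rw [mul_assoc, mul_assoc] at h2
      exact (cosetRep_injective h2).symm
    · intro hi
      exact absurd (Finset.mem_univ i) hi
  · rw [heckeFun, dif_neg (by rintro ⟨y, hy⟩; exact h ⟨_, _, _, hy⟩), LinearMap.zero_apply,
      Finset.sum_eq_zero]
    intro i _
    apply br_apply_of_ne
    intro n m hm
    rw [conv] at hm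
    exact h ⟨_, _, _, hm⟩

end HeckeBracket

/-! ### Monomials of bidegree `r` and the substitutions given by matrices. -/

section Monomials

open MvPolynomial

variable (R : Type*) [CommRing R] (r : Fin 2 → ℕ)

theorem Sym.toPoly_injective : Function.Injective (Sym.toPoly R r) := Subtype.val_injective

variable {R r} in
/-- The element of `Sym R r` attached to a bihomogeneous polynomial. -/
def Sym.mk (P : Poly R) (hP : P ∈ symSubmodule R r) : Sym R r := ⟨P, hP⟩

theorem Sym.toPoly_mk (P : Poly R) (hP : P ∈ symSubmodule R r) :
    Sym.toPoly R r (Sym.mk P hP) = P := rfl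

theorem Sym.toPoly_mem (v : Sym R r) : Sym.toPoly R r v ∈ symSubmodule R r := v.2

/-- The exponent of the monomial `X₀^i Y₀^{r₀-i} X₁^j Y₁^{r₁-j}`. -/
noncomputable def expo (i j : ℕ) : Fin 2 × Fin 2 →₀ ℕ :=
  Finsupp.single (0, 0) i + Finsupp.single (0, 1) (r 0 - i) + Finsupp.single (1, 0) j +
    Finsupp.single (1, 1) (r 1 - j)

theorem weight_bideg (d : Fin 2 × Fin 2 →₀ ℕ) :
    Finsupp.weight bideg d = ![d (0, 0) + d (0, 1), d (1, 0) + d (1, 1)] := by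
  rw [Finsupp.weight_apply, Finsupp.sum_fintype _ _ (by simp)]
  ext l
  rw [Fintype.sum_prod_type]
  fin_cases l <;> simp [Fin.sum_univ_two, bideg]

variable {r} in
theorem mem_symSubmodule_of_expo {i j : ℕ} (hi : i ≤ r 0) (hj : j ≤ r 1) :
    monomial (expo r i j) (1 : R) ∈ symSubmodule R r := by
  refine isWeightedHomogeneous_monomial _ _ _ ?_
  rw [weight_bideg]
  ext l
  fin_cases l <;> simp [expo] <;> omega

/-- The monomial `X₀^i Y₀^{r₀-i} X₁^j Y₁^{r₁-j}`. -/
noncomputable def mon (i j : ℕ) : Sym R r :=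
  if h : i ≤ r 0 ∧ j ≤ r 1 then Sym.mk _ (mem_symSubmodule_of_expo R h.1 h.2) else 0

variable {r}

theorem toPoly_mon_eq_monomial {i j : ℕ} (hi : i ≤ r 0) (hj : j ≤ r 1) :
    Sym.toPoly R r (mon R r i j) = monomial (expo r i j) 1 := by
  rw [mon, dif_pos ⟨hi, hj⟩, Sym.toPoly_mk]

theorem toPoly_mon {i j : ℕ} (hi : i ≤ r 0) (hj : j ≤ r 1) :
    Sym.toPoly R r (mon R r i j) =
      X (0, 0) ^ i * X (0, 1) ^ (r 0 - i) * (X (1, 0) ^ j * X (1, 1) ^ (r 1 - j)) := by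
  rw [toPoly_mon_eq_monomial R hi hj, expo, X_pow_eq_monomial, X_pow_eq_monomial,
    X_pow_eq_monomial, X_pow_eq_monomial, monomial_mul, monomial_mul, monomial_mul]
  simp [add_assoc]

theorem span_mon : Submodule.span R {v | ∃ i j, i ≤ r 0 ∧ j ≤ r 1 ∧ v = mon R r i j} = ⊤ := by
  rw [eq_top_iff]
  intro v _
  have h : Sym.toPoly R r v ∈ (Submodule.span R
      {v | ∃ i j, i ≤ r 0 ∧ j ≤ r 1 ∧ v = mon R r i j}).map (Sym.toPoly R r) := by
    rw [(Sym.toPoly R r v).as_sum]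
    refine Submodule.sum_mem _ fun d hd => ?_
    have hw : Finsupp.weight bideg d = r := Sym.toPoly_mem R r v (mem_support_iff.mp hd)
    rw [weight_bideg] at hw
    have h0 : d (0, 0) + d (0, 1) = r 0 := congrFun hw 0
    have h1 : d (1, 0) + d (1, 1) = r 1 := congrFun hw 1
    have hd' : d = expo r (d (0, 0)) (d (1, 0)) := by
      ext ⟨a, b⟩
      fin_cases a <;> fin_cases b <;> simp [expo] <;> omega
    refine ⟨coeff d (Sym.toPoly R r v) • mon R r (d (0, 0)) (d (1, 0)),
      Submodule.smul_mem _ _ (Submodule.subset_span ⟨_, _, by omega, by omega, rfl⟩), ?_⟩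
    rw [map_smul, toPoly_mon_eq_monomial R (by omega) (by omega), smul_monomial, ← hd']
    simp
  obtain ⟨w, hw, hwv⟩ := h
  rwa [← Sym.toPoly_injective R r hwv]

theorem mem_of_mon_mem (S : Submodule R (Sym R r))
    (h : ∀ i j, i ≤ r 0 → j ≤ r 1 → mon R r i j ∈ S) (v : Sym R r) : v ∈ S := by
  have h1 : Submodule.span R {v | ∃ i j, i ≤ r 0 ∧ j ≤ r 1 ∧ v = mon R r i j} ≤ S := by
    rw [Submodule.span_le]
    rintro _ ⟨i, j, hi, hj, rfl⟩
    exact h i j hi hj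
  rw [span_mon] at h1
  exact h1 trivial

theorem hom_ext_mon {V : Type*} [AddCommGroup V] [Module R V] {f f' : Sym R r →ₗ[R] V}
    (h : ∀ i j, i ≤ r 0 → j ≤ r 1 → f (mon R r i j) = f' (mon R r i j)) : f = f' :=
  LinearMap.ext fun v => mem_of_mon_mem R (LinearMap.eqLocus f f') h v

variable {R} in
-- The quotient by a nonzero constant of a domain has the same support, so it is still
-- bihomogeneous.
theorem exists_smul_of_C_dvd [IsDomain R] {c : R} (hc : c ≠ 0) {v : Sym R r}
    (h : C c ∣ Sym.toPoly R r v) : ∃ v', v = c • v' := by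
  obtain ⟨P, hP⟩ := h
  have hc' : ∀ d, coeff d (Sym.toPoly R r v) = c * coeff d P := fun d => by rw [hP, coeff_C_mul]
  have hPm : P ∈ symSubmodule R r := by
    have hv : IsWeightedHomogeneous bideg (Sym.toPoly R r v) r := Sym.toPoly_mem R r v
    intro d hd
    exact hv fun h0 => mul_ne_zero hc hd ((hc' d).symm.trans h0)
  refine ⟨Sym.mk P hPm, Sym.toPoly_injective R r ?_⟩
  rw [map_smul, Sym.toPoly_mk, smul_eq_C_mul, hP]

end Monomials

section Substitution

open MvPolynomial

variable {p : ℕ} [Fact p.Prime] (R : Type*) [CommRing R] [Algebra (Zq p) R] (r : Fin 2 → ℕ)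

theorem toPoly_matAct (m : Matrix (Fin 2) (Fin 2) (Zq p)) (v : Sym R r) :
    Sym.toPoly R r (matAct R r m v) = subst R m (Sym.toPoly R r v) := rfl

theorem symRep_apply (s : ℕ) (g : K p) (v : Sym R r) : symRep R r s g v =
    algebraMap (Zq p) R g.1.det ^ s • matAct R r g.1 v := rfl

theorem symRep_zero_apply (g : K p) (v : Sym R r) : symRep R r 0 g v = matAct R r g.1 v := by
  rw [symRep_apply, pow_zero, one_smul]

theorem subst_X_zero (m : Matrix (Fin 2) (Fin 2) (Zq p)) (j : Fin 2) :
    subst R m (X (0, j)) = C (algebraMap (Zq p) R (m 0 j)) * X (0, 0) +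
      C (algebraMap (Zq p) R (m 1 j)) * X (0, 1) := by
  simp [subst, Fin.sum_univ_two]

theorem subst_X_one (m : Matrix (Fin 2) (Fin 2) (Zq p)) (j : Fin 2) :
    subst R m (X (1, j)) = C (algebraMap (Zq p) R (WittVector.frobenius (m 0 j))) * X (1, 0) +
      C (algebraMap (Zq p) R (WittVector.frobenius (m 1 j))) * X (1, 1) := by
  simp [subst, Fin.sum_univ_two]

variable {r}

theorem toPoly_matAct_mon (m : Matrix (Fin 2) (Fin 2) (Zq p)) {i j : ℕ} (hi : i ≤ r 0)
    (hj : j ≤ r 1) : Sym.toPoly R r (matAct R r m (mon R r i j)) =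
      subst R m (X (0, 0)) ^ i * subst R m (X (0, 1)) ^ (r 0 - i) *
        (subst R m (X (1, 0)) ^ j * subst R m (X (1, 1)) ^ (r 1 - j)) := by
  rw [toPoly_matAct, toPoly_mon R hi hj]
  simp only [map_mul, map_pow]

end Substitution

/-! ### Normal forms modulo the lifts of `θ₀` and `θ₁`. -/

section Reduction

open MvPolynomial

variable (R : Type*) [CommRing R] (p : ℕ) (r : Fin 2 → ℕ)

/-- The span of the differences of monomials that are multiples of `θ₀` or `θ₁`. -/
noncomputable def binom : Submodule R (Sym R r) :=
  Submodule.span R ({v | ∃ i j, i + 1 ≤ r 0 ∧ j + p ≤ r 1 ∧ v = mon R r (i + 1) j - mon R r i (j + p)} ∪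
    {v | ∃ i j, i + p ≤ r 0 ∧ j + 1 ≤ r 1 ∧ v = mon R r (i + p) j - mon R r i (j + 1)})

variable {p r}

theorem binom_sub_mem₀ {i j : ℕ} (hi : i + 1 ≤ r 0) (hj : j + p ≤ r 1) :
    mon R r (i + 1) j - mon R r i (j + p) ∈ binom R p r :=
  Submodule.subset_span (Or.inl ⟨i, j, hi, hj, rfl⟩)

theorem binom_sub_mem₁ {i j : ℕ} (hi : i + p ≤ r 0) (hj : j + 1 ≤ r 1) :
    mon R r (i + p) j - mon R r i (j + 1) ∈ binom R p r :=
  Submodule.subset_span (Or.inr ⟨i, j, hi, hj, rfl⟩)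

/-- Modulo `θ₀` and `θ₁`, every monomial but `X₀^{r₀} X₁^{r₁}` is one with `i, j < p`. -/
theorem mon_mem_of_binom_le (hp : 1 < p) (hr : ∀ i, p ≤ r i) (S : Submodule R (Sym R r))
    (hS : binom R p r ≤ S) (h0 : ∀ i j, i < p → j < p → mon R r i j ∈ S)
    (h1 : mon R r (r 0) (r 1) ∈ S) {i j : ℕ} (hi : i ≤ r 0) (hj : j ≤ r 1) : mon R r i j ∈ S := by
  have hr0 := hr 0
  have hr1 := hr 1
  -- The relations exchange `X₀^p Y₁` with `Y₀^p X₁`, and `X₁^p Y₀` with `Y₁^p X₀`; each lowers `i +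
  -- j` by `p - 1`. Neither applies exactly when `i, j < p` or `(i, j) = (r₀, r₁)`.
  induction hn : i + j using Nat.strong_induction_on generalizing i j with
  | _ n ih =>
    by_cases hip : p ≤ i ∧ j + 1 ≤ r 1
    · have h2 := hS (binom_sub_mem₁ R (i := i - p) (j := j) (by omega) hip.2)
      have h3 := ih (i - p + (j + 1)) (by omega) (i := i - p) (j := j + 1) (by omega) (by omega) rfl
      rw [show i - p + p = i by omega] at h2
      simpa using S.add_mem h2 h3
    by_cases hjp : p ≤ j ∧ i + 1 ≤ r 0
    · have h2 := hS (binom_sub_mem₀ R (i := i) (j := j - p) hjp.2 (by omega))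
      have h3 := ih (i + 1 + (j - p)) (by omega) (i := i + 1) (j := j - p) (by omega) (by omega) rfl
      rw [show j - p + p = j by omega] at h2
      simpa using S.sub_mem h3 h2
    by_cases hlt : i < p ∧ j < p
    · exact h0 i j hlt.1 hlt.2
    · rw [show i = r 0 by omega, show j = r 1 by omega]
      exact h1

end Reduction

/-! ### Power sums over the field with `p²` elements. -/

section PowerSums

/-- No invertibility of `x` is required; the price is that both exponents must be positive, which
later uses have to check. -/
theorem pow_eq_pow_of_modEq {M : Type*} [CommMonoid M] {x : M} {q : ℕ} (hq : 1 < q) (hx : x ^ q = x)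
    {n m : ℕ} (hn : n ≠ 0) (hm : m ≠ 0) (h : n ≡ m [MOD q - 1]) : x ^ n = x ^ m := by
  have key : ∀ t n : ℕ, n ≠ 0 → x ^ (n + (q - 1) * t) = x ^ n := by
    intro t n hn
    induction t with
    | zero => simp
    | succ t ih =>
      have e : n + (q - 1) * (t + 1) = (n - 1 + (q - 1) * t) + q := by
        rw [mul_add, mul_one]
        omega
      rw [e, pow_add, hx, ← pow_succ, ← ih]
      congr 1
      omega
  rcases le_total n m with hl | hl
  · obtain ⟨t, ht⟩ := (Nat.modEq_iff_dvd' hl).mp h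
    rw [show m = n + (q - 1) * t by omega, key t n hn]
  · obtain ⟨t, ht⟩ := (Nat.modEq_iff_dvd' hl).mp h.symm
    rw [show n = m + (q - 1) * t by omega, key t m hm]

variable {p : ℕ} [Fact p.Prime]

theorem card_galoisField : Fintype.card (GaloisField p 2) = p ^ 2 := by
  rw [← Nat.card_eq_fintype_card, GaloisField.card p 2 two_ne_zero]

theorem galoisField_pow_card (x : GaloisField p 2) : x ^ p ^ 2 = x := by
  rw [← card_galoisField (p := p), FiniteField.pow_card]

theorem one_lt_sq : 1 < p ^ 2 := Nat.one_lt_pow two_ne_zero (Nat.Prime.one_lt Fact.out)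

theorem sum_galoisField_pow (n : ℕ) :
    ∑ x : GaloisField p 2, x ^ n = if n ≠ 0 ∧ p ^ 2 - 1 ∣ n then -1 else 0 := by
  classical
  have hq := one_lt_sq (p := p)
  by_cases h : n ≠ 0 ∧ p ^ 2 - 1 ∣ n
  · rw [if_pos h]
    have e : ∀ x : GaloisField p 2, x ^ n = x ^ (p ^ 2 - 1) := fun x =>
      pow_eq_pow_of_modEq hq (galoisField_pow_card x) h.1 (by omega)
        ((Nat.modEq_zero_iff_dvd.mpr h.2).trans (Nat.modEq_zero_iff_dvd.mpr dvd_rfl).symm)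
    have e2 : ∀ x : GaloisField p 2, x ^ (p ^ 2 - 1) = 1 - if x = 0 then 1 else 0 := by
      intro x
      split_ifs with hx
      · rw [hx, zero_pow (by omega), sub_self]
      · rw [← card_galoisField (p := p), FiniteField.pow_card_sub_one_eq_one x hx, sub_zero]
    simp only [e, e2]
    rw [Finset.sum_sub_distrib, Finset.sum_const, Finset.card_univ, card_galoisField]
    simp [CharP.cast_eq_zero]
  · rw [if_neg h]
    have hm : n % (p ^ 2 - 1) < p ^ 2 - 1 := Nat.mod_lt _ (by omega)
    by_cases hn : n = 0
    · rw [hn]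
      exact FiniteField.sum_pow_lt_card_sub_one _ 0 (by rw [card_galoisField]; omega)
    · have e : ∀ x : GaloisField p 2, x ^ n = x ^ (n % (p ^ 2 - 1)) := fun x =>
        pow_eq_pow_of_modEq hq (galoisField_pow_card x) hn
          (fun h0 => h ⟨hn, Nat.dvd_of_mod_eq_zero h0⟩) (Nat.mod_modEq _ _).symm
      simp only [e]
      exact FiniteField.sum_pow_lt_card_sub_one _ _ (by rw [card_galoisField]; exact hm)

theorem sum_galoisField_pow_eq_zero {n : ℕ} (hn : n < p ^ 2 - 1) :
    ∑ x : GaloisField p 2, x ^ n = 0 :=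
  FiniteField.sum_pow_lt_card_sub_one _ _ (by rw [card_galoisField]; exact hn)

/-- The sum of `x^m (x - c)^n` over the finite field. -/
theorem sum_pow_mul_sub_pow (m n : ℕ) (c : GaloisField p 2) :
    ∑ x : GaloisField p 2, x ^ m * (x - c) ^ n =
      ∑ i ∈ Finset.range (n + 1), (∑ x : GaloisField p 2, x ^ (m + i)) *
        ((-c) ^ (n - i) * (n.choose i : GaloisField p 2)) := by
  simp only [sub_eq_add_neg, add_pow, Finset.mul_sum, Finset.sum_mul]
  rw [Finset.sum_comm]
  refine Finset.sum_congr rfl fun i _ => Finset.sum_congr rfl fun x _ => ?_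
  ring

end PowerSums

/-! ### Sums weighted by `μ^{q - p a₁}`. -/

section Congruences

variable {p : ℕ} [Fact p.Prime] {r : Fin 2 → ℕ} {a₁ : ℕ}

theorem mul_lt_of_le_sub_one (ha₁' : a₁ ≤ p - 1) : p * a₁ + p ≤ p ^ 2 := by
  have hp := Nat.Prime.one_lt (Fact.out : p.Prime)
  calc p * a₁ + p = p * (a₁ + 1) := by ring
    _ ≤ p * p := Nat.mul_le_mul_left p (by omega)
    _ = p ^ 2 := by ring

/-- The coefficient `μ^{q - p a₁}`. -/
noncomputable def wt (p : ℕ) [Fact p.Prime] (a₁ : ℕ) (x : GaloisField p 2) : GaloisField p 2 :=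
  x ^ (p ^ 2 - p * a₁)

/-- The summand is a polynomial in `x` of degree less than `q - 1`. -/
theorem sum_wt_mul_sub_pow_of_lt (ha₁' : a₁ ≤ p - 1) {n : ℕ}
    (hn : n + 1 < p * a₁) (c : GaloisField p 2) :
    ∑ x, wt p a₁ x * (x - c) ^ n = 0 := by
  have h := mul_lt_of_le_sub_one ha₁'
  unfold wt
  rw [sum_pow_mul_sub_pow]
  refine Finset.sum_eq_zero fun i hi => ?_
  rw [Finset.mem_range] at hi
  rw [sum_galoisField_pow_eq_zero (by omega), zero_mul]

/-- The summand is monic in `x` of degree `q - 1`, and only its leading term contributes. -/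
theorem sum_wt_mul_sub_pow_pred (ha₁ : 1 ≤ a₁) (ha₁' : a₁ ≤ p - 1) (c : GaloisField p 2) :
    ∑ x, wt p a₁ x * (x - c) ^ (p * a₁ - 1) = -1 := by
  have hp := Nat.Prime.one_lt (Fact.out : p.Prime)
  have h := mul_lt_of_le_sub_one ha₁'
  have h1 : 1 < p * a₁ := lt_of_lt_of_le hp (Nat.le_mul_of_pos_right p ha₁)
  unfold wt
  rw [sum_pow_mul_sub_pow, Finset.sum_range_succ, Finset.sum_eq_zero, sum_galoisField_pow, if_pos]
  · simp
  · constructor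
    · omega
    · exact dvd_of_eq (by omega)
  · intro i hi
    rw [Finset.mem_range] at hi
    rw [sum_galoisField_pow_eq_zero (by omega), zero_mul]

/-- The degree is now `q`, which is not a multiple of `q - 1`, and the term of degree `q - 1`
carries the binomial coefficient `p a₁ = 0`. -/
theorem sum_wt_mul_sub_pow_self (ha₁ : 1 ≤ a₁) (ha₁' : a₁ ≤ p - 1) (c : GaloisField p 2) :
    ∑ x, wt p a₁ x * (x - c) ^ (p * a₁) = 0 := by
  have hp := Nat.Prime.one_lt (Fact.out : p.Prime)
  have h := mul_lt_of_le_sub_one ha₁'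
  have h1 : 1 < p * a₁ := lt_of_lt_of_le hp (Nat.le_mul_of_pos_right p ha₁)
  unfold wt
  rw [sum_pow_mul_sub_pow]
  refine Finset.sum_eq_zero fun i hi => ?_
  rw [Finset.mem_range] at hi
  by_cases hi' : i + 1 = p * a₁
  · have hc : (p * a₁).choose i = p * a₁ := by
      rw [← hi', Nat.choose_succ_self_right]
    rw [hc, Nat.cast_mul, CharP.cast_eq_zero, zero_mul, mul_zero, mul_zero]
  · rw [sum_galoisField_pow, if_neg, zero_mul]
    rintro ⟨-, t, ht⟩
    have ht1 : t = 1 := by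
      rcases t with _ | _ | t
      · omega
      · rfl
      · exfalso
        have : (p ^ 2 - 1) * (t + 1 + 1) = (p ^ 2 - 1) * t + 2 * (p ^ 2 - 1) := by ring
        have h4 : 2 ^ 2 ≤ p ^ 2 := Nat.pow_le_pow_left hp 2
        omega
    subst ht1
    omega

section
variable (hr : ∀ i, p ^ 2 ≤ r i) (ha₁ : 1 ≤ a₁) (ha₁' : a₁ ≤ p - 1)
  (hcong : r 0 + p * r 1 ≡ p * a₁ [MOD p ^ 2 - 1])
include hr ha₁ ha₁' hcong

/-- Together with the next two lemmas, this gives the constant term and the first-order terms of the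
images of `mainSym` under `lowMat`. The congruence for `r₀ + p r₁` reduces the exponents to `p a₁`,
`p a₁ - 1` and `p (a₁ - 1)`. -/
theorem sum_wt_value (c : GaloisField p 2) :
    ∑ x, wt p a₁ x * ((x - c) ^ r 0 * ((x - c) ^ p) ^ r 1) = 0 := by
  have hp := Nat.Prime.one_lt (Fact.out : p.Prime)
  have h1 : 1 < p * a₁ := lt_of_lt_of_le hp (Nat.le_mul_of_pos_right p ha₁)
  have hr0 := hr 0
  have hq := one_lt_sq (p := p)
  rw [← sum_wt_mul_sub_pow_self ha₁ ha₁' c]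
  refine Finset.sum_congr rfl fun x _ => ?_
  rw [← pow_mul, ← pow_add]
  congr 1
  exact pow_eq_pow_of_modEq hq (galoisField_pow_card _) (by omega) (by omega) hcong

theorem sum_wt_deriv₀ (c : GaloisField p 2) :
    ∑ x, wt p a₁ x * ((x - c) ^ (r 0 - 1) * ((x - c) ^ p) ^ r 1) = -1 := by
  have hp := Nat.Prime.one_lt (Fact.out : p.Prime)
  have h1 : 1 < p * a₁ := lt_of_lt_of_le hp (Nat.le_mul_of_pos_right p ha₁)
  have hr0 := hr 0
  have hq := one_lt_sq (p := p)
  rw [← sum_wt_mul_sub_pow_pred ha₁ ha₁' c]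
  refine Finset.sum_congr rfl fun x _ => ?_
  rw [← pow_mul, ← pow_add]
  congr 1
  refine pow_eq_pow_of_modEq hq (galoisField_pow_card _) (by omega) (by omega) ?_
  refine Nat.ModEq.add_right_cancel' 1 ?_
  rwa [show r 0 - 1 + p * r 1 + 1 = r 0 + p * r 1 by omega, show p * a₁ - 1 + 1 = p * a₁ by omega]

/-- For `a₁ ≥ 2` the reduced exponent `p (a₁ - 1)` is positive and below `p a₁ - 1`. For `a₁ = 1` it
would be `0`, and the factor `r₁` has to vanish instead. -/
theorem sum_wt_deriv₁ (hr₁ : a₁ = 1 → p ∣ r 1) (c : GaloisField p 2) :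
    (r 1 : GaloisField p 2) *
      ∑ x, wt p a₁ x * ((x - c) ^ r 0 * ((x - c) ^ p) ^ (r 1 - 1)) = 0 := by
  have hp := Nat.Prime.one_lt (Fact.out : p.Prime)
  by_cases h1 : a₁ = 1
  · rw [(CharP.cast_eq_zero_iff (GaloisField p 2) p _).mpr (hr₁ h1), zero_mul]
  have hr0 := hr 0
  have hr1 := hr 1
  have hq := one_lt_sq (p := p)
  have e1 : p * a₁ = p * (a₁ - 1) + p := by
    conv_lhs => rw [show a₁ = a₁ - 1 + 1 by omega]
    ring
  have e2 : p * r 1 = p * (r 1 - 1) + p := by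
    conv_lhs => rw [show r 1 = r 1 - 1 + 1 by omega]
    ring
  have e3 : p * 1 ≤ p * (a₁ - 1) := Nat.mul_le_mul_left p (by omega)
  rw [← mul_zero (r 1 : GaloisField p 2),
    ← sum_wt_mul_sub_pow_of_lt ha₁' (n := p * (a₁ - 1)) (by omega) c]
  congr 1
  refine Finset.sum_congr rfl fun x _ => ?_
  rw [← pow_mul, ← pow_add]
  congr 1
  refine pow_eq_pow_of_modEq hq (galoisField_pow_card _) (by omega) (by omega) ?_
  refine Nat.ModEq.add_right_cancel' p ?_
  rwa [add_assoc, ← e2, ← e1]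

end

theorem sum_wt (ha₁ : 1 ≤ a₁) (ha₁' : a₁ ≤ p - 1) : ∑ x, wt p a₁ x = 0 := by
  have hp := Nat.Prime.one_lt (Fact.out : p.Prime)
  have h1 : 1 < p * a₁ := lt_of_lt_of_le hp (Nat.le_mul_of_pos_right p ha₁)
  simpa using sum_wt_mul_sub_pow_of_lt ha₁' (n := 0) (by omega) 0

theorem sum_wt_mul (hp2 : 2 < p) (ha₁ : 1 ≤ a₁) (ha₁' : a₁ ≤ p - 1) : ∑ x, wt p a₁ x * x = 0 := by
  have h1 : p * 1 ≤ p * a₁ := Nat.mul_le_mul_left p ha₁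
  simpa using sum_wt_mul_sub_pow_of_lt ha₁' (n := 1) (by omega) 0

theorem sum_wt_mul_pow (ha₁ : 1 ≤ a₁) (ha₁' : a₁ ≤ p - 1) (hr₁ : a₁ = 1 → p ∣ r 1) :
    (r 1 : GaloisField p 2) * ∑ x, wt p a₁ x * x ^ p = 0 := by
  have hp := Nat.Prime.one_lt (Fact.out : p.Prime)
  by_cases h1 : a₁ = 1
  · rw [(CharP.cast_eq_zero_iff (GaloisField p 2) p _).mpr (hr₁ h1), zero_mul]
  have h2 : p * 2 ≤ p * a₁ := Nat.mul_le_mul_left p (by omega)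
  have h := sum_wt_mul_sub_pow_of_lt ha₁' (n := p) (by omega) 0
  simp only [sub_zero] at h
  rw [h, mul_zero]

end Congruences

/-! ### Images under `diag(p,1) κ⁻¹` modulo `p` and modulo `p²`. -/

section Divisibility

open MvPolynomial

theorem add_pow_of_mul_self_eq_zero {A : Type*} [CommRing A] {x e : A} (he : e * e = 0) (n : ℕ) :
    (e + x) ^ n = x ^ n + n * (e * x ^ (n - 1)) := by
  induction n with
  | zero => simp
  | succ n ih =>
    rw [pow_succ, ih]
    rcases n with _ | n
    · simp [add_comm]
    · push_cast
      simp only [pow_succ]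
      linear_combination ((n + 1 : A) * x ^ n) * he

/-- A Taylor expansion to first order, to be applied with `e = p` in the polynomial ring modulo
`p²`. -/
theorem mul_add_pow_mul_pow {A : Type*} [CommRing A] {e : A} (he : e * e = 0)
    (x x' z z' X₀ Y₀ X₁ Y₁ : A) (n m : ℕ) :
    (e * x * X₀ + z * Y₀) ^ n * (e * x' * X₁ + z' * Y₁) ^ m =
      z ^ n * z' ^ m * (Y₀ ^ n * Y₁ ^ m) +
        e * (n * (x * (z ^ (n - 1) * z' ^ m)) * (X₀ * Y₀ ^ (n - 1) * Y₁ ^ m) +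
          m * (x' * (z ^ n * z' ^ (m - 1))) * (Y₀ ^ n * (X₁ * Y₁ ^ (m - 1)))) := by
  have h0 : (e * x * X₀) * (e * x * X₀) = 0 := by linear_combination (x * X₀) ^ 2 * he
  have h1 : (e * x' * X₁) * (e * x' * X₁) = 0 := by linear_combination (x' * X₁) ^ 2 * he
  rw [add_pow_of_mul_self_eq_zero h0, add_pow_of_mul_self_eq_zero h1]
  simp only [mul_pow]
  linear_combination (n * m * x * X₀ * x' * X₁ * z ^ (n - 1) * z' ^ (m - 1) * Y₀ ^ (n - 1) *
    Y₁ ^ (m - 1)) * he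

variable {p : ℕ} [Fact p.Prime] {R : Type*} [CommRing R] [IsDomain R] [Algebra (Zq p) R]
  {r : Fin 2 → ℕ}

/-- It allows congruences to be computed in a quotient of the polynomial ring and then read as
divisibility in `Sym R r`. -/
theorem exists_smul_of_mk_eq {c : R} (hc : c ≠ 0) {v w : Sym R r}
    (h : Ideal.Quotient.mk (Ideal.span {C c}) (Sym.toPoly R r v) =
      Ideal.Quotient.mk (Ideal.span {(C c : Poly R)}) (Sym.toPoly R r w)) :
    ∃ v', v = w + c • v' := by
  rw [Ideal.Quotient.eq, Ideal.mem_span_singleton, ← map_sub] at h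
  obtain ⟨v', hv'⟩ := exists_smul_of_C_dvd hc h
  exact ⟨v', by rw [← hv', add_sub_cancel]⟩

variable (p R) in
/-- The element of `R` given by the Teichmüller lift. -/
noncomputable def tm (x : GaloisField p 2) : R := algebraMap (Zq p) R (WittVector.teichmuller p x)

theorem frobenius_teichmuller (x : GaloisField p 2) :
    WittVector.frobenius (WittVector.teichmuller p x) = WittVector.teichmuller p x ^ p := by
  rw [WittVector.frobenius_eq_map_frobenius, WittVector.map_teichmuller, ← map_pow]
  rfl

omit [IsDomain R] in
theorem tm_pow (x : GaloisField p 2) (n : ℕ) : tm p R (x ^ n) = tm p R x ^ n := by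
  rw [tm, tm, map_pow, map_pow]

omit [IsDomain R] in
theorem tm_pow_card (x : GaloisField p 2) : tm p R x ^ p ^ 2 = tm p R x := by
  rw [← tm_pow, galoisField_pow_card]

omit [IsDomain R] in
theorem neg_tm_pow_card (hp : Odd p) (x : GaloisField p 2) :
    (-tm p R x) ^ p ^ 2 = -tm p R x := by
  rw [Odd.neg_pow (hp.pow), tm_pow_card]

omit [IsDomain R] in
theorem algebraMap_frobenius_neg_teichmuller (hp : Odd p) (x : GaloisField p 2) :
    algebraMap (Zq p) R (WittVector.frobenius (-WittVector.teichmuller p x)) =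
      (-tm p R x) ^ p := by
  rw [map_neg, frobenius_teichmuller, map_neg, map_pow, hp.neg_pow, tm]

variable (p) in
/-- The matrix `diag(p, 1) κ⁻¹` for `κ` lower unipotent. -/
noncomputable def lowMat (x : GaloisField p 2) : Matrix (Fin 2) (Fin 2) (Zq p) :=
  !![(p : Zq p), 0; -WittVector.teichmuller p x, 1]

variable (p) in
/-- The matrix `diag(p, 1) κ⁻¹` for `κ` the permutation matrix. -/
noncomputable def swapDiag : Matrix (Fin 2) (Fin 2) (Zq p) := !![0, (p : Zq p); 1, 0]

variable (p R r) in
/-- A polynomial whose reduction is supported, as a function on `𝔽_{p²}²`, on the line `Y = 0`. -/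
noncomputable def deltaSym : Sym R r :=
  mon R r (r 0) (r 1) - mon R r (r 0 - (p ^ 2 - 1)) (r 1)

variable (hp2 : Odd p) (hpR : (p : R) ≠ 0)
include hpR

include hp2 in
-- Modulo `p` the substitution is `X_i ↦ (-x)^{p^i} Y_i`, `Y_i ↦ Y_i`: evaluation at `(-x, 1)`.
-- Oddness of `p` lets the sign pass through the Frobenius.
theorem matAct_lowMat_mon (x : GaloisField p 2) {i j : ℕ} (hi : i ≤ r 0) (hj : j ≤ r 1) :
    ∃ v', matAct R r (lowMat p x) (mon R r i j) =
      ((-tm p R x) ^ (i + p * j)) • mon R r 0 0 + (p : R) • v' := by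
  have h0 : Ideal.Quotient.mk (Ideal.span {(C (p : R) : Poly R)}) (C (p : R)) = 0 :=
    Ideal.Quotient.eq_zero_iff_mem.mpr (Ideal.mem_span_singleton_self _)
  apply exists_smul_of_mk_eq hpR
  rw [toPoly_matAct_mon R _ hi hj, map_smul, toPoly_mon R (Nat.zero_le _) (Nat.zero_le _)]
  simp only [subst_X_zero, subst_X_one, lowMat, Matrix.of_apply, Matrix.cons_val', Matrix.cons_val_zero,
    Matrix.cons_val_one, Matrix.cons_val_fin_one, map_natCast, map_zero, map_one,
    algebraMap_frobenius_neg_teichmuller hp2]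
  have e : algebraMap (Zq p) R (-WittVector.teichmuller p x) = -tm p R x := by rw [map_neg, tm]
  rw [e, smul_eq_C_mul]
  simp only [map_mul, map_add, map_pow, map_natCast, map_zero, map_one] at h0 ⊢
  simp only [h0]
  have e3 : r 0 = i + (r 0 - i) := by omega
  have e4 : r 1 = j + (r 1 - j) := by omega
  simp only [zero_mul, zero_add, one_mul, Nat.sub_zero, pow_zero]
  conv_rhs => rw [e3, e4]
  ring

/-- Here the substitution is `X_i ↦ Y_i`, `Y_i ↦ p X_i`, which is evaluation at `(1, 0)` modulo `p`.
-/
theorem matAct_swapDiag_mon {i j : ℕ} (hi : i ≤ r 0) (hj : j ≤ r 1) (h : i ≠ r 0 ∨ j ≠ r 1) :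
    ∃ v', matAct R r (swapDiag p) (mon R r i j) = (p : R) • v' := by
  have h0 : Ideal.Quotient.mk (Ideal.span {(C (p : R) : Poly R)}) (C (p : R)) = 0 :=
    Ideal.Quotient.eq_zero_iff_mem.mpr (Ideal.mem_span_singleton_self _)
  obtain ⟨v', hv'⟩ := exists_smul_of_mk_eq (r := r) hpR
    (v := matAct R r (swapDiag p) (mon R r i j)) (w := 0) (by
      rw [toPoly_matAct_mon R _ hi hj, map_zero, map_zero]
      simp only [subst_X_zero, subst_X_one, swapDiag, Matrix.of_apply, Matrix.cons_val',
        Matrix.cons_val_zero, Matrix.cons_val_one, Matrix.cons_val_fin_one, map_natCast, map_zero,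
        map_one]
      simp only [map_mul, map_add, map_pow, map_natCast] at h0 ⊢
      simp only [h0]
      rcases h with h | h
      · rw [show r 0 - i = r 0 - i - 1 + 1 by omega]
        simp
      · rw [show r 1 - j = r 1 - j - 1 + 1 by omega]
        simp)
  exact ⟨v', by rw [hv', zero_add]⟩

omit hpR [IsDomain R] in
theorem matAct_swapDiag_top : matAct R r (swapDiag p) (mon R r (r 0) (r 1)) = mon R r 0 0 := by
  apply Sym.toPoly_injective
  rw [toPoly_matAct_mon R _ le_rfl le_rfl, toPoly_mon R (Nat.zero_le _) (Nat.zero_le _)]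
  simp [subst_X_zero, subst_X_one, swapDiag]

include hp2 in
/-- The polynomials `θᵢ P` are sent to multiples of `p` by the matrices in `K diag(p, 1) K`. -/
theorem matAct_lowMat_binom (x : GaloisField p 2) {v : Sym R r} (hv : v ∈ binom R p r) :
    ∃ v', matAct R r (lowMat p x) v = (p : R) • v' := by
  have key : ∀ {i j i' j' : ℕ}, i ≤ r 0 → j ≤ r 1 → i' ≤ r 0 → j' ≤ r 1 →
      (-tm p R x) ^ (i + p * j) = (-tm p R x) ^ (i' + p * j') →
      ∃ v', matAct R r (lowMat p x) (mon R r i j - mon R r i' j') = (p : R) • v' := by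
    intro i j i' j' hi hj hi' hj' h
    obtain ⟨v, hv⟩ := matAct_lowMat_mon hp2 hpR x hi hj
    obtain ⟨v', hv'⟩ := matAct_lowMat_mon hp2 hpR x hi' hj'
    exact ⟨v - v', by rw [map_sub, hv, hv', h, smul_sub, add_sub_add_left_eq_sub]⟩
  refine Submodule.span_induction (p := fun v _ => ∃ v', matAct R r (lowMat p x) v = (p : R) • v')
    ?_ ⟨0, by simp⟩ ?_ ?_ hv
  · rintro _ (⟨i, j, hi, hj, rfl⟩ | ⟨i, j, hi, hj, rfl⟩)
    · refine key (by omega) (by omega) (by omega) (by omega) ?_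
      rw [show i + p * (j + p) = (i + p * j) + p ^ 2 by ring, pow_add _ (i + p * j),
        neg_tm_pow_card hp2, ← pow_succ, add_right_comm]
    · exact key (by omega) (by omega) (by omega) (by omega) (by ring)
  · rintro v w - - ⟨v', hv'⟩ ⟨w', hw'⟩
    exact ⟨v' + w', by rw [map_add, hv', hw', smul_add]⟩
  · rintro c v - ⟨v', hv'⟩
    exact ⟨c • v', by rw [map_smul, hv', smul_comm]⟩

theorem matAct_swapDiag_binom {v : Sym R r} (hv : v ∈ binom R p r) :
    ∃ v', matAct R r (swapDiag p) v = (p : R) • v' := by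
  have hp := Nat.Prime.one_lt (Fact.out : p.Prime)
  have key : ∀ {i j i' j' : ℕ}, i ≤ r 0 → j ≤ r 1 → i' ≤ r 0 → j' ≤ r 1 →
      (i ≠ r 0 ∨ j ≠ r 1) → (i' ≠ r 0 ∨ j' ≠ r 1) →
      ∃ v', matAct R r (swapDiag p) (mon R r i j - mon R r i' j') = (p : R) • v' := by
    intro i j i' j' hi hj hi' hj' h h'
    obtain ⟨v, hv⟩ := matAct_swapDiag_mon hpR hi hj h
    obtain ⟨v', hv'⟩ := matAct_swapDiag_mon hpR hi' hj' h'
    exact ⟨v - v', by rw [map_sub, hv, hv', smul_sub]⟩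
  refine Submodule.span_induction (p := fun v _ => ∃ v', matAct R r (swapDiag p) v = (p : R) • v')
    ?_ ⟨0, by simp⟩ ?_ ?_ hv
  · rintro _ (⟨i, j, hi, hj, rfl⟩ | ⟨i, j, hi, hj, rfl⟩)
    · exact key (by omega) (by omega) (by omega) (by omega) (by omega) (by omega)
    · exact key (by omega) (by omega) (by omega) (by omega) (by omega) (by omega)
  · rintro v w - - ⟨v', hv'⟩ ⟨w', hw'⟩
    exact ⟨v' + w', by rw [map_add, hv', hw', smul_add]⟩
  · rintro c v - ⟨v', hv'⟩
    exact ⟨c • v', by rw [map_smul, hv', smul_comm]⟩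

section Delta

variable (hr : p ^ 2 ≤ r 0)
include hr

include hp2 in
theorem matAct_lowMat_delta (x : GaloisField p 2) :
    ∃ v', matAct R r (lowMat p x) (deltaSym p R r) = (p : R) • v' := by
  obtain ⟨v, hv⟩ := matAct_lowMat_mon hp2 hpR (r := r) x (i := r 0) (j := r 1) le_rfl le_rfl
  obtain ⟨v', hv'⟩ := matAct_lowMat_mon hp2 hpR (r := r) x (i := r 0 - (p ^ 2 - 1)) (j := r 1)
    (by omega) le_rfl
  have hq := one_lt_sq (p := p)
  -- The two monomials of `δ` take the same value at `(-x, 1)`; the bound `q ≤ r₀` keeps the second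
  -- exponent positive.
  have e : (-tm p R x) ^ (r 0 + p * r 1) = (-tm p R x) ^ (r 0 - (p ^ 2 - 1) + p * r 1) := by
    refine pow_eq_pow_of_modEq hq (neg_tm_pow_card hp2 x) (by omega) (by omega) ?_
    refine Nat.ModEq.add_right _ ?_
    conv_lhs => rw [show r 0 = r 0 - (p ^ 2 - 1) + (p ^ 2 - 1) by omega]
    simp [Nat.ModEq]
  exact ⟨v - v', by rw [deltaSym, map_sub, hv, hv', e, smul_sub, add_sub_add_left_eq_sub]⟩

theorem matAct_swapDiag_delta :
    ∃ v', matAct R r (swapDiag p) (deltaSym p R r) = mon R r 0 0 + (p : R) • v' := by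
  have hq := one_lt_sq (p := p)
  obtain ⟨v', hv'⟩ := matAct_swapDiag_mon hpR (r := r) (i := r 0 - (p ^ 2 - 1)) (j := r 1)
    (by omega) le_rfl (Or.inl (by omega))
  exact ⟨-v', by rw [deltaSym, map_sub, matAct_swapDiag_top, hv', smul_neg, sub_eq_add_neg]⟩

end Delta

/-- The expansion modulo `p²` of the image of `X₀^{r₀} X₁^{r₁}` under a matrix whose first column is
`(p x, z)`. -/
theorem matAct_top_expansion (hr : ∀ i, 1 ≤ r i) (m : Matrix (Fin 2) (Fin 2) (Zq p)) (x z : Zq p)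
    (hx : m 0 0 = p * x) (hz : m 1 0 = z) :
    ∃ v', matAct R r m (mon R r (r 0) (r 1)) =
      algebraMap (Zq p) R (z ^ r 0 * WittVector.frobenius z ^ r 1) • mon R r 0 0 +
      (p : R) • (algebraMap (Zq p) R
          (r 0 * (x * (z ^ (r 0 - 1) * WittVector.frobenius z ^ r 1))) • mon R r 1 0 +
        algebraMap (Zq p) R (r 1 * (WittVector.frobenius x *
          (z ^ r 0 * WittVector.frobenius z ^ (r 1 - 1)))) • mon R r 0 1) +
      (p : R) • (p : R) • v' := by
  have h0 : Ideal.Quotient.mk (Ideal.span {(C ((p : R) * p) : Poly R)}) (C ((p : R) * p)) = 0 :=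
    Ideal.Quotient.eq_zero_iff_mem.mpr (Ideal.mem_span_singleton_self _)
  simp only [smul_smul (p : R) (p : R)]
  apply exists_smul_of_mk_eq (mul_ne_zero hpR hpR)
  rw [toPoly_matAct_mon R _ le_rfl le_rfl]
  simp only [map_add, map_smul, toPoly_mon R (Nat.zero_le (r 0)) (Nat.zero_le (r 1)),
    toPoly_mon R (hr 0) (Nat.zero_le (r 1)), toPoly_mon R (Nat.zero_le (r 0)) (hr 1), subst_X_zero,
    subst_X_one, hx, hz, smul_eq_C_mul]
  simp only [map_mul, map_add, map_pow, map_natCast] at h0 ⊢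
  simp only [Nat.sub_self, Nat.sub_zero, pow_zero, pow_one, mul_one, one_mul]
  exact mul_add_pow_mul_pow h0 _ _ _ _ _ _ _ _ _ _

end Divisibility

/-! ### The polynomial whose Hecke image yields the sum over the socle vectors. -/

section MainPolynomial

open MvPolynomial

variable {p : ℕ} [Fact p.Prime] {R : Type*} [CommRing R] [IsDomain R] [Algebra (Zq p) R]
  {r : Fin 2 → ℕ}

theorem constantCoeff_frobenius (x : Zq p) :
    WittVector.constantCoeff (WittVector.frobenius x) = WittVector.constantCoeff x ^ p :=
  WittVector.coeff_frobenius_charP p x 0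

variable (p R r) in
/-- The sum of the `μ^{q - p a₁} (X₀ + μ Y₀)^{r₀} (X₁ + μ^p Y₁)^{r₁}`. -/
noncomputable def mainSym (a₁ : ℕ) : Sym R r :=
  ∑ x, tm p R (wt p a₁ x) •
    matAct R r (lowerUnip (WittVector.teichmuller p x)).1 (mon R r (r 0) (r 1))

omit [IsDomain R] in
theorem exists_smul_add_of_constantCoeff_eq {x y : Zq p}
    (h : WittVector.constantCoeff x = WittVector.constantCoeff y) :
    ∃ c : R, algebraMap (Zq p) R x = algebraMap (Zq p) R y + p * c := by
  have h1 : (p : Zq p) ∣ x - y := by rw [← constantCoeff_eq_zero_iff, map_sub, h, sub_self]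
  obtain ⟨c, hc⟩ := h1
  refine ⟨algebraMap (Zq p) R c, ?_⟩
  rw [sub_eq_iff_eq_add'.mp hc, map_add, map_mul, map_natCast]

/-- The expansion modulo `p²` is summed with weights `c y`. Its coefficients come from `ℤ_q`, so
they are controlled modulo `p` by sums over the residue field. The value `d` is an integer so that
it makes sense both in the residue field and in `R`; the coefficient of `Y^r` need only be divisible
by `p`. -/
theorem sum_matAct_top (hpR : (p : R) ≠ 0) (hr : ∀ i, 1 ≤ r i)
    (c x z : GaloisField p 2 → Zq p) (m : GaloisField p 2 → Matrix (Fin 2) (Fin 2) (Zq p))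
    (hx : ∀ y, m y 0 0 = p * x y) (hz : ∀ y, m y 1 0 = z y)
    (h0 : ∑ y, WittVector.constantCoeff (c y) * (WittVector.constantCoeff (z y) ^ r 0 *
      (WittVector.constantCoeff (z y) ^ p) ^ r 1) = 0)
    (d : ℤ) (h1 : (r 0 : GaloisField p 2) * ∑ y, WittVector.constantCoeff (c y) *
      (WittVector.constantCoeff (x y) * (WittVector.constantCoeff (z y) ^ (r 0 - 1) *
        (WittVector.constantCoeff (z y) ^ p) ^ r 1)) = d)
    (h2 : (r 1 : GaloisField p 2) * ∑ y, WittVector.constantCoeff (c y) *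
      (WittVector.constantCoeff (x y) ^ p * (WittVector.constantCoeff (z y) ^ r 0 *
        (WittVector.constantCoeff (z y) ^ p) ^ (r 1 - 1))) = 0) :
    ∃ (A : R) (v : Sym R r), ∑ y, algebraMap (Zq p) R (c y) • matAct R r (m y) (mon R r (r 0) (r 1)) =
      (p : R) • (A • mon R r 0 0 + (d : R) • mon R r 1 0 + (p : R) • v) := by
  choose v hv using fun y => matAct_top_expansion hpR hr (m y) (x y) (z y) (hx y) (hz y)
  obtain ⟨A₀, hA₀⟩ := exists_smul_add_of_constantCoeff_eq (R := R)
    (x := ∑ y, c y * (z y ^ r 0 * WittVector.frobenius (z y) ^ r 1)) (y := 0) (by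
      simpa only [map_sum, map_mul, map_pow, constantCoeff_frobenius, map_zero] using h0)
  obtain ⟨A₁, hA₁⟩ := exists_smul_add_of_constantCoeff_eq (R := R)
    (x := ∑ y, c y * ((r 0 : Zq p) * (x y * (z y ^ (r 0 - 1) * WittVector.frobenius (z y) ^ r 1))))
    (y := (d : Zq p)) (by
      rw [map_intCast, ← h1, Finset.mul_sum, map_sum]
      refine Finset.sum_congr rfl fun y _ => ?_
      simp only [map_mul, map_pow, map_natCast, constantCoeff_frobenius]
      ring)
  obtain ⟨A₂, hA₂⟩ := exists_smul_add_of_constantCoeff_eq (R := R)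
    (x := ∑ y, c y * ((r 1 : Zq p) * (WittVector.frobenius (x y) *
      (z y ^ r 0 * WittVector.frobenius (z y) ^ (r 1 - 1)))))
    (y := 0) (by
      rw [map_zero, ← h2, Finset.mul_sum, map_sum]
      refine Finset.sum_congr rfl fun y _ => ?_
      simp only [map_mul, map_pow, map_natCast, constantCoeff_frobenius]
      ring)
  rw [map_zero, zero_add] at hA₀ hA₂
  rw [map_intCast] at hA₁
  refine ⟨A₀, A₁ • mon R r 1 0 + A₂ • mon R r 0 1 + ∑ y, algebraMap (Zq p) R (c y) • v y, ?_⟩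
  have e : ∀ y, algebraMap (Zq p) R (c y) • matAct R r (m y) (mon R r (r 0) (r 1)) =
      algebraMap (Zq p) R (c y * (z y ^ r 0 * WittVector.frobenius (z y) ^ r 1)) • mon R r 0 0 +
      (p : R) • (algebraMap (Zq p) R (c y * (r 0 * (x y * (z y ^ (r 0 - 1) *
        WittVector.frobenius (z y) ^ r 1)))) • mon R r 1 0) +
      (p : R) • (algebraMap (Zq p) R (c y * (r 1 * (WittVector.frobenius (x y) *
      (z y ^ r 0 * WittVector.frobenius (z y) ^ (r 1 - 1))))) • mon R r 0 1) +
      (p : R) • (p : R) • algebraMap (Zq p) R (c y) • v y := by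
    intro y
    rw [hv y, map_mul _ (c y), map_mul _ (c y), map_mul _ (c y)]
    module
  simp only [e, Finset.sum_add_distrib, ← Finset.smul_sum, ← Finset.sum_smul, ← map_sum, hA₀, hA₁,
    hA₂]
  module

omit [IsDomain R] in
theorem matAct_mainSym (m : Matrix (Fin 2) (Fin 2) (Zq p)) (a₁ : ℕ) :
    matAct R r m (mainSym p R r a₁) =
      ∑ y, algebraMap (Zq p) R (WittVector.teichmuller p (wt p a₁ y)) • matAct R r
        (m * (lowerUnip (WittVector.teichmuller p y)).1) (mon R r (r 0) (r 1)) := by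
  rw [mainSym, map_sum]
  refine Finset.sum_congr rfl fun y _ => ?_
  rw [map_smul, map_mul, Module.End.mul_apply]
  rfl

variable {a₁ : ℕ} (hpR : (p : R) ≠ 0) (hr : ∀ i, p ^ 2 ≤ r i) (ha₁ : 1 ≤ a₁) (ha₁' : a₁ ≤ p - 1)
  (hr₁ : a₁ = 1 → p ∣ r 1)
include hpR hr ha₁ ha₁' hr₁

/-- The product of `lowMat p x` with the unipotent of `y` has first column `(p, [y] - [x])`, whence
the sums in `(y - x)` computed above. -/
theorem matAct_lowMat_mainSym (hcong : r 0 + p * r 1 ≡ p * a₁ [MOD p ^ 2 - 1])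
    (x : GaloisField p 2) : ∃ (A : R) (v : Sym R r), matAct R r (lowMat p x) (mainSym p R r a₁) =
      (p : R) • (A • mon R r 0 0 + ((-(r 0 : ℤ) : ℤ) : R) • mon R r 1 0 + (p : R) • v) := by
  have hq := one_lt_sq (p := p)
  rw [matAct_mainSym]
  refine sum_matAct_top hpR (fun i => hq.le.trans (hr i)) _ (fun _ => 1)
    (fun y => WittVector.teichmuller p y - WittVector.teichmuller p x) _ (fun y => ?_) (fun y => ?_)
    ?_ _ ?_ ?_
  · simp [lowMat, lowerUnip, Matrix.mul_apply, Fin.sum_univ_two]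
  · simp [lowMat, lowerUnip, Matrix.mul_apply, Fin.sum_univ_two]
    ring
  · simp only [map_sub, constantCoeff_teichmuller]
    exact sum_wt_value hr ha₁ ha₁' hcong x
  · simp only [map_sub, constantCoeff_teichmuller, map_one, one_mul]
    rw [sum_wt_deriv₀ hr ha₁ ha₁' hcong x]
    simp
  · simp only [map_sub, constantCoeff_teichmuller, map_one, one_mul, one_pow]
    exact sum_wt_deriv₁ hr ha₁ ha₁' hcong hr₁ x

/-- The first column is `(p [y], 1)`, so the weighted sums of `1`, `y` and `y^p` are needed. The sum
of `y` vanishes for `a₁ = 1` only because `p > 2`. -/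
theorem matAct_swapDiag_mainSym (hp2 : 2 < p) :
    ∃ (A : R) (v : Sym R r), matAct R r (swapDiag p) (mainSym p R r a₁) =
      (p : R) • (A • mon R r 0 0 + (p : R) • v) := by
  have hq := one_lt_sq (p := p)
  rw [matAct_mainSym]
  obtain ⟨A, v, h⟩ := sum_matAct_top hpR (fun i => hq.le.trans (hr i))
    (fun y => WittVector.teichmuller p (wt p a₁ y)) (fun y => WittVector.teichmuller p y)
    (fun _ => 1) (fun y => swapDiag p * (lowerUnip (WittVector.teichmuller p y)).1)
    (fun y => by simp [swapDiag, lowerUnip, Matrix.mul_apply, Fin.sum_univ_two])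
    (fun y => by simp [swapDiag, lowerUnip, Matrix.mul_apply, Fin.sum_univ_two])
    (by
      simp only [constantCoeff_teichmuller, map_one, one_pow, mul_one]
      exact sum_wt ha₁ ha₁') 0
    (by
      simp only [constantCoeff_teichmuller, map_one, one_pow, mul_one]
      rw [sum_wt_mul hp2 ha₁ ha₁']
      simp)
    (by
      simp only [constantCoeff_teichmuller, map_one, one_pow, mul_one]
      exact sum_wt_mul_pow ha₁ ha₁' hr₁)
  exact ⟨A, v, by rw [h, Int.cast_zero, zero_smul, add_zero]⟩

end MainPolynomial

/-! ### Elements of the kernel of the map to `Θ̄`. -/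

section Kill

/-- The maps `L` and `L' i` stand for the brackets in the formula for `T`; this collects the terms
of `T[g, P]`. -/
theorem add_sum_map_smul {A V M ι : Type*} [CommRing A] [AddCommGroup V] [Module A V]
    [AddCommGroup M] [Module A M] [Fintype ι] (L : V →ₗ[A] M) (L' : ι → V →ₗ[A] M) (c d B : A)
    (A' : ι → A) (x y w : V) (u : ι → V) :
    L (c • (B • x + c • w)) + ∑ i, L' i (c • (A' i • x + (-d) • y + c • u i)) =
      c • ((B • L x + ∑ i, A' i • L' i x) + c • (L w + ∑ i, L' i (u i)) - d • ∑ i, L' i y) := by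
  have e : ∀ i, L' i (c • (A' i • x + (-d) • y + c • u i)) =
      c • (A' i • L' i x) - c • d • L' i y + c • c • L' i (u i) := by
    intro i
    simp only [map_smul, map_add]
    module
  simp only [e, Finset.sum_add_distrib, Finset.sum_sub_distrib, ← Finset.smul_sum, map_smul, map_add]
  module

variable {p : ℕ} [Fact p.Prime]

theorem heckeT_zero_br {R : Type*} [CommRing R] [Algebra (Zq p) R] (r : Fin 2 → ℕ) (g : G p)
    (v : Sym R r) : heckeT R r 0 (br (symRep (p := p) R r 0) g v) =
      br (symRep (p := p) R r 0) (g * toG p swapMat * alpha p) (matAct R r (swapDiag p) v) +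
      ∑ x, br (symRep (p := p) R r 0) (g * toG p (lowerUnip (WittVector.teichmuller p x)) * alpha p)
        (matAct R r (lowMat p x) v) := by
  rw [heckeT_br, Fintype.sum_option]
  simp only [symRep_zero_apply, ← Module.End.mul_apply, ← map_mul]
  simp only [cosetRep, diagP_mul_lowerUnip_inv, diagP_mul_swapMat_inv]
  rfl

/-- Because of this identity, one of the terms of `T[g u(x) α, v]` is again a bracket over `g`. -/
theorem alpha_swapMat_alpha :
    alpha p * toG p swapMat * alpha p = pScalar p ^ (1 : ℤ) * toG p swapMat := by
  have hw : (toG p swapMat).1 = !![(0 : Qq p), 1; 1, 0] := by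
    ext i j
    change algebraMap (Zq p) (Qq p) (!![(0 : Zq p), 1; 1, 0] i j) = _
    fin_cases i <;> fin_cases j <;> simp
  have hα : (alpha p).1 = !![1, 0; 0, (p : Qq p)] := rfl
  have hs : (pScalar p).1 = !![(p : Qq p), 0; 0, (p : Qq p)] := by
    rw [pScalar, Matrix.GeneralLinearGroup.coe_scalar, Matrix.scalar_apply]
    ext i j
    rw [Matrix.diagonal_apply]
    fin_cases i <;> fin_cases j <;> simp
  apply Units.ext
  rw [zpow_one, Units.val_mul, Units.val_mul, Units.val_mul, hw, hα, hs]
  simp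

theorem matAct_swapMat_mon_zero {R : Type*} [CommRing R] [Algebra (Zq p) R] (r : Fin 2 → ℕ) :
    matAct R r (swapMat (p := p)).1 (mon R r 0 0) = mon R r (r 0) (r 1) := by
  apply Sym.toPoly_injective
  rw [toPoly_matAct_mon R _ (Nat.zero_le _) (Nat.zero_le _), toPoly_mon R le_rfl le_rfl]
  simp [subst_X_zero, subst_X_one, swapMat]

theorem coeffMap_matAct (S R : Type*) [CommRing S] [CommRing R] [Algebra S R] [Algebra (Zq p) S]
    [Algebra (Zq p) R] [IsScalarTower (Zq p) S R] (r : Fin 2 → ℕ)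
    (m : Matrix (Fin 2) (Fin 2) (Zq p)) (v : Sym S r) :
    coeffMap S R r (matAct S r m v) = matAct R r m (coeffMap S R r v) := by
  have h : ∀ w : Poly S, MvPolynomial.map (algebraMap S R) (subst S m w) =
      subst R m (MvPolynomial.map (algebraMap S R) w) := by
    intro w
    induction w using MvPolynomial.induction_on with
    | C a => simp [subst]
    | add a b ha hb => simp only [map_add, ha, hb]
    | mul_X a x ha =>
      rw [map_mul, map_mul, map_mul, map_mul, ha]
      simp only [subst, MvPolynomial.map_X, MvPolynomial.aeval_X, map_sum, map_mul,
        MvPolynomial.map_C, ← IsScalarTower.algebraMap_apply]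
  exact Sym.toPoly_injective R r (h (Sym.toPoly S r v))

theorem coeffMap_heckeFun (S R : Type*) [CommRing S] [CommRing R] [Algebra S R] [Algebra (Zq p) S]
    [Algebra (Zq p) R] [IsScalarTower (Zq p) S R] (r : Fin 2 → ℕ) (g : G p) (v : Sym S r) :
    coeffMap S R r (heckeFun S r 0 g v) = heckeFun R r 0 g (coeffMap S R r v) := by
  by_cases h : ∃ x : ℤ × K p × K p,
      g = pScalar p ^ x.1 * toG p x.2.1 * (alpha p)⁻¹ * toG p x.2.2
  · obtain ⟨x, rfl⟩ := h
    simp only [heckeFun_apply, Module.End.mul_apply, coeffMap_symRep, coeffMap_matAct]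
  · rw [heckeFun, heckeFun, dif_neg h, dif_neg h, LinearMap.zero_apply, LinearMap.zero_apply,
      map_zero]

variable (𝒪 E : Type*) [CommRing 𝒪] [Field E] [Algebra 𝒪 E] [Algebra (Zq p) 𝒪] [Algebra (Zq p) E]
  [IsScalarTower (Zq p) 𝒪 E]

theorem indMap_heckeT (r : Fin 2 → ℕ) (F : ind (symRep (p := p) 𝒪 r 0)) :
    indMap (symRep 𝒪 r 0) (symRep E r 0) (coeffMap 𝒪 E r) (coeffMap_symRep 𝒪 E r 0)
      (heckeT 𝒪 r 0 F) =
    heckeT E r 0 (indMap (symRep 𝒪 r 0) (symRep E r 0) (coeffMap 𝒪 E r)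
      (coeffMap_symRep 𝒪 E r 0) F) := by
  ext g : 2
  change coeffMap 𝒪 E r (∑ᶠ c : G p ⧸ KZ p, heckeFun 𝒪 r 0 c.out (F.1 (c.out⁻¹ * g))) =
    ∑ᶠ c : G p ⧸ KZ p, heckeFun E r 0 c.out (coeffMap 𝒪 E r (F.1 (c.out⁻¹ * g)))
  have h := (coeffMap 𝒪 E r).toAddMonoidHom.map_finsum (heckeSummand_finite 𝒪 r 0 F g)
  simp only [LinearMap.toAddMonoidHom_coe] at h
  rw [h]
  exact finsum_congr fun c => coeffMap_heckeFun 𝒪 E r _ _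

variable [IsLocalRing 𝒪] (p) in
/-- The kernel of `ind_{KZ}^G (Sym^{r₀} 𝒪² ⊗ Sym^{r₁} 𝒪²) → Θ̄`. -/
noncomputable def kill (r : Fin 2 → ℕ) (a : 𝒪) : Submodule 𝒪 (ind (symRep (p := p) 𝒪 r 0)) :=
  LinearMap.ker (toThetaBar 𝒪 E r (algebraMap 𝒪 E a))

variable [IsLocalRing 𝒪] {r : Fin 2 → ℕ} {a : 𝒪}

theorem smul_mem_kill {x : 𝒪} (hx : x ∈ IsLocalRing.maximalIdeal 𝒪)
    (f : ind (symRep (p := p) 𝒪 r 0)) : x • f ∈ kill p 𝒪 E r a := by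
  have hx' : x • (1 : IsLocalRing.ResidueField 𝒪) = 0 := by
    rw [Algebra.smul_def, IsLocalRing.ResidueField.algebraMap_eq,
      (IsLocalRing.residue_eq_zero_iff x).mpr hx, zero_mul]
  rw [kill, LinearMap.mem_ker, map_smul, toThetaBar, LinearMap.comp_apply,
    TensorProduct.mk_apply, TensorProduct.smul_tmul', hx', TensorProduct.zero_tmul]

/-- Over `E` the scalar `c` is invertible, so `f` is the image of `c⁻¹ F` under `T - a`, although
`c⁻¹ F` need not be integral. -/
theorem mem_kill_of_smul_eq [FaithfulSMul 𝒪 E] {c : 𝒪} (hc : c ≠ 0) {f F : ind (symRep (p := p) 𝒪 r 0)}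
    (h : heckeT 𝒪 r 0 F - a • F = c • f) : f ∈ kill p 𝒪 E r a := by
  have hc' : algebraMap 𝒪 E c ≠ 0 := (map_ne_zero_iff _ (FaithfulSMul.algebraMap_injective 𝒪 E)).mpr hc
  have h0 : toPi 𝒪 E r (algebraMap 𝒪 E a) f = 0 := by
    rw [toPi, LinearMap.comp_apply, LinearMap.restrictScalars_apply, Submodule.mkQ_apply,
      Submodule.Quotient.mk_eq_zero]
    set ι := indMap (symRep (p := p) 𝒪 r 0) (symRep E r 0) (coeffMap 𝒪 E r) (coeffMap_symRep 𝒪 E r 0)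
    refine ⟨(algebraMap 𝒪 E c)⁻¹ • ι F, ?_⟩
    have h1 : heckeT E r 0 (ι F) - algebraMap 𝒪 E a • ι F = algebraMap 𝒪 E c • ι f := by
      rw [← indMap_heckeT, algebraMap_smul, algebraMap_smul, ← map_smul, ← map_smul, ← map_sub, h]
    rw [map_smul, LinearMap.sub_apply, LinearMap.smul_apply, Module.End.one_apply, h1, smul_smul,
      inv_mul_cancel₀ hc', one_smul]
  rw [kill, LinearMap.mem_ker, toThetaBar, LinearMap.comp_apply]
  have h1 : (toPi (p := p) 𝒪 E r (algebraMap 𝒪 E a)).rangeRestrict f = 0 := Subtype.ext h0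
  rw [h1, map_zero]

theorem heckeT_mem_kill [FaithfulSMul 𝒪 E] (ha : a ∈ IsLocalRing.maximalIdeal 𝒪)
    (F : ind (symRep (p := p) 𝒪 r 0)) : heckeT 𝒪 r 0 F ∈ kill p 𝒪 E r a := by
  have h : heckeT 𝒪 r 0 F - a • F ∈ kill p 𝒪 E r a :=
    mem_kill_of_smul_eq 𝒪 E one_ne_zero (by rw [one_smul])
  simpa using (kill p 𝒪 E r a).add_mem h (smul_mem_kill 𝒪 E ha F)

variable [IsDomain 𝒪] [FaithfulSMul 𝒪 E] (hpR : (p : 𝒪) ≠ 0) (hp2 : Odd p)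
  (hp𝔪 : (p : 𝒪) ∈ IsLocalRing.maximalIdeal 𝒪) (hr : p ^ 2 ≤ r 0)
  (ha : a ∈ IsLocalRing.maximalIdeal 𝒪)
include hpR hp2 hp𝔪 hr ha

/-- Modulo `p`, it is `T[g₀, δ]` for `g₀ w α = g`: of the values of `δ` that occur, only the one at
`(1, 0)` is nonzero. -/
theorem br_mon_zero_mem_kill (g : G p) :
    br (symRep (p := p) 𝒪 r 0) g (mon 𝒪 r 0 0) ∈ kill p 𝒪 E r a := by
  set g₀ := g * (toG p swapMat * alpha p)⁻¹ with hg₀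
  have hg : g₀ * toG p swapMat * alpha p = g := by rw [hg₀, mul_assoc, inv_mul_cancel_right]
  have h := heckeT_mem_kill 𝒪 E ha (br (symRep (p := p) 𝒪 r 0) g₀ (deltaSym p 𝒪 r))
  obtain ⟨v, hv⟩ := matAct_swapDiag_delta hpR hr
  choose w hw using matAct_lowMat_delta hp2 hpR hr
  rw [heckeT_zero_br, hg, hv, map_add, map_smul] at h
  have h1 : (∑ x, br (symRep (p := p) 𝒪 r 0)
      (g₀ * toG p (lowerUnip (WittVector.teichmuller p x)) * alpha p)
        (matAct 𝒪 r (lowMat p x) (deltaSym p 𝒪 r))) ∈ kill p 𝒪 E r a := by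
    refine Submodule.sum_mem _ fun x _ => ?_
    rw [hw, map_smul]
    exact smul_mem_kill 𝒪 E hp𝔪 _
  have h2 := Submodule.sub_mem _ (Submodule.sub_mem _ h h1)
    (smul_mem_kill 𝒪 E (r := r) (a := a) hp𝔪 (br (symRep (p := p) 𝒪 r 0) g v))
  simpa using h2

omit hr ha hp𝔪 in
-- Since `T[g, v] = p F = a b F`, dividing `(T - a)[g, v]` by `a` gives `b F - [g, v]`, and `b F`
-- vanishes in `Θ̄`.
theorem br_binom_mem_kill {b : 𝒪} (hb : b ∈ IsLocalRing.maximalIdeal 𝒪) (hab : (p : 𝒪) = a * b)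
    (g : G p) {v : Sym 𝒪 r} (hv : v ∈ binom 𝒪 p r) :
    br (symRep (p := p) 𝒪 r 0) g v ∈ kill p 𝒪 E r a := by
  have ha0 : a ≠ 0 := by
    rintro rfl
    rw [zero_mul] at hab
    exact hpR hab
  obtain ⟨w, hw⟩ := matAct_swapDiag_binom hpR hv
  choose u hu using fun x => matAct_lowMat_binom hp2 hpR x hv
  set F := br (symRep (p := p) 𝒪 r 0) (g * toG p swapMat * alpha p) w +
    ∑ x, br (symRep (p := p) 𝒪 r 0)
      (g * toG p (lowerUnip (WittVector.teichmuller p x)) * alpha p) (u x) with hF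
  have h : heckeT 𝒪 r 0 (br (symRep (p := p) 𝒪 r 0) g v) = (p : 𝒪) • F := by
    rw [heckeT_zero_br, hw]
    simp only [hu, map_smul, hF, smul_add, Finset.smul_sum]
  have h1 : b • F - br (symRep (p := p) 𝒪 r 0) g v ∈ kill p 𝒪 E r a :=
    mem_kill_of_smul_eq 𝒪 E ha0 (F := br (symRep (p := p) 𝒪 r 0) g v) (by
      rw [h, smul_sub, smul_smul, ← hab])
  simpa using Submodule.sub_mem _ (smul_mem_kill 𝒪 E (r := r) (a := a) hb F) h1

omit hr in
/-- The sum that expresses the Hecke operator on the socle of `Q` lies in the kernel. -/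
theorem sum_br_mem_kill (hp3 : 2 < p) (hr : ∀ i, p ^ 2 ≤ r i) {a₁ : ℕ} (ha₁ : 1 ≤ a₁)
    (ha₁' : a₁ ≤ p - 1) (hr₁ : a₁ = 1 → p ∣ r 1) (hcong : r 0 + p * r 1 ≡ p * a₁ [MOD p ^ 2 - 1])
    {b : 𝒪} (hb : b ∈ IsLocalRing.maximalIdeal 𝒪) (hab : a * a = p * b)
    (hr₀ : IsUnit (r 0 : 𝒪)) (g : G p) :
    ∑ x, br (symRep (p := p) 𝒪 r 0) (g * toG p (lowerUnip (WittVector.teichmuller p x)) * alpha p)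
      (mon 𝒪 r 1 0) ∈ kill p 𝒪 E r a := by
  obtain ⟨B, w, hw⟩ := matAct_swapDiag_mainSym hpR hr ha₁ ha₁' hr₁ hp3
  choose A u hu using matAct_lowMat_mainSym hpR hr ha₁ ha₁' hr₁ hcong
  obtain ⟨d, hd⟩ := matAct_swapDiag_delta hpR (hr 0)
  choose e he using matAct_lowMat_delta hp2 hpR (hr 0)
  set B' := br (symRep (p := p) 𝒪 r 0) with hB'
  set l : GaloisField p 2 → K p := fun x => lowerUnip (WittVector.teichmuller p x)
  -- By `α w α = p w` the term of `w` is `[g, u(x) w Y^r] = [g, u(x) X^r]` modulo `p`, and the other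
  -- terms are divisible by `p`.
  have hT : ∀ x, ∃ f, heckeT 𝒪 r 0 (B' (g * toG p (l x) * alpha p) (deltaSym p 𝒪 r)) =
      B' g (matAct 𝒪 r (l x).1 (mon 𝒪 r (r 0) (r 1))) + (p : 𝒪) • f := by
    intro x
    refine ⟨B' g (symRep 𝒪 r 0 (l x) (symRep 𝒪 r 0 (swapMat (p := p)) d)) +
      ∑ y, B' (g * toG p (l x) * alpha p * toG p (l y) * alpha p) (e y), ?_⟩
    have h1 : g * toG p (l x) * alpha p * toG p swapMat * alpha p =
        g * toG p (l x) * (pScalar p ^ (1 : ℤ) * toG p swapMat) := by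
      rw [← alpha_swapMat_alpha]
      simp only [mul_assoc]
    rw [heckeT_zero_br, h1, br_mul, br_mul_toG, hd]
    simp only [he, map_add, map_smul, smul_add, Finset.smul_sum]
    rw [symRep_zero_apply 𝒪 r swapMat (mon 𝒪 r 0 0), matAct_swapMat_mon_zero,
      symRep_zero_apply 𝒪 r (l x) (mon 𝒪 r (r 0) (r 1))]
    rw [← add_assoc]
  choose f hf using hT
  set c : GaloisField p 2 → 𝒪 := fun x => tm p 𝒪 (wt p a₁ x)
  set F₂ := ∑ x, c x • B' (g * toG p (l x) * alpha p) (deltaSym p 𝒪 r)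
  have h2 : heckeT 𝒪 r 0 F₂ = B' g (mainSym p 𝒪 r a₁) + (p : 𝒪) • ∑ x, c x • f x := by
    simp only [F₂, mainSym, map_sum, map_smul, hf, smul_add, Finset.sum_add_distrib,
      Finset.smul_sum]
    congr 1
    exact Finset.sum_congr rfl fun x _ => smul_comm _ _ _
  have h1 : heckeT 𝒪 r 0 (B' g (mainSym p 𝒪 r a₁)) = (p : 𝒪) •
      ((B • B' (g * toG p swapMat * alpha p) (mon 𝒪 r 0 0) +
        ∑ x, A x • B' (g * toG p (l x) * alpha p) (mon 𝒪 r 0 0)) +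
      (p : 𝒪) • (B' (g * toG p swapMat * alpha p) w + ∑ x, B' (g * toG p (l x) * alpha p) (u x)) -
      (r 0 : 𝒪) • ∑ x, B' (g * toG p (l x) * alpha p) (mon 𝒪 r 1 0)) := by
    rw [heckeT_zero_br, hw]
    simp only [hu, Int.cast_neg, Int.cast_natCast]
    exact add_sum_map_smul _ _ _ _ _ _ _ _ _ _
  set n₁ := B • B' (g * toG p swapMat * alpha p) (mon 𝒪 r 0 0) +
        ∑ x, A x • B' (g * toG p (l x) * alpha p) (mon 𝒪 r 0 0) with hn₁
  set n₂ := B' (g * toG p swapMat * alpha p) w + ∑ x, B' (g * toG p (l x) * alpha p) (u x)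
  set S := ∑ x, B' (g * toG p (l x) * alpha p) (mon 𝒪 r 1 0)
  have h3 : n₁ + (p : 𝒪) • n₂ - (r 0 : 𝒪) • S + a • (∑ x, c x • f x) - b • F₂ ∈ kill p 𝒪 E r a := by
    -- In `(T - a)([g, P] + a F₂)` the term `-a [g, P]` cancels against `a T F₂` modulo `a p`, and
    -- `a² F₂ = p b F₂`. Everything left is divisible by `p`.
    refine mem_kill_of_smul_eq 𝒪 E hpR (F := B' g (mainSym p 𝒪 r a₁) + a • F₂) ?_
    have e : a • a • F₂ = (p : 𝒪) • b • F₂ := by rw [smul_smul, hab, smul_smul]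
    rw [map_add, map_smul, h1, h2]
    simp only [smul_add, e]
    module
  have h4 : n₁ ∈ kill p 𝒪 E r a := by
    have h0 := br_mon_zero_mem_kill 𝒪 E hpR hp2 hp𝔪 (hr 0) ha
    exact Submodule.add_mem _ (Submodule.smul_mem _ _ (h0 _))
      (Submodule.sum_mem _ fun x _ => Submodule.smul_mem _ _ (h0 _))
  have h5 : (r 0 : 𝒪) • S ∈ kill p 𝒪 E r a := by
    have h6 := Submodule.sub_mem _ (Submodule.add_mem _ (Submodule.add_mem _ (Submodule.add_mem _ h4
      (smul_mem_kill 𝒪 E hp𝔪 n₂)) (smul_mem_kill 𝒪 E ha (∑ x, c x • f x)))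
      (Submodule.neg_mem _ (smul_mem_kill 𝒪 E hb F₂))) h3
    convert h6 using 1
    abel
  obtain ⟨t, ht⟩ := hr₀.exists_left_inv
  have h7 := Submodule.smul_mem _ t h5
  rwa [smul_smul, ht, one_smul] at h7

end Kill

/-! ### Coefficients and linear maps prescribed on monomials. -/

section Coefficients

open MvPolynomial

variable {R : Type*} [CommRing R] {r : Fin 2 → ℕ}

theorem expo_inj {i j i' j' : ℕ} (h : expo r i j = expo r i' j') : i = i' ∧ j = j' := by
  have h0 := DFunLike.congr_fun h (0, 0)
  have h1 := DFunLike.congr_fun h (1, 0)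
  simp [expo] at h0 h1
  exact ⟨h0, h1⟩

variable (R r) in
/-- The coefficient of `X₀^i Y₀^{r₀-i} X₁^j Y₁^{r₁-j}`. -/
noncomputable def coeffMon (i j : ℕ) : Sym R r →ₗ[R] R := (lcoeff R (expo r i j)).comp (Sym.toPoly R r)

theorem coeffMon_mon {i j i' j' : ℕ} (hi : i ≤ r 0) (hj : j ≤ r 1) :
    coeffMon R r i' j' (mon R r i j) = if i = i' ∧ j = j' then 1 else 0 := by
  classical
  rw [coeffMon, LinearMap.comp_apply, toPoly_mon_eq_monomial R hi hj, lcoeff_apply, coeff_monomial]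
  refine if_congr ⟨expo_inj, ?_⟩ rfl rfl
  rintro ⟨rfl, rfl⟩
  rfl

/-- The linear map on `Sym R r` with prescribed values on the monomials. -/
noncomputable def monConstr {V : Type*} [AddCommGroup V] [Module R V] (φ : ℕ → ℕ → V) :
    Sym R r →ₗ[R] V :=
  ∑ i ∈ Finset.range (r 0 + 1), ∑ j ∈ Finset.range (r 1 + 1), (coeffMon R r i j).smulRight (φ i j)

theorem monConstr_mon {V : Type*} [AddCommGroup V] [Module R V] (φ : ℕ → ℕ → V) {i j : ℕ}
    (hi : i ≤ r 0) (hj : j ≤ r 1) : monConstr (R := R) φ (mon R r i j) = φ i j := by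
  simp only [monConstr, LinearMap.sum_apply, LinearMap.smulRight_apply, coeffMon_mon hi hj]
  rw [Finset.sum_eq_single i, Finset.sum_eq_single j]
  · simp
  · intro j' _ hj'
    rw [if_neg (fun h => hj' h.2.symm), zero_smul]
  · intro h
    exact absurd (Finset.mem_range.mpr (by omega)) h
  · intro i' _ hi'
    refine Finset.sum_eq_zero fun j' _ => ?_
    rw [if_neg (fun h => hi' h.1.symm), zero_smul]
  · intro h
    exact absurd (Finset.mem_range.mpr (by omega)) h

theorem monConstr_apply_mon (v : Sym R r) : monConstr (fun i j => mon R r i j) v = v := by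
  have h : monConstr (fun i j => mon R r i j) = LinearMap.id (R := R) (M := Sym R r) :=
    hom_ext_mon R fun i j hi hj => monConstr_mon _ hi hj
  rw [h, LinearMap.id_apply]

end Coefficients

/-! ### Polynomials in characteristic `p` as functions on pairs. -/

section Evaluation

open MvPolynomial

variable {p : ℕ} [Fact p.Prime] (k : Type*) [Field k] [Algebra (Zq p) k] [CharP k p]

variable (p) in
/-- The embedding of the residue field of `ℤ_{p²}` in `k`. -/
noncomputable def tau : GaloisField p 2 →+* k where
  toFun x := tm p k x
  map_one' := by rw [tm, map_one, map_one]
  map_mul' x y := by rw [tm, map_mul, map_mul, tm, tm]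
  map_zero' := by rw [tm, WittVector.teichmuller_zero, map_zero]
  -- The Teichmüller lift is not additive, but the map from `ℤ_q` to `k` depends only on the
  -- residue.
  map_add' x y := by
    rw [tm, tm, tm, ← map_add]
    apply algebraMap_eq_of_coeff
    rw [map_add WittVector.constantCoeff, constantCoeff_teichmuller, constantCoeff_teichmuller,
      constantCoeff_teichmuller]

theorem algebraMap_teichmuller (x : GaloisField p 2) :
    algebraMap (Zq p) k (WittVector.teichmuller p x) = tau p k x := rfl

theorem algebraMap_pow_card (x : Zq p) : algebraMap (Zq p) k x ^ p ^ 2 = algebraMap (Zq p) k x := by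
  rw [sq, pow_mul, algebraMap_pow_pow]

theorem algebraMap_pow_eq {n m : ℕ} (hn : n ≠ 0) (hm : m ≠ 0) (h : n ≡ m [MOD p ^ 2 - 1]) (x : Zq p) :
    algebraMap (Zq p) k x ^ n = algebraMap (Zq p) k x ^ m :=
  pow_eq_pow_of_modEq one_lt_sq (algebraMap_pow_card k x) hn hm h

theorem sum_tau_pow (n : ℕ) :
    ∑ x, tau p k x ^ n = if n ≠ 0 ∧ p ^ 2 - 1 ∣ n then -1 else 0 := by
  simp only [← map_pow, ← map_sum, sum_galoisField_pow]
  split_ifs <;> simp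

/-- Averaging over `𝔽_{p²}` extracts a coefficient. -/
theorem sum_tau_pow_smul {V ι : Type*} [AddCommGroup V] [Module k V] (s : Finset ι) (n : ι → ℕ)
    (f : ι → V) (m : ℕ) {i₀ : ι} (hi₀ : i₀ ∈ s) (h0 : m + n i₀ = p ^ 2 - 1)
    (h : ∀ i ∈ s, m + n i < 2 * (p ^ 2 - 1)) (hn : ∀ i ∈ s, n i = n i₀ → i = i₀) :
    ∑ x, tau p k x ^ m • ∑ i ∈ s, tau p k x ^ n i • f i = -f i₀ := by
  have hq := one_lt_sq (p := p)
  have e : ∑ x, tau p k x ^ m • ∑ i ∈ s, tau p k x ^ n i • f i =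
      ∑ i ∈ s, (∑ x, tau p k x ^ (m + n i)) • f i := by
    simp only [Finset.smul_sum, Finset.sum_smul, smul_smul, ← pow_add]
    exact Finset.sum_comm
  rw [e, Finset.sum_eq_single i₀]
  · rw [sum_tau_pow, if_pos ⟨by omega, dvd_of_eq h0.symm⟩, neg_one_smul]
  · intro i hi hne
    rw [sum_tau_pow, if_neg, zero_smul]
    rintro ⟨hz, t, ht⟩
    have h1 := h i hi
    have ht1 : t = 1 := by
      rcases t with _ | _ | t
      · omega
      · rfl
      · exfalso
        have : (p ^ 2 - 1) * (t + 1 + 1) = (p ^ 2 - 1) * t + 2 * (p ^ 2 - 1) := by ring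
        omega
    subst ht1
    exact hne (hn i hi (by omega))
  · intro h
    exact absurd hi₀ h

/-- Evaluation at a point of `ℤ_{p²}²`, embedded by `X_i ↦ x^{p^i}`, `Y_i ↦ y^{p^i}`. -/
noncomputable def ev (v : Fin 2 → Zq p) : Poly k →ₐ[k] k :=
  aeval fun x => algebraMap (Zq p) k (v x.2) ^ p ^ (x.1 : ℕ)

omit [CharP k p] in
theorem ev_X (v : Fin 2 → Zq p) (i j : Fin 2) :
    ev k v (X (i, j)) = algebraMap (Zq p) k (v j) ^ p ^ (i : ℕ) := by
  rw [ev, aeval_X]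

/-- The Frobenius twist on `X₁, Y₁` matches the `p`-th powers in the evaluation, so `K` acts on
functions by right translation. -/
theorem ev_subst (m : Matrix (Fin 2) (Fin 2) (Zq p)) (v : Fin 2 → Zq p) (P : Poly k) :
    ev k v (subst k m P) = ev k (Matrix.vecMul v m) P := by
  have : ExpChar k p := ExpChar.prime Fact.out
  have h : (ev k v).comp (subst k m) = ev k (Matrix.vecMul v m) := by
    apply algHom_ext
    rintro ⟨i, j⟩
    rw [AlgHom.comp_apply]
    fin_cases i
    · simp only [Fin.zero_eta]
      rw [subst_X_zero]
      simp only [map_add, map_mul, ev_X, algHom_C, Matrix.vecMul, dotProduct, Fin.sum_univ_two,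
        Algebra.algebraMap_self, RingHom.id_apply]
      simp
      ring
    · simp only [Fin.mk_one]
      rw [subst_X_one]
      simp only [map_add, map_mul, ev_X, algHom_C, Matrix.vecMul, dotProduct, Fin.sum_univ_two,
        Algebra.algebraMap_self, RingHom.id_apply, algebraMap_frobenius]
      simp only [Fin.val_one, pow_one, add_pow_expChar, mul_pow]
      ring
  exact DFunLike.congr_fun h P

theorem ev_theta (v : Fin 2 → Zq p) (i : Fin 2) : ev k v (theta (p := p) k i) = 0 := by
  have h1 : (0 : Fin 2) - 1 = 1 := rfl
  have h2 : (1 : Fin 2) - 1 = 0 := rfl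
  fin_cases i
  · simp only [theta, map_sub, map_mul, map_pow, ev_X, Fin.zero_eta, h1, Fin.val_zero, Fin.val_one,
      pow_zero, pow_one, algebraMap_pow_pow]
    ring
  · simp only [theta, map_sub, map_mul, map_pow, ev_X, Fin.mk_one, h2, Fin.val_zero, Fin.val_one,
      pow_zero, pow_one]
    ring

variable (p) in
/-- Polynomials as functions on `ℤ_{p²}²`. -/
noncomputable def evSym (r : Fin 2 → ℕ) : Sym k r →ₗ[k] ((Fin 2 → Zq p) → k) :=
  LinearMap.pi fun v => (ev k v).toLinearMap.comp (Sym.toPoly k r)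

variable {r : Fin 2 → ℕ}

omit [CharP k p] in
theorem evSym_apply (f : Sym k r) (v : Fin 2 → Zq p) : evSym p k r f v = ev k v (Sym.toPoly k r f) :=
  rfl

theorem evSym_matAct (m : Matrix (Fin 2) (Fin 2) (Zq p)) (f : Sym k r) (v : Fin 2 → Zq p) :
    evSym p k r (matAct k r m f) v = evSym p k r f (Matrix.vecMul v m) := by
  rw [evSym_apply, toPoly_matAct, ev_subst, evSym_apply]

omit [CharP k p] in
theorem evSym_mon {i j : ℕ} (hi : i ≤ r 0) (hj : j ≤ r 1) (v : Fin 2 → Zq p) :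
    evSym p k r (mon k r i j) v = algebraMap (Zq p) k (v 0) ^ (i + p * j) *
      algebraMap (Zq p) k (v 1) ^ (r 0 - i + p * (r 1 - j)) := by
  rw [evSym_apply, toPoly_mon k hi hj]
  simp only [map_mul, map_pow, ev_X, Fin.val_zero, Fin.val_one, pow_zero, pow_one, ← pow_mul]
  ring

end Evaluation

/-! ### Linear independence of the normal-form monomials as functions. -/

section Basis

open MvPolynomial

variable (p : ℕ) (R : Type*) [CommRing R] (r : Fin 2 → ℕ)

/-- The monomial `X₀^i Y₀^{r₀-i} X₁^j Y₁^{r₁-j}` with `e = i + p j`, `i < p`. -/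
noncomputable def monB (e : ℕ) : Sym R r := mon R r (e % p) (e / p)

variable {p R r}

theorem monB_eq {i j : ℕ} (hi : i < p) : monB p R r (i + p * j) = mon R r i j := by
  rw [monB, Nat.add_mul_mod_self_left, Nat.mod_eq_of_lt hi, Nat.add_mul_div_left _ _ (by omega),
    Nat.div_eq_of_lt hi, zero_add]

theorem exists_eq_binom_add_sum (hp : 1 < p) (hr : ∀ i, p ≤ r i) (v : Sym R r) :
    ∃ b ∈ binom R p r, ∃ (c : ℕ → R) (d : R),
      v = b + (∑ e ∈ Finset.range (p ^ 2), c e • monB p R r e) + d • mon R r (r 0) (r 1) := by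
  let S : Submodule R (Sym R r) :=
    { carrier := {v | ∃ b ∈ binom R p r, ∃ (c : ℕ → R) (d : R),
        v = b + (∑ e ∈ Finset.range (p ^ 2), c e • monB p R r e) + d • mon R r (r 0) (r 1)}
      zero_mem' := ⟨0, Submodule.zero_mem _, 0, 0, by simp⟩
      add_mem' := by
        rintro _ _ ⟨b, hb, c, d, rfl⟩ ⟨b', hb', c', d', rfl⟩
        refine ⟨b + b', Submodule.add_mem _ hb hb', c + c', d + d', ?_⟩
        simp only [Pi.add_apply, add_smul, Finset.sum_add_distrib]
        abel
      smul_mem' := by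
        rintro a _ ⟨b, hb, c, d, rfl⟩
        refine ⟨a • b, Submodule.smul_mem _ _ hb, fun e => a * c e, a * d, ?_⟩
        simp only [smul_add, Finset.smul_sum, smul_smul] }
  have hS : binom R p r ≤ S := fun b hb => ⟨b, hb, 0, 0, by simp⟩
  refine mem_of_mon_mem R S (fun i j hi hj => ?_) v
  refine mon_mem_of_binom_le R hp hr S hS (fun i j hi hj => ?_) ?_ hi hj
  · have hlt : i + p * j < p ^ 2 := by
      calc i + p * j < p + p * j := by omega
        _ = p * (j + 1) := by ring
        _ ≤ p * p := Nat.mul_le_mul_left p hj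
        _ = p ^ 2 := by ring
    refine ⟨0, Submodule.zero_mem _, Pi.single (i + p * j) 1, 0, ?_⟩
    rw [Finset.sum_eq_single (i + p * j)]
    · simp [monB_eq hi]
    · intro e _ he
      rw [Pi.single_eq_of_ne he, zero_smul]
    · intro h
      exact absurd (Finset.mem_range.mpr hlt) h
  · exact ⟨0, Submodule.zero_mem _, 0, 1, by simp⟩

variable [Fact p.Prime] (k : Type*) [Field k] [Algebra (Zq p) k] [CharP k p]

omit [CharP k p] in
theorem evSym_monB (hr : ∀ i, p ^ 2 ≤ r i) {e : ℕ} (he : e < p ^ 2) (v : Fin 2 → Zq p) :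
    evSym p k r (monB p k r e) v = algebraMap (Zq p) k (v 0) ^ e *
      algebraMap (Zq p) k (v 1) ^ (r 0 + p * r 1 - e) := by
  have hp := Nat.Prime.one_lt (Fact.out : p.Prime)
  have h0 := hr 0
  have h1 := hr 1
  have hmod : e % p < p := Nat.mod_lt _ (by omega)
  have hpp : p ≤ p ^ 2 := Nat.le_self_pow two_ne_zero p
  have hdiv : e / p < p := by
    rw [Nat.div_lt_iff_lt_mul (by omega), ← sq]
    exact he
  rw [monB, evSym_mon k (by omega) (by omega)]
  have e1 : e % p + p * (e / p) = e := Nat.mod_add_div e p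
  have e2 : p * (r 1 - e / p) = p * r 1 - p * (e / p) := Nat.mul_sub _ _ _
  have e3 : p * (e / p) ≤ p * r 1 := Nat.mul_le_mul_left p (by omega)
  rw [e1, e2]
  congr 2
  omega

omit [CharP k p] in
theorem evSym_top (v : Fin 2 → Zq p) :
    evSym p k r (mon k r (r 0) (r 1)) v = algebraMap (Zq p) k (v 0) ^ (r 0 + p * r 1) := by
  rw [evSym_mon k le_rfl le_rfl]
  simp

/-- A polynomial of degree less than `q` that vanishes on `𝔽_q` is zero. -/
theorem coeff_eq_zero_of_sum_eq_zero (c : ℕ → k)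
    (h : ∀ x, ∑ e ∈ Finset.range (p ^ 2), c e * tau p k x ^ e = 0) {e : ℕ} (he : e < p ^ 2) :
    c e = 0 := by
  set P : Polynomial k := ∑ e ∈ Finset.range (p ^ 2), Polynomial.C (c e) * Polynomial.X ^ e with hP
  have hdeg : P.natDegree < p ^ 2 := by
    refine lt_of_le_of_lt (Polynomial.natDegree_sum_le_of_forall_le (n := p ^ 2 - 1) _ _ ?_) ?_
    · intro i hi
      rw [Finset.mem_range] at hi
      exact (Polynomial.natDegree_C_mul_X_pow_le _ _).trans (by omega)
    · have := one_lt_sq (p := p)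
      omega
  have h0 : P = 0 := by
    refine Polynomial.eq_zero_of_natDegree_lt_card_of_eval_eq_zero P (tau p k).injective ?_
      (by rwa [card_galoisField])
    intro x
    rw [hP, Polynomial.eval_finsetSum, ← h x]
    simp
  have h1 : P.coeff e = c e := by
    rw [hP, Polynomial.finsetSum_coeff]
    simp only [Polynomial.coeff_C_mul_X_pow]
    rw [Finset.sum_ite_eq]
    exact if_pos (Finset.mem_range.mpr he)
  rw [← h1, h0, Polynomial.coeff_zero]

end Basis

section VanishingCoefficients

variable {p : ℕ} [Fact p.Prime] (k : Type*) [Field k] [Algebra (Zq p) k] [CharP k p]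
  {r : Fin 2 → ℕ}

omit [CharP k p] in
theorem evSym_sum_monB (hr : ∀ i, p ^ 2 ≤ r i) (c : ℕ → k) (d : k) (v : Fin 2 → Zq p) :
    evSym p k r ((∑ e ∈ Finset.range (p ^ 2), c e • monB p k r e) + d • mon k r (r 0) (r 1)) v =
      (∑ e ∈ Finset.range (p ^ 2), c e * (algebraMap (Zq p) k (v 0) ^ e *
        algebraMap (Zq p) k (v 1) ^ (r 0 + p * r 1 - e))) +
      d * algebraMap (Zq p) k (v 0) ^ (r 0 + p * r 1) := by
  rw [map_add, map_sum, Pi.add_apply, Finset.sum_apply, map_smul, Pi.smul_apply, evSym_top,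
    smul_eq_mul]
  congr 1
  refine Finset.sum_congr rfl fun e he => ?_
  rw [map_smul, Pi.smul_apply, evSym_monB k hr (Finset.mem_range.mp he), smul_eq_mul]

omit [Fact p.Prime] in
theorem lt_weight (hr : ∀ i, p ^ 2 ≤ r i) {e : ℕ} (he : e < p ^ 2) : e < r 0 + p * r 1 :=
  lt_of_lt_of_le he ((hr 0).trans (Nat.le_add_right _ _))

/-- The point `(1, 0)` isolates `d`, as every other exponent of `y` is positive. The points `(x, 1)`
then give a polynomial of degree less than `q` with `q` roots. -/
theorem coeff_eq_zero_of_evSym_eq_zero (hr : ∀ i, p ^ 2 ≤ r i) (c : ℕ → k) (d : k)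
    (h : evSym p k r
      ((∑ e ∈ Finset.range (p ^ 2), c e • monB p k r e) + d • mon k r (r 0) (r 1)) = 0) :
    d = 0 ∧ ∀ e < p ^ 2, c e = 0 := by
  have hd : d = 0 := by
    have h1 := congrFun h ![1, 0]
    rw [evSym_sum_monB k hr, Finset.sum_eq_zero] at h1
    · simpa using h1
    · intro e he
      have := lt_weight hr (Finset.mem_range.mp he)
      simp only [Matrix.cons_val_one, Matrix.cons_val_fin_one, map_zero]
      rw [zero_pow (by omega), mul_zero, mul_zero]
  refine ⟨hd, fun e he => coeff_eq_zero_of_sum_eq_zero k c (fun x => ?_) he⟩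
  have h1 := congrFun h ![WittVector.teichmuller p x, 1]
  rw [evSym_sum_monB k hr, hd] at h1
  simpa [algebraMap_teichmuller] using h1

omit [Algebra (Zq p) k] in
theorem choose_ne_zero {n m : ℕ} (hn : n < p) (hm : m ≤ n) : (n.choose m : k) ≠ 0 := by
  rw [Ne, CharP.cast_eq_zero_iff k p]
  intro h
  have h1 : p ∣ n.factorial := by
    rw [← Nat.choose_mul_factorial_mul_factorial hm, mul_assoc]
    exact h.mul_right _
  have := ((Fact.out : p.Prime).dvd_factorial).mp h1
  omega

end VanishingCoefficients

theorem topMonomial_eq (k : Type*) [Field k] (r : Fin 2 → ℕ) :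
    topMonomial k r = mon k r (r 0) (r 1) := by
  apply Sym.toPoly_injective
  rw [toPoly_mon _ le_rfl le_rfl]
  change ∏ i, MvPolynomial.X (i, 0) ^ r i = _
  rw [Fin.prod_univ_two]
  simp

/-! ### The kernel of `V_r → Q` described by functions. -/

section KernelOfQ

open IsLocalRing MvPolynomial

variable {p : ℕ} [Fact p.Prime] (𝒪 : Type*) [CommRing 𝒪] [Algebra (Zq p) 𝒪] [IsLocalRing 𝒪]
  [Module.Finite (Zq p) 𝒪] {r : Fin 2 → ℕ}

theorem binom_le_Vstar : binom (ResidueField 𝒪) p r ≤ (Vstar (p := p) 𝒪 r).toSubmodule := by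
  have h1 : (0 : Fin 2) - 1 = 1 := rfl
  have h2 : (1 : Fin 2) - 1 = 0 := rfl
  rw [binom, Submodule.span_le]
  have key : ∀ (v : Sym (ResidueField 𝒪) r) (i : Fin 2),
      theta (p := p) (ResidueField 𝒪) i ∣ Sym.toPoly (ResidueField 𝒪) r v →
      v ∈ (Vstar (p := p) 𝒪 r).toSubmodule := fun v i hv =>
    (Ideal.span (Set.range (theta (p := p) (ResidueField 𝒪)))).mem_of_dvd hv
      (Ideal.subset_span ⟨i, rfl⟩)
  rintro _ (⟨i, j, hi, hj, rfl⟩ | ⟨i, j, hi, hj, rfl⟩)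
  · refine key _ 0 ⟨X (0, 0) ^ i * X (0, 1) ^ (r 0 - (i + 1)) *
      (X (1, 0) ^ j * X (1, 1) ^ (r 1 - (j + p))), ?_⟩
    rw [map_sub, toPoly_mon _ hi (by omega), toPoly_mon _ (by omega) hj, theta, h1,
      show r 1 - j = r 1 - (j + p) + p by omega, show r 0 - i = r 0 - (i + 1) + 1 by omega]
    ring
  · refine key _ 1 ⟨-(X (0, 0) ^ i * X (0, 1) ^ (r 0 - (i + p)) *
      (X (1, 0) ^ j * X (1, 1) ^ (r 1 - (j + 1)))), ?_⟩
    rw [map_sub, toPoly_mon _ hi (by omega), toPoly_mon _ (by omega) hj, theta, h2,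
      show r 0 - i = r 0 - (i + p) + p by omega, show r 1 - j = r 1 - (j + 1) + 1 by omega]
    ring

theorem evSym_eq_zero_of_mem_Vstar {v : Sym (ResidueField 𝒪) r}
    (hv : v ∈ (Vstar (p := p) 𝒪 r).toSubmodule) : evSym p (ResidueField 𝒪) r v = 0 := by
  have := charP_residueField (p := p) 𝒪
  funext x
  have h : Ideal.span (Set.range (theta (p := p) (ResidueField 𝒪))) ≤
      RingHom.ker (ev (p := p) (ResidueField 𝒪) x) := by
    rw [Ideal.span_le]
    rintro _ ⟨i, rfl⟩
    exact ev_theta (ResidueField 𝒪) x i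
  exact h hv

variable (hr : ∀ i, p ^ 2 ≤ r i)
include hr

/-- The polynomials `θ₀` and `θ₁` vanish at all points; conversely, a normal form modulo `binom`
that vanishes at all points is zero by linear independence. -/
theorem mem_Vstar_iff (v : Sym (ResidueField 𝒪) r) :
    v ∈ (Vstar (p := p) 𝒪 r).toSubmodule ↔ evSym p (ResidueField 𝒪) r v = 0 := by
  have := charP_residueField (p := p) 𝒪
  refine ⟨evSym_eq_zero_of_mem_Vstar 𝒪, fun h => ?_⟩
  obtain ⟨b, hb, c, d, rfl⟩ := exists_eq_binom_add_sum (Nat.Prime.one_lt (Fact.out : p.Prime))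
    (fun i => (Nat.le_self_pow two_ne_zero p).trans (hr i)) v
  have hb' := binom_le_Vstar 𝒪 hb
  rw [add_assoc, map_add, evSym_eq_zero_of_mem_Vstar 𝒪 hb', zero_add] at h
  obtain ⟨hd, hc⟩ := coeff_eq_zero_of_evSym_eq_zero (ResidueField 𝒪) hr c d h
  rw [hd, zero_smul, add_zero, Finset.sum_eq_zero, add_zero]
  · exact hb'
  · intro e he
    rw [hc e (Finset.mem_range.mp he), zero_smul]

omit hr [Module.Finite (Zq p) 𝒪] [Algebra (Zq p) 𝒪] [Fact p.Prime] in
theorem coeffMap_mon {i j : ℕ} (hi : i ≤ r 0) (hj : j ≤ r 1) :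
    coeffMap 𝒪 (ResidueField 𝒪) r (mon 𝒪 r i j) = mon (ResidueField 𝒪) r i j := by
  apply Sym.toPoly_injective
  rw [toPoly_mon_eq_monomial _ hi hj]
  change MvPolynomial.map (algebraMap 𝒪 (ResidueField 𝒪)) (Sym.toPoly 𝒪 r (mon 𝒪 r i j)) = _
  rw [toPoly_mon_eq_monomial _ hi hj, map_monomial, map_one]

omit hr [Module.Finite (Zq p) 𝒪] [Algebra (Zq p) 𝒪] [Fact p.Prime] in
theorem coeffMap_mem_binom {b : Sym 𝒪 r} (hb : b ∈ binom 𝒪 p r) :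
    coeffMap 𝒪 (ResidueField 𝒪) r b ∈ binom (ResidueField 𝒪) p r := by
  have h : binom 𝒪 p r ≤ ((binom (ResidueField 𝒪) p r).restrictScalars 𝒪).comap
      (coeffMap 𝒪 (ResidueField 𝒪) r) := by
    rw [binom, Submodule.span_le]
    rintro _ (⟨i, j, hi, hj, rfl⟩ | ⟨i, j, hi, hj, rfl⟩)
    · rw [SetLike.mem_coe, Submodule.mem_comap, map_sub, coeffMap_mon 𝒪 hi (by omega),
        coeffMap_mon 𝒪 (by omega) hj]
      exact binom_sub_mem₀ _ hi hj
    · rw [SetLike.mem_coe, Submodule.mem_comap, map_sub, coeffMap_mon 𝒪 hi (by omega),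
        coeffMap_mon 𝒪 (by omega) hj]
      exact binom_sub_mem₁ _ hi hj
  exact h hb

/-- A polynomial over `𝒪` whose reduction lies in `V_r^*` is, modulo the maximal ideal, a combination
of multiples of the lifts of `θ₀` and `θ₁`. -/
theorem mem_of_coeffMap_mem_Vstar (N : Submodule 𝒪 (Sym 𝒪 r)) (hN : binom 𝒪 p r ≤ N)
    (hN' : ∀ x ∈ maximalIdeal 𝒪, ∀ v, x • v ∈ N) {v : Sym 𝒪 r}
    (hv : coeffMap 𝒪 (ResidueField 𝒪) r v ∈ (Vstar (p := p) 𝒪 r).toSubmodule) : v ∈ N := by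
  have := charP_residueField (p := p) 𝒪
  have hp := Nat.Prime.one_lt (Fact.out : p.Prime)
  have hpp : p ≤ p ^ 2 := Nat.le_self_pow two_ne_zero p
  obtain ⟨b, hb, c, d, rfl⟩ := exists_eq_binom_add_sum hp (fun i => hpp.trans (hr i)) v
  have hB : ∀ e ∈ Finset.range (p ^ 2), coeffMap 𝒪 (ResidueField 𝒪) r (c e • monB p 𝒪 r e) =
      residue 𝒪 (c e) • monB p (ResidueField 𝒪) r e := by
    intro e he
    have h0 := hr 0
    have h1 := hr 1
    have hdiv : e / p < p := by
      rw [Nat.div_lt_iff_lt_mul (by omega), ← sq]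
      exact Finset.mem_range.mp he
    have hmod : e % p < p := Nat.mod_lt _ (by omega)
    rw [map_smul, monB, coeffMap_mon 𝒪 (by omega) (by omega)]
    rw [← ResidueField.algebraMap_eq, algebraMap_smul]
    rfl
  -- The normal form of `v` over `𝒪` reduces to one over the residue field whose function is zero,
  -- so all of its coefficients lie in the maximal ideal.
  have hv' := evSym_eq_zero_of_mem_Vstar 𝒪 hv
  rw [add_assoc, map_add, map_add, evSym_eq_zero_of_mem_Vstar 𝒪 (binom_le_Vstar 𝒪
    (coeffMap_mem_binom 𝒪 hb)), zero_add, map_add, map_sum, Finset.sum_congr rfl hB, map_smul,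
    coeffMap_mon 𝒪 le_rfl le_rfl, ← algebraMap_smul (ResidueField 𝒪) d,
    ResidueField.algebraMap_eq] at hv'
  obtain ⟨hd, hc⟩ := coeff_eq_zero_of_evSym_eq_zero (ResidueField 𝒪) hr (fun e => residue 𝒪 (c e)) _ hv'
  refine N.add_mem (N.add_mem (hN hb) (N.sum_mem fun e he => hN' _ ?_ _)) (hN' _ ?_ _)
  · exact (residue_eq_zero_iff _).mp (hc e (Finset.mem_range.mp he))
  · exact (residue_eq_zero_iff _).mp hd

variable {a₁ : ℕ} (ha₁ : 1 ≤ a₁) (ha₁' : a₁ ≤ p - 1)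
  (hcong : r 0 + p * r 1 ≡ p * a₁ [MOD p ^ 2 - 1])
include ha₁ hcong

theorem evSym_top_eq (v : Fin 2 → Zq p) :
    evSym p (ResidueField 𝒪) r (mon _ r (r 0) (r 1)) v =
      evSym p (ResidueField 𝒪) ![0, a₁] (mon _ ![0, a₁] 0 a₁) v := by
  have := charP_residueField (p := p) 𝒪
  have hp := Nat.Prime.one_lt (Fact.out : p.Prime)
  have hq := one_lt_sq (p := p)
  have h0 := lt_weight hr (e := 0) (by omega)
  have h1 : 1 < p * a₁ := lt_of_lt_of_le hp (Nat.le_mul_of_pos_right p ha₁)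
  rw [evSym_top, evSym_mon _ (by simp) (by simp), algebraMap_pow_eq _ (by omega) (by omega) hcong]
  simp

include ha₁'

/-- As a function, `u(t) X^r` is `(x + t y)^{p a₁}`. Averaging against powers of `t` isolates each
`x^{pj} y^{p(a₁-j)}`, whose binomial coefficient is nonzero because `a₁ < p`. -/
theorem evSym_range_le (u : Sym (ResidueField 𝒪) ![0, a₁]) :
    ∃ w ∈ (Xr (p := p) 𝒪 r).toSubmodule, evSym p (ResidueField 𝒪) r w =
      evSym p (ResidueField 𝒪) ![0, a₁] u := by
  have := charP_residueField (p := p) 𝒪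
  have : ExpChar (ResidueField 𝒪) p := ExpChar.prime Fact.out
  have hp := Nat.Prime.one_lt (Fact.out : p.Prime)
  have hpa := mul_lt_of_le_sub_one ha₁'
  refine mem_of_mon_mem (ResidueField 𝒪) (((Xr (p := p) 𝒪 r).toSubmodule.map
    (evSym p (ResidueField 𝒪) r)).comap (evSym p (ResidueField 𝒪) ![0, a₁])) (fun i j hi hj => ?_) u
  replace hi : i = 0 := by simpa using hi
  replace hj : j ≤ a₁ := by simpa using hj
  subst hi
  rw [Submodule.mem_comap]
  have hC : (a₁.choose j : ResidueField 𝒪) ≠ 0 := choose_ne_zero (ResidueField 𝒪) (by omega) hj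
  have hX : ∀ g : K p, symRep (ResidueField 𝒪) r 0 g (mon _ r (r 0) (r 1)) ∈
      (Xr (p := p) 𝒪 r).toSubmodule := by
    intro g
    rw [← topMonomial_eq]
    exact Submodule.subset_span ⟨g, rfl⟩
  set f : ℕ → (Fin 2 → Zq p) → ResidueField 𝒪 := fun i v =>
    algebraMap (Zq p) (ResidueField 𝒪) (v 0) ^ (p * i) *
      algebraMap (Zq p) (ResidueField 𝒪) (v 1) ^ (p * (a₁ - i)) * a₁.choose i with hf
  have h1 : ∀ x, evSym p (ResidueField 𝒪) r (symRep (ResidueField 𝒪) r 0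
      (lowerUnip (WittVector.teichmuller p x)) (mon _ r (r 0) (r 1))) =
      ∑ i ∈ Finset.range (a₁ + 1), tau p (ResidueField 𝒪) x ^ (p * (a₁ - i)) • f i := by
    intro x
    funext v
    rw [symRep_zero_apply, evSym_matAct, evSym_top_eq 𝒪 hr ha₁ hcong, evSym_mon _ (by simp) (by simp),
      Finset.sum_apply]
    have e : Matrix.vecMul v (lowerUnip (WittVector.teichmuller p x)).1 0 =
        v 0 + v 1 * WittVector.teichmuller p x := by
      simp [lowerUnip, Matrix.vecMul, dotProduct, Fin.sum_univ_two]
    rw [e, map_add, map_mul, algebraMap_teichmuller]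
    simp only [zero_add, Matrix.cons_val_zero, Matrix.cons_val_one, Matrix.cons_val_fin_one,
      Nat.sub_self, mul_zero, pow_zero, mul_one]
    rw [pow_mul, add_pow_expChar, add_pow]
    refine Finset.sum_congr rfl fun i _ => ?_
    rw [Pi.smul_apply, smul_eq_mul, hf]
    simp only [← pow_mul, mul_pow]
    ring
  -- The averaging exponent complements `p (a₁ - j)` to `q - 1`; since `p a₁ < q - 1`, no other term
  -- reaches a multiple of `q - 1`.
  have h2 := sum_tau_pow_smul (ResidueField 𝒪) (p := p) (Finset.range (a₁ + 1))
    (fun i => p * (a₁ - i)) f (p ^ 2 - 1 - p * (a₁ - j)) (i₀ := j) (Finset.mem_range.mpr (by omega))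
    (by
      have : p * (a₁ - j) ≤ p * a₁ := Nat.mul_le_mul_left p (by omega)
      omega)
    (fun i _ => by
      have : p * (a₁ - i) ≤ p * a₁ := Nat.mul_le_mul_left p (by omega)
      omega)
    (fun i hi h => by
      have h3 := Nat.eq_of_mul_eq_mul_left (by omega) h
      rw [Finset.mem_range] at hi
      omega)
  have h3 : evSym p (ResidueField 𝒪) ![0, a₁] (mon _ ![0, a₁] 0 j) =
      (a₁.choose j : ResidueField 𝒪)⁻¹ • f j := by
    funext v
    rw [evSym_mon _ (by simp) (by simpa using hj), Pi.smul_apply, smul_eq_mul, hf]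
    simp only [zero_add, Matrix.cons_val_zero, Matrix.cons_val_one, Matrix.cons_val_fin_one,
      Nat.sub_self]
    field_simp
  rw [h3, ← neg_neg (f j), ← h2]
  refine Submodule.smul_mem _ _ (Submodule.neg_mem _ (Submodule.sum_mem _ fun x _ =>
    Submodule.smul_mem _ _ ?_))
  rw [← h1]
  exact Submodule.mem_map_of_mem (hX _)

/-- Passing to functions kills exactly `V_r^*` and carries `X_r` onto the functions of `(0, a₁)`.
From here on, `Q` is handled as a quotient of spaces of functions. -/
theorem mem_kerQ_iff (v : Sym (ResidueField 𝒪) r) : v ∈ (kerQ (p := p) 𝒪 r).toSubmodule ↔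
    evSym p (ResidueField 𝒪) r v ∈ LinearMap.range (evSym p (ResidueField 𝒪) ![0, a₁]) := by
  have := charP_residueField (p := p) 𝒪
  constructor
  · intro h
    obtain ⟨x, hx, y, hy, rfl⟩ := Submodule.mem_sup.mp h
    rw [map_add, evSym_eq_zero_of_mem_Vstar 𝒪 hx, zero_add]
    have hle : (Xr (p := p) 𝒪 r).toSubmodule ≤
        (LinearMap.range (evSym p (ResidueField 𝒪) ![0, a₁])).comap (evSym p (ResidueField 𝒪) r) := by
      refine Submodule.span_le.mpr ?_
      rintro _ ⟨g, rfl⟩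
      refine ⟨matAct _ _ g.1 (mon _ ![0, a₁] 0 a₁), ?_⟩
      funext z
      beta_reduce
      rw [evSym_matAct, symRep_zero_apply, evSym_matAct, topMonomial_eq, evSym_top_eq 𝒪 hr ha₁ hcong]
    exact hle hy
  · rintro ⟨u, hu⟩
    obtain ⟨w, hw, hwu⟩ := evSym_range_le 𝒪 hr ha₁ ha₁' hcong u
    have h1 : v - w ∈ (Vstar (p := p) 𝒪 r).toSubmodule := by
      rw [mem_Vstar_iff 𝒪 hr, map_sub, hwu, hu, sub_self]
    exact Submodule.mem_sup.mpr ⟨v - w, h1, w, hw, sub_add_cancel v w⟩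

end KernelOfQ

/-! ### The diagonal torus. -/

section Torus

open MvPolynomial

variable {p : ℕ} [Fact p.Prime]

/-- The matrix `diag(t, 1)`, for `t` a Teichmüller unit. -/
noncomputable def torus (t : (GaloisField p 2)ˣ) : K p :=
  ⟨!![WittVector.teichmuller p t.1, 0; 0, 1], !![WittVector.teichmuller p t⁻¹.1, 0; 0, 1],
    by rw [Matrix.one_fin_two]; simp [← map_mul], by rw [Matrix.one_fin_two]; simp [← map_mul]⟩

theorem matAct_torus_mon {R : Type*} [CommRing R] [Algebra (Zq p) R] {r : Fin 2 → ℕ}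
    (t : (GaloisField p 2)ˣ) {i j : ℕ} (hi : i ≤ r 0) (hj : j ≤ r 1) :
    matAct R r (torus t).1 (mon R r i j) = tm p R t.1 ^ (i + p * j) • mon R r i j := by
  apply Sym.toPoly_injective
  rw [toPoly_matAct_mon R _ hi hj, map_smul, toPoly_mon R hi hj, smul_eq_C_mul]
  have h0 : (torus t).1 = !![WittVector.teichmuller p t.1, 0; 0, 1] := rfl
  simp only [subst_X_zero, subst_X_one, h0, Matrix.of_apply, Matrix.cons_val', Matrix.cons_val_zero,
    Matrix.cons_val_one, Matrix.cons_val_fin_one, map_zero, map_one, frobenius_teichmuller, map_pow]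
  rw [← tm]
  ring

end Torus

theorem tau_apply {p : ℕ} [Fact p.Prime] (k : Type*) [Field k] [Algebra (Zq p) k] [CharP k p]
    (x : GaloisField p 2) : tau p k x = tm p k x := rfl

/-! ### Weight vectors of `Q` and its smallest subrepresentation. -/

section StructureOfQ

open IsLocalRing

variable {p : ℕ} [Fact p.Prime] (𝒪 : Type*) [CommRing 𝒪] [Algebra (Zq p) 𝒪] [IsLocalRing 𝒪]
  [Module.Finite (Zq p) 𝒪] {r : Fin 2 → ℕ}

variable (p r) in
/-- The projection `V_r → Q`. -/
noncomputable def cls : Sym (ResidueField 𝒪) r →ₗ[ResidueField 𝒪]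
    (Sym (ResidueField 𝒪) r ⧸ (kerQ (p := p) 𝒪 r).toSubmodule) :=
  (kerQ (p := p) 𝒪 r).toSubmodule.mkQ

theorem repQ_cls (g : K p) (v : Sym (ResidueField 𝒪) r) :
    repQ 𝒪 r g (cls p 𝒪 r v) = cls p 𝒪 r (matAct _ r g.1 v) := by
  rw [← symRep_zero_apply]
  rfl

theorem repQ_torus_cls_monB (hr : ∀ i, p ^ 2 ≤ r i) (t : (GaloisField p 2)ˣ) {e : ℕ} (he : e < p ^ 2) :
    repQ 𝒪 r (torus t) (cls p 𝒪 r (monB p _ r e)) =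
      tm p (ResidueField 𝒪) t.1 ^ e • cls p 𝒪 r (monB p _ r e) := by
  have hp := Nat.Prime.one_lt (Fact.out : p.Prime)
  have h0 := hr 0
  have h1 := hr 1
  have hpp : p ≤ p ^ 2 := Nat.le_self_pow two_ne_zero p
  have hdiv : e / p < p := by
    rw [Nat.div_lt_iff_lt_mul (by omega), ← sq]
    exact he
  have hmod : e % p < p := Nat.mod_lt _ (by omega)
  rw [repQ_cls, monB, matAct_torus_mon t (by omega) (by omega), map_smul, Nat.mod_add_div]

variable (hr : ∀ i, p ^ 2 ≤ r i) {a₁ : ℕ} (ha₁ : 1 ≤ a₁) (ha₁' : a₁ ≤ p - 1)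
  (hcong : r 0 + p * r 1 ≡ p * a₁ [MOD p ^ 2 - 1])
include hr ha₁ ha₁' hcong

theorem cls_eq_zero_iff (v : Sym (ResidueField 𝒪) r) : cls p 𝒪 r v = 0 ↔
    evSym p (ResidueField 𝒪) r v ∈ LinearMap.range (evSym p (ResidueField 𝒪) ![0, a₁]) := by
  rw [← mem_kerQ_iff 𝒪 hr ha₁ ha₁' hcong, cls, Submodule.mkQ_apply, Submodule.Quotient.mk_eq_zero]

theorem cls_eq_of_evSym_eq {v w : Sym (ResidueField 𝒪) r}
    (h : evSym p (ResidueField 𝒪) r v = evSym p (ResidueField 𝒪) r w) :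
    cls p 𝒪 r v = cls p 𝒪 r w := by
  rw [← sub_eq_zero, ← map_sub, cls_eq_zero_iff 𝒪 hr ha₁ ha₁' hcong, map_sub, h, sub_self]
  exact Submodule.zero_mem _

theorem cls_top : cls p 𝒪 r (mon _ r (r 0) (r 1)) = 0 := by
  rw [cls_eq_zero_iff 𝒪 hr ha₁ ha₁' hcong]
  exact ⟨mon _ ![0, a₁] 0 a₁, funext fun v => (evSym_top_eq 𝒪 hr ha₁ hcong v).symm⟩

omit ha₁ in
theorem modEq_sub {e : ℕ} (he : e < p * a₁) :
    r 0 + p * r 1 - e ≡ p * a₁ - e [MOD p ^ 2 - 1] := by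
  have hpa := mul_lt_of_le_sub_one ha₁'
  have h := lt_weight hr (e := e) (by omega)
  refine Nat.ModEq.add_right_cancel' e ?_
  rwa [Nat.sub_add_cancel h.le, Nat.sub_add_cancel he.le]

theorem cls_monB_mul {j : ℕ} (hj : j < a₁) : cls p 𝒪 r (monB p _ r (p * j)) = 0 := by
  have := charP_residueField (p := p) 𝒪
  have hp := Nat.Prime.one_lt (Fact.out : p.Prime)
  have hpa := mul_lt_of_le_sub_one ha₁'
  have h1 : p * j < p * a₁ := Nat.mul_lt_mul_of_pos_left hj (by omega)
  have h2 := lt_weight hr (e := p * j) (by omega)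
  rw [cls_eq_zero_iff 𝒪 hr ha₁ ha₁' hcong]
  refine ⟨mon _ ![0, a₁] 0 j, funext fun v => ?_⟩
  rw [evSym_monB _ hr (by omega), evSym_mon _ (by simp) (by simpa using hj.le),
    algebraMap_pow_eq _ (by omega) (by omega) (modEq_sub hr ha₁' hcong h1)]
  simp [Nat.mul_sub]

theorem exists_eq_sum_cls (x : Sym (ResidueField 𝒪) r ⧸ (kerQ (p := p) 𝒪 r).toSubmodule) :
    ∃ c : ℕ → ResidueField 𝒪,
      x = ∑ e ∈ Finset.Ico 1 (p ^ 2), c e • cls p 𝒪 r (monB p _ r e) := by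
  have hq := one_lt_sq (p := p)
  obtain ⟨v, rfl⟩ := Submodule.mkQ_surjective _ x
  obtain ⟨b, hb, c, d, rfl⟩ := exists_eq_binom_add_sum (Nat.Prime.one_lt (Fact.out : p.Prime))
    (fun i => (Nat.le_self_pow two_ne_zero p).trans (hr i)) v
  refine ⟨c, ?_⟩
  change cls p 𝒪 r _ = _
  have hb0 : cls p 𝒪 r b = 0 := by
    rw [cls, Submodule.mkQ_apply, Submodule.Quotient.mk_eq_zero]
    exact Submodule.mem_sup_left (binom_le_Vstar 𝒪 hb)
  have h0 := cls_monB_mul 𝒪 hr ha₁ ha₁' hcong (j := 0) (by omega)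
  rw [mul_zero] at h0
  rw [map_add, map_add, hb0, zero_add, map_smul, cls_top 𝒪 hr ha₁ ha₁' hcong, smul_zero, add_zero,
    map_sum, Finset.range_eq_Ico, Finset.sum_eq_sum_Ico_succ_bot (by omega), map_smul, h0, smul_zero,
    zero_add]
  simp only [map_smul, zero_add]

/-- Suppose the function equals that of some `u` in `(0, a₁)`. The point `(1, 0)` shows that
`X₁^{a₁}` does not occur in `u`, and the points `(x, 1)` then compare polynomials of degree less
than `q`. So the only relations are the vanishing classes `e = p j`, `j < a₁`. -/
theorem cls_coeff_eq_zero (c : ℕ → ResidueField 𝒪)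
    (h : ∑ e ∈ Finset.range (p ^ 2), c e • cls p 𝒪 r (monB p _ r e) = 0) {e : ℕ} (he : e < p ^ 2)
    (hej : ∀ j < a₁, e ≠ p * j) : c e = 0 := by
  have := charP_residueField (p := p) 𝒪
  have hp := Nat.Prime.one_lt (Fact.out : p.Prime)
  have hpa := mul_lt_of_le_sub_one ha₁'
  have h1 : cls p 𝒪 r ((∑ e ∈ Finset.range (p ^ 2), c e • monB p _ r e) +
      (0 : ResidueField 𝒪) • mon _ r (r 0) (r 1)) = 0 := by
    rw [zero_smul, add_zero, map_sum, ← h]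
    simp only [map_smul]
  rw [cls_eq_zero_iff 𝒪 hr ha₁ ha₁' hcong] at h1
  obtain ⟨u, hu⟩ := h1
  have hu1 : ∀ v, evSym p (ResidueField 𝒪) ![0, a₁] u v = ∑ j ∈ Finset.range (a₁ + 1),
      coeffMon (ResidueField 𝒪) ![0, a₁] 0 j u * (algebraMap (Zq p) _ (v 0) ^ (p * j) *
        algebraMap (Zq p) _ (v 1) ^ (p * (a₁ - j))) := by
    intro v
    conv_lhs => rw [← monConstr_apply_mon u, monConstr]
    simp only [Matrix.cons_val_zero, zero_add, Finset.range_one, Finset.sum_singleton,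
      Matrix.cons_val_one, Matrix.cons_val_fin_one, LinearMap.sum_apply, map_sum, Finset.sum_apply,
      LinearMap.smulRight_apply, map_smul, Pi.smul_apply, smul_eq_mul]
    refine Finset.sum_congr rfl fun j hj => ?_
    rw [Finset.mem_range] at hj
    rw [evSym_mon _ (by simp) (by simp; omega)]
    simp
  set m : ℕ → ResidueField 𝒪 := fun j => coeffMon (ResidueField 𝒪) ![0, a₁] 0 j u
  have hma : m a₁ = 0 := by
    have h2 := congrFun hu ![1, 0]
    rw [evSym_sum_monB _ hr, hu1, Finset.sum_range_succ, Finset.sum_eq_zero, Finset.sum_eq_zero] at h2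
    · simpa using h2
    · intro e he
      have := lt_weight hr (Finset.mem_range.mp he)
      simp only [Matrix.cons_val_one, Matrix.cons_val_fin_one, map_zero]
      rw [zero_pow (by omega), mul_zero, mul_zero]
    · intro j hj
      rw [Finset.mem_range] at hj
      have : 0 < p * (a₁ - j) := Nat.mul_pos (by omega) (by omega)
      simp only [Matrix.cons_val_one, Matrix.cons_val_fin_one, map_zero]
      rw [zero_pow (by omega), mul_zero, mul_zero]
  set m' : ℕ → ResidueField 𝒪 := fun e => ∑ j ∈ Finset.range a₁, if e = p * j then m j else 0 with hm'
  have hc : c e - m' e = 0 := by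
    refine coeff_eq_zero_of_sum_eq_zero (p := p) (ResidueField 𝒪) (fun e => c e - m' e)
      (fun x => ?_) he
    have h2 := congrFun hu ![WittVector.teichmuller p x, 1]
    rw [evSym_sum_monB _ hr, hu1, Finset.sum_range_succ] at h2
    change (∑ j ∈ Finset.range a₁, m j * _) + m a₁ * _ = _ at h2
    simp only [Matrix.cons_val_zero, Matrix.cons_val_one, Matrix.cons_val_fin_one, map_one, one_pow,
      mul_one, zero_mul, add_zero, algebraMap_teichmuller, hma] at h2
    simp only [sub_mul, Finset.sum_sub_distrib]
    rw [← h2, sub_eq_zero, hm']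
    simp only [Finset.sum_mul]
    rw [Finset.sum_comm]
    refine Finset.sum_congr rfl fun j hj => ?_
    rw [Finset.mem_range] at hj
    have h3 : p * j < p * a₁ := Nat.mul_lt_mul_of_pos_left hj (by omega)
    simp only [ite_mul, zero_mul]
    rw [Finset.sum_ite_eq', if_pos (Finset.mem_range.mpr (by omega))]
  have h4 : m' e = 0 := Finset.sum_eq_zero fun j hj => if_neg (hej j (Finset.mem_range.mp hj))
  rwa [h4, sub_zero] at hc

omit ha₁ ha₁' hcong in
open Classical in
/-- The weight spaces of the torus on `Q` are spanned by the classes of the monomials. -/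
theorem sum_torus (c : ℕ → ResidueField 𝒪) {e₀ : ℕ} (he₀ : e₀ ∈ Finset.Ico 1 (p ^ 2)) :
    ∑ t : GaloisField p 2, tm p (ResidueField 𝒪) t ^ (p ^ 2 - 1 - e₀) •
      -- The value `0` at `t = 0` agrees with `∑ t^e (…)` because `e ≥ 1`, so the sum may run over
      -- the whole field.
      (if h : t = 0 then 0 else repQ 𝒪 r (torus (Units.mk0 t h))
        (∑ e ∈ Finset.Ico 1 (p ^ 2), c e • cls p 𝒪 r (monB p _ r e))) =
      -(c e₀ • cls p 𝒪 r (monB p _ r e₀)) := by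
  have := charP_residueField (p := p) 𝒪
  have he := Finset.mem_Ico.mp he₀
  rw [← sum_tau_pow_smul (ResidueField 𝒪) (p := p) (Finset.Ico 1 (p ^ 2)) (fun e => e)
    (fun e => c e • cls p 𝒪 r (monB p _ r e)) (p ^ 2 - 1 - e₀) he₀ (by omega)
    (fun i hi => by have := Finset.mem_Ico.mp hi; omega) (fun i _ h => h)]
  refine Finset.sum_congr rfl fun t _ => ?_
  congr 1
  split_ifs with h
  · rw [h, map_zero, Finset.sum_eq_zero]
    intro i hi
    rw [zero_pow (by have := Finset.mem_Ico.mp hi; omega), zero_smul]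
  · rw [map_sum]
    refine Finset.sum_congr rfl fun i hi => ?_
    rw [map_smul, repQ_torus_cls_monB 𝒪 hr _ (Finset.mem_Ico.mp hi).2, smul_comm]
    rfl

open Classical in
-- The characters `t ↦ t^e` for `1 ≤ e ≤ q - 1` are distinct, so the weight `t` occurs only for `e =
-- 1`.
theorem eq_smul_of_torus_weight (x : Sym (ResidueField 𝒪) r ⧸ (kerQ (p := p) 𝒪 r).toSubmodule)
    (h : ∀ t, repQ 𝒪 r (torus t) x = tm p (ResidueField 𝒪) t.1 • x) :
    ∃ c : ResidueField 𝒪, x = c • cls p 𝒪 r (monB p _ r 1) := by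
  have := charP_residueField (p := p) 𝒪
  have hq : 2 ^ 2 ≤ p ^ 2 := Nat.pow_le_pow_left (Nat.Prime.two_le (Fact.out : p.Prime)) 2
  obtain ⟨c, hc⟩ := exists_eq_sum_cls 𝒪 hr ha₁ ha₁' hcong x
  refine ⟨c 1, ?_⟩
  have h1 := sum_torus 𝒪 hr c (e₀ := 1) (Finset.mem_Ico.mpr (by omega))
  rw [← hc] at h1
  have h2 : ∀ t : GaloisField p 2, tm p (ResidueField 𝒪) t ^ (p ^ 2 - 1 - 1) •
      (if h : t = 0 then 0 else repQ 𝒪 r (torus (Units.mk0 t h)) x) =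
      tm p (ResidueField 𝒪) t ^ (p ^ 2 - 1) • x := by
    intro t
    split_ifs with ht
    · rw [ht, smul_zero, ← tau_apply, map_zero, zero_pow (by omega), zero_smul]
    · rw [h, smul_smul, Units.val_mk0, ← pow_succ]
      congr 2
      omega
  rw [Finset.sum_congr rfl fun t _ => h2 t, ← Finset.sum_smul] at h1
  simp only [← tau_apply] at h1
  rw [sum_tau_pow,
    if_pos ⟨by omega, dvd_rfl⟩, neg_one_smul] at h1
  exact neg_injective h1

theorem repQ_lowerUnip_cls_monB (x : GaloisField p 2) {e : ℕ} (he : e < p ^ 2) :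
    repQ 𝒪 r (lowerUnip (WittVector.teichmuller p x)) (cls p 𝒪 r (monB p _ r e)) =
      ∑ i ∈ Finset.range (e + 1), tm p (ResidueField 𝒪) x ^ (e - i) •
        ((e.choose i : ResidueField 𝒪) • cls p 𝒪 r (monB p _ r i)) := by
  have := charP_residueField (p := p) 𝒪
  have hD := lt_weight hr he
  simp only [← map_smul, ← map_sum]
  rw [repQ_cls]
  apply cls_eq_of_evSym_eq 𝒪 hr ha₁ ha₁' hcong
  funext v
  have e0 : Matrix.vecMul v (lowerUnip (WittVector.teichmuller p x)).1 0 =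
      v 0 + v 1 * WittVector.teichmuller p x := by
    simp [lowerUnip, Matrix.vecMul, dotProduct, Fin.sum_univ_two]
  have e1 : Matrix.vecMul v (lowerUnip (WittVector.teichmuller p x)).1 1 = v 1 := by
    simp [lowerUnip, Matrix.vecMul, dotProduct, Fin.sum_univ_two]
  rw [evSym_matAct, evSym_monB _ hr he, e0, e1, map_add, map_mul, algebraMap_teichmuller, add_pow,
    map_sum, Finset.sum_apply, Finset.sum_mul]
  refine Finset.sum_congr rfl fun i hi => ?_
  rw [Finset.mem_range] at hi
  rw [map_smul, map_smul, Pi.smul_apply, Pi.smul_apply, smul_eq_mul, smul_eq_mul,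
    evSym_monB _ hr (by omega), show r 0 + p * r 1 - i = (r 0 + p * r 1 - e) + (e - i) by omega, tau_apply]
  ring

/-- Since `r₀ + p r₁ - p a₁` is a positive multiple of `q - 1`, the class is that of `x^{p a₁}
y^{q-1}`; exchanging the variables gives `x^{q-1} y^{p a₁}`. -/
theorem repQ_swapMat_cls_monB :
    repQ 𝒪 r swapMat (cls p 𝒪 r (monB p _ r (p * a₁))) = cls p 𝒪 r (monB p _ r (p ^ 2 - 1)) := by
  have := charP_residueField (p := p) 𝒪
  have hp := Nat.Prime.one_lt (Fact.out : p.Prime)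
  have hpa := mul_lt_of_le_sub_one ha₁'
  have hq := one_lt_sq (p := p)
  have h1 : p * 1 ≤ p * a₁ := Nat.mul_le_mul_left p ha₁
  have hD := lt_weight hr (e := p ^ 2 - 1) (by omega)
  rw [repQ_cls]
  apply cls_eq_of_evSym_eq 𝒪 hr ha₁ ha₁' hcong
  funext v
  have e0 : Matrix.vecMul v (swapMat (p := p)).1 0 = v 1 := by
    simp [swapMat, Matrix.vecMul, dotProduct, Fin.sum_univ_two]
  have e1 : Matrix.vecMul v (swapMat (p := p)).1 1 = v 0 := by
    simp [swapMat, Matrix.vecMul, dotProduct, Fin.sum_univ_two]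
  have h2 : r 0 + p * r 1 - p * a₁ ≡ p ^ 2 - 1 [MOD p ^ 2 - 1] := by
    refine Nat.ModEq.add_right_cancel' (p * a₁) ?_
    rw [Nat.sub_add_cancel (by omega)]
    exact hcong.trans (by simp [Nat.ModEq])
  have h3 : p * a₁ ≡ r 0 + p * r 1 - (p ^ 2 - 1) [MOD p ^ 2 - 1] := by
    refine Nat.ModEq.add_right_cancel' (p ^ 2 - 1) ?_
    rw [Nat.sub_add_cancel (by omega)]
    exact Nat.ModEq.trans (by simp [Nat.ModEq]) hcong.symm
  rw [evSym_matAct, evSym_monB _ hr (by omega), evSym_monB _ hr (by omega), e0, e1,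
    algebraMap_pow_eq _ (by omega) (by omega) h2, algebraMap_pow_eq _ (by omega) (by omega) h3, mul_comm]

/-- Every nonzero subrepresentation of `Q` contains the class of `X₀ Y₀^{r₀-1} Y₁^{r₁}`. -/
theorem cls_monB_one_mem (W : Subrepresentation (repQ (p := p) 𝒪 r))
    {x : Sym (ResidueField 𝒪) r ⧸ (kerQ (p := p) 𝒪 r).toSubmodule} (hx : x ∈ W.toSubmodule)
    (hx0 : x ≠ 0) : cls p 𝒪 r (monB p _ r 1) ∈ W.toSubmodule := by
  have := charP_residueField (p := p) 𝒪
  have hp := Nat.Prime.one_lt (Fact.out : p.Prime)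
  have hpa := mul_lt_of_le_sub_one ha₁'
  have hq : 2 ^ 2 ≤ p ^ 2 := Nat.pow_le_pow_left hp 2
  obtain ⟨c, rfl⟩ := exists_eq_sum_cls 𝒪 hr ha₁ ha₁' hcong x
  obtain ⟨e, he, hce⟩ := Finset.exists_ne_zero_of_sum_ne_zero hx0
  have he' := Finset.mem_Ico.mp he
  have h1 : cls p 𝒪 r (monB p _ r e) ∈ W.toSubmodule := by
    have h2 : -(c e • cls p 𝒪 r (monB p _ r e)) ∈ W.toSubmodule := by
      rw [← sum_torus 𝒪 hr c he]
      refine Submodule.sum_mem _ fun t _ => Submodule.smul_mem _ _ ?_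
      split_ifs with h
      · exact Submodule.zero_mem _
      · exact W.apply_mem_toSubmodule _ hx
    have hc0 : c e ≠ 0 := fun h => hce (by rw [h, zero_smul])
    have h3 := Submodule.smul_mem _ (c e)⁻¹ (Submodule.neg_mem _ h2)
    rwa [neg_neg, smul_smul, inv_mul_cancel₀ hc0, one_smul] at h3
  -- Averaging over lower unipotents leads from the exponent `e` to any `i₀ < q - 1`, `i₀ ≤ e`,
  -- whose binomial coefficient is nonzero.
  have avg : ∀ e i₀ m : ℕ, e < p ^ 2 → i₀ ≤ e → m + (e - i₀) = p ^ 2 - 1 → i₀ + 1 < p ^ 2 →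
      (e.choose i₀ : ResidueField 𝒪) ≠ 0 → cls p 𝒪 r (monB p _ r e) ∈ W.toSubmodule →
      cls p 𝒪 r (monB p _ r i₀) ∈ W.toSubmodule := by
    intro e i₀ m he hi₀ hm hi₀' hC hmem
    have h2 := sum_tau_pow_smul (ResidueField 𝒪) (p := p) (Finset.range (e + 1)) (fun i => e - i)
      (fun i => (e.choose i : ResidueField 𝒪) • cls p 𝒪 r (monB p _ r i)) m
      (Finset.mem_range.mpr (Nat.lt_succ_of_le hi₀)) hm (fun i _ => by omega)
      (fun i hi h => by have := Finset.mem_range.mp hi; omega)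
    have h3 : -((e.choose i₀ : ResidueField 𝒪) • cls p 𝒪 r (monB p _ r i₀)) ∈ W.toSubmodule := by
      rw [← h2]
      refine Submodule.sum_mem _ fun t _ => Submodule.smul_mem _ _ ?_
      simp only [tau_apply]
      rw [← repQ_lowerUnip_cls_monB 𝒪 hr ha₁ ha₁' hcong t he]
      exact W.apply_mem_toSubmodule _ hmem
    have h4 := Submodule.smul_mem _ (e.choose i₀ : ResidueField 𝒪)⁻¹ (Submodule.neg_mem _ h3)
    rwa [neg_neg, smul_smul, inv_mul_cancel₀ hC, one_smul] at h4
  have hone : ∀ e, 1 ≤ e → e < p ^ 2 → ¬ p ∣ e → cls p 𝒪 r (monB p _ r e) ∈ W.toSubmodule →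
      cls p 𝒪 r (monB p _ r 1) ∈ W.toSubmodule := by
    intro e he1 he hpe hmem
    refine avg e 1 (p ^ 2 - e) he he1 (by omega) (by omega) ?_ hmem
    rwa [Nat.choose_one_right, Ne, CharP.cast_eq_zero_iff _ p]
  by_cases hpe : p ∣ e
  · obtain ⟨j, rfl⟩ := hpe
    have hj : a₁ ≤ j := by
      by_contra h
      exact hce (by rw [cls_monB_mul 𝒪 hr ha₁ ha₁' hcong (by omega), smul_zero])
    have hjp : j < p := by
      by_contra h
      have : p * p ≤ p * j := Nat.mul_le_mul_left p (by omega)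
      rw [← sq] at this
      omega
    have h2 : p * a₁ ≤ p * j := Nat.mul_le_mul_left p hj
    have h3 : p * 1 ≤ p * a₁ := Nat.mul_le_mul_left p ha₁
    -- If `p` divides `e`, the coefficient `e` at `i₀ = 1` vanishes. The detour goes through `p a₁`,
    -- allowed by Lucas' theorem, and then by `w` to `q - 1`, which is prime to `p`.
    have hC : ((p * j).choose (p * a₁) : ResidueField 𝒪) ≠ 0 := by
      have hL := Choose.choose_modEq_choose_mod_mul_choose_div_nat (p := p) (n := p * j) (k := p * a₁)
      rw [Nat.mul_mod_right, Nat.mul_mod_right, Nat.choose_self, one_mul,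
        Nat.mul_div_cancel_left _ (by omega), Nat.mul_div_cancel_left _ (by omega)] at hL
      rw [(CharP.natCast_eq_natCast (ResidueField 𝒪) p).mpr hL]
      exact choose_ne_zero _ hjp hj
    have h4 := avg (p * j) (p * a₁) (p ^ 2 - 1 - (p * j - p * a₁)) he'.2 h2 (by omega) (by omega) hC h1
    have h5 := W.apply_mem_toSubmodule swapMat h4
    rw [repQ_swapMat_cls_monB 𝒪 hr ha₁ ha₁' hcong] at h5
    refine hone (p ^ 2 - 1) (by omega) (by omega) ?_ h5
    intro h6
    have h7 : p ∣ p ^ 2 := dvd_pow_self p two_ne_zero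
    have h8 := (Nat.dvd_sub_iff_right (by omega) h7).mp h6
    exact absurd (Nat.dvd_one.mp h8) (by omega)
  · exact hone e he'.1 he'.2 hpe h1

end StructureOfQ

/-! ### Integration of the invariant 1-form. -/

section Antiderivative

open MvPolynomial

variable {p : ℕ} [Fact p.Prime] (k : Type*) [Field k] [Algebra (Zq p) k] [CharP k p]

variable (p) in
/-- The antiderivative of `Y₀ P` in `X₀`; it is also the one of `-X₀ P` in `Y₀`. -/
noncomputable def antideriv (a₁ : ℕ) : Sym k ![p - 2, a₁ - 1] →ₗ[k] Sym k ![p, a₁ - 1] :=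
  monConstr fun i j => ((i : k) + 1)⁻¹ • mon k ![p, a₁ - 1] (i + 1) j

omit [Algebra (Zq p) k] in
theorem natCast_succ_ne_zero {i : ℕ} (hi : i ≤ p - 2) : (i : k) + 1 ≠ 0 := by
  have hp := Nat.Prime.two_le (Fact.out : p.Prime)
  rw [← Nat.cast_succ, Ne, CharP.cast_eq_zero_iff k p]
  intro h
  have := Nat.le_of_dvd (by omega) h
  omega

omit [Algebra (Zq p) k] in
-- The antiderivative has degree `p = 0` in `X₀, Y₀`, so `X₀ ∂/∂X₀ + Y₀ ∂/∂Y₀` annihilates it and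
-- either formula determines the other. Division by `i + 1` is possible as `i + 1 ≤ p - 1`.
theorem pderiv_antideriv {a₁ : ℕ} (f : Sym k ![p - 2, a₁ - 1]) :
    pderiv (0, 0) (Sym.toPoly k _ (antideriv p k a₁ f)) = X (0, 1) * Sym.toPoly k _ f ∧
    pderiv (0, 1) (Sym.toPoly k _ (antideriv p k a₁ f)) = -(X (0, 0) * Sym.toPoly k _ f) := by
  have hp := Nat.Prime.two_le (Fact.out : p.Prime)
  have h0 : ((pderiv (0, 0)).toLinearMap.comp ((Sym.toPoly k _).comp (antideriv p k a₁))) =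
      (LinearMap.mulLeft k (X (0, 1))).comp (Sym.toPoly k _) := by
    refine hom_ext_mon k fun i j hi hj => ?_
    simp only [Matrix.cons_val_zero, Matrix.cons_val_one, Matrix.cons_val_fin_one] at hi hj
    have hi' := natCast_succ_ne_zero (p := p) k hi
    simp only [LinearMap.comp_apply, antideriv, LinearMap.mulLeft_apply, Derivation.coeFn_coe]
    rw [monConstr_mon _ (by simpa using hi) (by simpa using hj), map_smul, Derivation.map_smul,
      toPoly_mon k (by simp; omega) (by simpa using hj),
      toPoly_mon k (by simpa using hi) (by simpa using hj)]
    simp only [Matrix.cons_val_zero, Matrix.cons_val_one, Matrix.cons_val_fin_one, Derivation.leibniz,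
      Derivation.leibniz_pow, pderiv_X, smul_eq_mul]
    rw [show p - (i + 1) = p - 2 - i + 1 by omega]
    simp [smul_eq_C_mul, nsmul_eq_mul]
    have hC : (C ((i : k) + 1)⁻¹ : Poly k) * (i + 1) = 1 := by
      rw [← map_natCast (C : k →+* Poly k), ← map_one (C : k →+* Poly k), ← map_add, ← map_mul,
        inv_mul_cancel₀ hi']
    linear_combination (X (0, 0) ^ i * X (0, 1) ^ (p - 2 - i + 1) *
      (X (1, 0) ^ j * X (1, 1) ^ (a₁ - 1 - j))) * hC
  have h1 : ((pderiv (0, 1)).toLinearMap.comp ((Sym.toPoly k _).comp (antideriv p k a₁))) =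
      -(LinearMap.mulLeft k (X (0, 0))).comp (Sym.toPoly k _) := by
    refine hom_ext_mon k fun i j hi hj => ?_
    simp only [Matrix.cons_val_zero, Matrix.cons_val_one, Matrix.cons_val_fin_one] at hi hj
    have hi' := natCast_succ_ne_zero (p := p) k hi
    simp only [LinearMap.comp_apply, antideriv, LinearMap.mulLeft_apply, Derivation.coeFn_coe,
      LinearMap.neg_apply]
    rw [monConstr_mon _ (by simpa using hi) (by simpa using hj), map_smul, Derivation.map_smul,
      toPoly_mon k (by simp; omega) (by simpa using hj),
      toPoly_mon k (by simpa using hi) (by simpa using hj)]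
    simp only [Matrix.cons_val_zero, Matrix.cons_val_one, Matrix.cons_val_fin_one, Derivation.leibniz,
      Derivation.leibniz_pow, pderiv_X, smul_eq_mul]
    have hn : ((p - (i + 1) : ℕ) : Poly k) = -((i : Poly k) + 1) := by
      rw [Nat.cast_sub (by omega), CharP.cast_eq_zero, zero_sub]
      push_cast
      ring
    have hs : p - (i + 1) - 1 = p - 2 - i := by omega
    simp [smul_eq_C_mul, nsmul_eq_mul, hn, hs]
    have hC : (C ((i : k) + 1)⁻¹ : Poly k) * (i + 1) = 1 := by
      rw [← map_natCast (C : k →+* Poly k), ← map_one (C : k →+* Poly k), ← map_add, ← map_mul,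
        inv_mul_cancel₀ hi']
    linear_combination -(X (0, 0) ^ (i + 1) * X (0, 1) ^ (p - 2 - i) *
      (X (1, 0) ^ j * X (1, 1) ^ (a₁ - 1 - j))) * hC
  exact ⟨LinearMap.congr_fun h0 f, LinearMap.congr_fun h1 f⟩

omit [CharP k p] in
theorem pderiv_subst (m : Matrix (Fin 2) (Fin 2) (Zq p)) (P : Poly k) :
    pderiv (0, 0) (subst k m P) = C (algebraMap (Zq p) k (m 0 0)) * subst k m (pderiv (0, 0) P) +
      C (algebraMap (Zq p) k (m 0 1)) * subst k m (pderiv (0, 1) P) := by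
  induction P using MvPolynomial.induction_on with
  | C a => simp [subst]
  | add P Q hP hQ => simp only [map_add, hP, hQ]; ring
  | mul_X P x hP =>
    obtain ⟨i, j⟩ := x
    simp only [map_mul, Derivation.leibniz, smul_eq_mul, map_add, hP]
    fin_cases i <;> fin_cases j <;>
      simp [subst_X_zero, subst_X_one, pderiv_X] <;> ring

/-- The antiderivative is `K`-equivariant up to monomials `Y₀^p X₁^j Y₁^{a₁-1-j}` and
`X₀^p X₁^j Y₁^{a₁-1-j}`. -/
theorem evSym_antideriv_sub_mem {a₁ : ℕ} (ha₁ : 1 ≤ a₁) (m : Matrix (Fin 2) (Fin 2) (Zq p))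
    (f : Sym k ![p - 2, a₁ - 1]) :
    evSym p k _ (matAct k _ m (antideriv p k a₁ f) -
      algebraMap (Zq p) k m.det • antideriv p k a₁ (matAct k _ m f)) ∈
      LinearMap.range (evSym p k ![0, a₁]) := by
  set h := matAct k _ m (antideriv p k a₁ f) -
    algebraMap (Zq p) k m.det • antideriv p k a₁ (matAct k _ m f) with hh
  -- The form `Y₀ dX₀ - X₀ dY₀` is multiplied by the determinant under the substitution, so both
  -- terms of `h` have the same derivative.
  have hd : pderiv (0, 0) (Sym.toPoly k _ h) = 0 := by
    rw [hh, map_sub, map_sub, map_smul, Derivation.map_smul, (pderiv_antideriv k _).1, toPoly_matAct,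
      pderiv_subst, (pderiv_antideriv k f).1, (pderiv_antideriv k f).2, toPoly_matAct, smul_eq_C_mul,
      map_mul, map_neg, map_mul, subst_X_zero, subst_X_zero, Matrix.det_fin_two, map_sub, map_mul,
      map_mul]
    simp only [map_sub, map_mul]
    ring
  have hc : ∀ i j, i + 1 < p → coeffMon k _ (i + 1) j h = 0 := by
    intro i j hi
    have h1 := congrArg (coeff (expo ![p, a₁ - 1] (i + 1) j - Finsupp.single (0, 0) 1)) hd
    have h2 : expo ![p, a₁ - 1] (i + 1) j - Finsupp.single (0, 0) 1 + Finsupp.single (0, 0) 1 =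
        expo ![p, a₁ - 1] (i + 1) j := by
      refine tsub_add_cancel_of_le ?_
      rw [Finsupp.single_le_iff]
      simp [expo]
    have h3 : (expo ![p, a₁ - 1] (i + 1) j - Finsupp.single (0, 0) 1 : Fin 2 × Fin 2 →₀ ℕ) (0, 0) =
        i := by
      simp [expo]
    rw [coeff_pderiv, h2, h3, coeff_zero] at h1
    exact (mul_eq_zero.mp h1).resolve_right (natCast_succ_ne_zero k (p := p) (by omega))
  rw [← monConstr_apply_mon h, monConstr]
  simp only [LinearMap.sum_apply, map_sum, LinearMap.smulRight_apply, map_smul]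
  refine Submodule.sum_mem _ fun i hi => Submodule.sum_mem _ fun j hj => ?_
  simp only [Finset.mem_range, Matrix.cons_val_zero, Matrix.cons_val_one, Matrix.cons_val_fin_one]
    at hi hj
  -- Only the exponents `0` and `p` of `X₀` survive. As functions, `Y₀^p` and `X₀^p` are `Y₁` and
  -- `X₁`, which brings the monomial into `(0, a₁)`.
  rcases Nat.eq_zero_or_pos i with rfl | hi0
  · refine Submodule.smul_mem _ _ ⟨mon k _ 0 j, funext fun v => ?_⟩
    rw [evSym_mon k (by simp) (by simp; omega), evSym_mon k (by simp) (by simp; omega)]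
    have : p * (a₁ - j) = p + p * (a₁ - 1 - j) := by
      rw [show a₁ - j = a₁ - 1 - j + 1 by omega]
      ring
    simp [this]
  · rcases Nat.lt_or_ge i p with hip | hip
    · obtain ⟨i, rfl⟩ := Nat.exists_eq_succ_of_ne_zero hi0.ne'
      rw [hc i j hip, zero_smul]
      exact Submodule.zero_mem _
    · obtain rfl : i = p := by omega
      refine Submodule.smul_mem _ _ ⟨mon k _ 0 (j + 1), funext fun v => ?_⟩
      rw [evSym_mon k (by simp) (by simp; omega), evSym_mon k (by simp) (by simp; omega)]
      have : a₁ - (j + 1) = a₁ - 1 - j := by omega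
      simp [this, Nat.mul_add, add_comm]

end Antiderivative

/-! ### Generation by the lowest monomial. -/

section UpperUnipotent

open MvPolynomial

variable {p : ℕ} [Fact p.Prime]

/-- The upper unipotent matrix with entry `c`. -/
noncomputable def upperUnip (c : Zq p) : K p :=
  ⟨!![1, c; 0, 1], !![1, -c; 0, 1], by rw [Matrix.one_fin_two]; simp,
    by rw [Matrix.one_fin_two]; simp⟩

variable (k : Type*) [Field k] [Algebra (Zq p) k] [CharP k p]

theorem matAct_upperUnip_mon_zero {r : Fin 2 → ℕ} (x : GaloisField p 2) :
    matAct k r (upperUnip (WittVector.teichmuller p x)).1 (mon k r 0 0) =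
      ∑ e ∈ Finset.range (r 0 + 1) ×ˢ Finset.range (r 1 + 1), tau p k x ^ (e.1 + p * e.2) •
        (((r 0).choose e.1 * (r 1).choose e.2 : k) • mon k r e.1 e.2) := by
  apply Sym.toPoly_injective
  rw [toPoly_matAct_mon k _ (Nat.zero_le _) (Nat.zero_le _)]
  have h0 : (upperUnip (WittVector.teichmuller p x)).1 = !![1, WittVector.teichmuller p x; 0, 1] := rfl
  simp only [subst_X_zero, subst_X_one, h0, Matrix.of_apply, Matrix.cons_val', Matrix.cons_val_zero,
    Matrix.cons_val_one, Matrix.cons_val_fin_one, map_one, frobenius_teichmuller, map_pow,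
    algebraMap_teichmuller, pow_zero, one_mul, Nat.sub_zero, add_pow, map_sum]
  rw [Finset.sum_mul_sum, Finset.sum_product]
  refine Finset.sum_congr rfl fun i hi => Finset.sum_congr rfl fun j hj => ?_
  rw [Finset.mem_range] at hi hj
  rw [map_smul, map_smul, toPoly_mon k (by omega) (by omega), smul_eq_C_mul, smul_eq_C_mul]
  simp only [map_mul, map_pow, map_natCast]
  ring

/-- `Sym^{r₀} ⊗ Sym^{r₁} ⊗ D^s` is generated by `Y₀^{r₀} Y₁^{r₁}` if `r₀, r₁ < p` and `r₁ < p - 1`. -/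
theorem eq_top_of_mon_zero_mem {r : Fin 2 → ℕ} {s : ℕ} (hr : r 0 < p) (hr' : r 1 + 1 < p)
    (W : Subrepresentation (symRep (p := p) k r s)) (h : mon k r 0 0 ∈ W.toSubmodule) :
    W.toSubmodule = ⊤ := by
  rw [eq_top_iff]
  intro v _
  refine mem_of_mon_mem k W.toSubmodule (fun i j hi hj => ?_) v
  -- With `r₁ < p - 1` all exponents `i + p j` stay below `q - 1`, so averaging over upper
  -- unipotents separates the monomials.
  have hb : p * (r 1 + 1) + p ≤ p ^ 2 := mul_lt_of_le_sub_one (by omega)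
  have hlt : ∀ e ∈ Finset.range (r 0 + 1) ×ˢ Finset.range (r 1 + 1), e.1 + p * e.2 < p ^ 2 - 1 := by
    intro e he
    rw [Finset.mem_product, Finset.mem_range, Finset.mem_range] at he
    have : p * e.2 ≤ p * r 1 := Nat.mul_le_mul_left p (by omega)
    rw [Nat.mul_add] at hb
    omega
  have hmem : (i, j) ∈ Finset.range (r 0 + 1) ×ˢ Finset.range (r 1 + 1) := by
    rw [Finset.mem_product, Finset.mem_range, Finset.mem_range]
    omega
  have h0 := hlt _ hmem
  have h1 := sum_tau_pow_smul k (p := p) (Finset.range (r 0 + 1) ×ˢ Finset.range (r 1 + 1))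
    (fun e => e.1 + p * e.2) (fun e => ((r 0).choose e.1 * (r 1).choose e.2 : k) • mon k r e.1 e.2)
    (p ^ 2 - 1 - (i + p * j)) hmem (by simp only at h0 ⊢; omega)
    (fun e he => by have := hlt e he; omega) (fun e he hij => by
      rw [Finset.mem_product, Finset.mem_range, Finset.mem_range] at he
      have h2 := congrArg (· % p) hij
      have h3 := congrArg (· / p) hij
      simp only [Nat.add_mul_mod_self_left, Nat.mod_eq_of_lt (show e.1 < p by omega),
        Nat.mod_eq_of_lt (show i < p by omega)] at h2
      simp only [Nat.add_mul_div_left _ _ (show 0 < p by omega),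
        Nat.div_eq_of_lt (show e.1 < p by omega), Nat.div_eq_of_lt (show i < p by omega),
        zero_add] at h3
      exact Prod.ext h2 h3)
  have h2 : -(((r 0).choose i * (r 1).choose j : k) • mon k r i j) ∈ W.toSubmodule := by
    rw [← h1]
    refine Submodule.sum_mem _ fun x _ => Submodule.smul_mem _ _ ?_
    rw [← matAct_upperUnip_mon_zero]
    have h3 := W.apply_mem_toSubmodule (upperUnip (WittVector.teichmuller p x)) h
    rw [symRep_apply] at h3
    have h4 : (upperUnip (WittVector.teichmuller p x)).1.det = 1 := by
      simp [upperUnip, Matrix.det_fin_two]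
    rwa [h4, map_one, one_pow, one_smul] at h3
  have hne : ((r 0).choose i * (r 1).choose j : k) ≠ 0 :=
    mul_ne_zero (choose_ne_zero k hr hi) (choose_ne_zero k (by omega) hj)
  have h3 := Submodule.smul_mem _ ((r 0).choose i * (r 1).choose j : k)⁻¹ (Submodule.neg_mem _ h2)
  rwa [neg_neg, smul_smul, inv_mul_cancel₀ hne, one_smul] at h3

end UpperUnipotent

/-! ### The socle of `Q`. -/

section Socle

open IsLocalRing

variable {p : ℕ} [Fact p.Prime] (𝒪 : Type*) [CommRing 𝒪] [Algebra (Zq p) 𝒪] [IsLocalRing 𝒪]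
  [Module.Finite (Zq p) 𝒪] {r : Fin 2 → ℕ}

variable (p r) in
/-- The map `P ↦ ∫ Y₀ P dX₀` followed by the passage to functions on `𝔽_{p²}²`, lifted to `V_r`. -/
noncomputable def liftAntideriv (a₁ : ℕ) :
    Sym (ResidueField 𝒪) ![p - 2, a₁ - 1] →ₗ[ResidueField 𝒪] Sym (ResidueField 𝒪) r :=
  monConstr fun i j => ((i : ResidueField 𝒪) + 1)⁻¹ • monB p _ r (i + 1 + p * j)

variable (hr : ∀ i, p ^ 2 ≤ r i) {a₁ : ℕ} (ha₁ : 1 ≤ a₁) (ha₁' : a₁ ≤ p - 1)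
  (hcong : r 0 + p * r 1 ≡ p * a₁ [MOD p ^ 2 - 1])
include hr ha₁ ha₁' hcong

/-- The degrees differ, but `r₀ + p r₁ ≡ p a₁` modulo `q - 1`, and `e = i + 1 + p j < p a₁` keeps
both exponents of `y` positive. -/
theorem evSym_liftAntideriv (f : Sym (ResidueField 𝒪) ![p - 2, a₁ - 1]) :
    evSym p (ResidueField 𝒪) r (liftAntideriv p 𝒪 r a₁ f) =
      evSym p (ResidueField 𝒪) _ (antideriv p (ResidueField 𝒪) a₁ f) := by
  have := charP_residueField (p := p) 𝒪
  have hp := Nat.Prime.two_le (Fact.out : p.Prime)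
  have hpa := mul_lt_of_le_sub_one ha₁'
  refine LinearMap.congr_fun (f := (evSym p (ResidueField 𝒪) r).comp (liftAntideriv p 𝒪 r a₁))
    (g := (evSym p (ResidueField 𝒪) _).comp (antideriv p (ResidueField 𝒪) a₁))
    (hom_ext_mon _ fun i j hi hj => ?_) f
  rw [LinearMap.comp_apply, LinearMap.comp_apply, liftAntideriv, antideriv, monConstr_mon _ hi hj,
    monConstr_mon _ hi hj, map_smul, map_smul]
  simp only [Matrix.cons_val_zero, Matrix.cons_val_one, Matrix.cons_val_fin_one] at hi hj
  congr 1
  funext v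
  obtain ⟨b, hb⟩ := Nat.exists_eq_add_of_le hj
  have ha : p * a₁ = p * j + p * b + p := by
    rw [show a₁ = j + b + 1 by omega]
    ring
  have h1 := modEq_sub hr ha₁' hcong (e := i + 1 + p * j) (by omega)
  have h2 := lt_weight hr (e := i + 1 + p * j) (by omega)
  rw [evSym_monB _ hr (by omega), evSym_mon _ (by simp; omega) (by simp; omega),
    algebraMap_pow_eq _ (by omega) (by omega) h1, ha]
  simp only [Matrix.cons_val_zero, Matrix.cons_val_one, Matrix.cons_val_fin_one, hb,
    Nat.add_sub_cancel_left]
  congr 2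
  omega

theorem repQ_cls_liftAntideriv (g : K p) (f : Sym (ResidueField 𝒪) ![p - 2, a₁ - 1]) :
    repQ 𝒪 r g (cls p 𝒪 r (liftAntideriv p 𝒪 r a₁ f)) =
      cls p 𝒪 r (liftAntideriv p 𝒪 r a₁ (symRep _ _ 1 g f)) := by
  have := charP_residueField (p := p) 𝒪
  rw [repQ_cls, ← sub_eq_zero, ← map_sub, cls_eq_zero_iff 𝒪 hr ha₁ ha₁' hcong]
  have h1 : evSym p (ResidueField 𝒪) r (matAct _ r g.1 (liftAntideriv p 𝒪 r a₁ f)) =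
      evSym p (ResidueField 𝒪) _ (matAct _ _ g.1 (antideriv p (ResidueField 𝒪) a₁ f)) := by
    funext v
    rw [evSym_matAct, evSym_matAct, evSym_liftAntideriv 𝒪 hr ha₁ ha₁' hcong]
  have h2 := evSym_antideriv_sub_mem (ResidueField 𝒪) ha₁ g.1 f
  rw [map_sub, map_smul, ← h1, ← evSym_liftAntideriv 𝒪 hr ha₁ ha₁' hcong, ← map_smul, ← map_smul,
    ← map_sub] at h2
  rw [symRep_apply, pow_one]
  exact h2

/-- The exponents `i + 1 + p j` are distinct and prime to `p`, hence they avoid the vanishing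
classes `e = p j`. -/
theorem cls_liftAntideriv_injective :
    Function.Injective ((cls p 𝒪 r).comp (liftAntideriv p 𝒪 r a₁)) := by
  have := charP_residueField (p := p) 𝒪
  have hp := Nat.Prime.two_le (Fact.out : p.Prime)
  have hpa := mul_lt_of_le_sub_one ha₁'
  rw [← LinearMap.ker_eq_bot, LinearMap.ker_eq_bot']
  intro f hf
  set s := Finset.range (p - 2 + 1) ×ˢ Finset.range (a₁ - 1 + 1) with hs
  have hlt : ∀ e ∈ s, e.1 + 1 < p ∧ e.2 < a₁ ∧ e.1 + 1 + p * e.2 < p ^ 2 := by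
    intro e he
    rw [hs, Finset.mem_product, Finset.mem_range, Finset.mem_range] at he
    have : p * e.2 ≤ p * a₁ := Nat.mul_le_mul_left p (by omega)
    omega
  have hinj : ∀ e ∈ s, ∀ e' ∈ s, e.1 + 1 + p * e.2 = e'.1 + 1 + p * e'.2 → e = e' := by
    intro e he e' he' h
    have h1 := hlt e he
    have h1' := hlt e' he'
    have h2 := congrArg (· % p) h
    have h3 := congrArg (· / p) h
    simp only [Nat.add_mul_mod_self_left, Nat.mod_eq_of_lt h1.1, Nat.mod_eq_of_lt h1'.1] at h2
    simp only [Nat.add_mul_div_left _ _ (show 0 < p by omega), Nat.div_eq_of_lt h1.1,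
      Nat.div_eq_of_lt h1'.1, zero_add] at h3
    exact Prod.ext (by omega) h3
  set φ : ℕ × ℕ → ResidueField 𝒪 := fun e =>
    coeffMon (ResidueField 𝒪) ![p - 2, a₁ - 1] e.1 e.2 f * ((e.1 : ResidueField 𝒪) + 1)⁻¹ with hφ
  have h1 : ∑ e ∈ Finset.range (p ^ 2), (∑ d ∈ s, if d.1 + 1 + p * d.2 = e then φ d else 0) •
      cls p 𝒪 r (monB p _ r e) = 0 := by
    have h2 : cls p 𝒪 r (liftAntideriv p 𝒪 r a₁ f) =
        ∑ d ∈ s, φ d • cls p 𝒪 r (monB p _ r (d.1 + 1 + p * d.2)) := by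
      rw [liftAntideriv, monConstr, hs, Finset.sum_product]
      simp only [LinearMap.sum_apply, map_sum, LinearMap.smulRight_apply, map_smul, smul_smul]
      rfl
    rw [← hf, LinearMap.comp_apply, h2]
    simp only [Finset.sum_smul]
    rw [Finset.sum_comm]
    refine Finset.sum_congr rfl fun d hd => ?_
    simp only [ite_smul, zero_smul]
    rw [Finset.sum_ite_eq, if_pos (Finset.mem_range.mpr (hlt d hd).2.2)]
  have h2 : ∀ d ∈ s, coeffMon (ResidueField 𝒪) ![p - 2, a₁ - 1] d.1 d.2 f = 0 := by
    intro d hd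
    have h3 := cls_coeff_eq_zero 𝒪 hr ha₁ ha₁' hcong _ h1 (hlt d hd).2.2 (fun j _ h => by
      have h2 := congrArg (· % p) h
      simp only [Nat.add_mul_mod_self_left, Nat.mod_eq_of_lt (hlt d hd).1, Nat.mul_mod_right] at h2
      omega)
    rw [Finset.sum_eq_single d (fun d' hd' hne => if_neg fun h => hne (hinj d' hd' d hd h))
      (fun h => absurd hd h), if_pos rfl] at h3
    refine (mul_eq_zero.mp h3).resolve_right (inv_ne_zero (natCast_succ_ne_zero (p := p) _ ?_))
    have := hlt d hd
    omega
  rw [← monConstr_apply_mon f, monConstr, LinearMap.sum_apply]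
  refine Finset.sum_eq_zero fun i hi => ?_
  rw [LinearMap.sum_apply]
  refine Finset.sum_eq_zero fun j hj => ?_
  rw [LinearMap.smulRight_apply, h2 (i, j) (Finset.mem_product.mpr ⟨hi, hj⟩), zero_smul]

/-- The image of `(p-2, a₁-1) ⊗ D` in `Q`. -/
noncomputable def rangeAntideriv : Subrepresentation (repQ (p := p) 𝒪 r) where
  toSubmodule := LinearMap.range ((cls p 𝒪 r).comp (liftAntideriv p 𝒪 r a₁))
  apply_mem_toSubmodule g v := by
    rintro ⟨f, rfl⟩
    exact ⟨_, (repQ_cls_liftAntideriv 𝒪 hr ha₁ ha₁' hcong g f).symm⟩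

omit hr ha₁ ha₁' hcong in
theorem cls_liftAntideriv_mon_zero :
    cls p 𝒪 r (liftAntideriv p 𝒪 r a₁ (mon _ _ 0 0)) = cls p 𝒪 r (monB p _ r 1) := by
  rw [liftAntideriv, monConstr_mon _ (by simp) (by simp)]
  simp

/-- The preimage of `W` in `(p-2, a₁-1) ⊗ D` contains the generator `Y₀^{p-2} Y₁^{a₁-1}`, which maps
to the class with `e = 1`. -/
theorem rangeAntideriv_le (W : Subrepresentation (repQ (p := p) 𝒪 r)) (hW : W.toSubmodule ≠ ⊥) :
    (rangeAntideriv 𝒪 hr ha₁ ha₁' hcong).toSubmodule ≤ W.toSubmodule := by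
  have := charP_residueField (p := p) 𝒪
  have hp := Nat.Prime.two_le (Fact.out : p.Prime)
  obtain ⟨x, hx, hx0⟩ := Submodule.exists_mem_ne_zero_of_ne_bot hW
  let U : Subrepresentation (symRep (p := p) (ResidueField 𝒪) ![p - 2, a₁ - 1] 1) :=
    { toSubmodule := W.toSubmodule.comap ((cls p 𝒪 r).comp (liftAntideriv p 𝒪 r a₁))
      apply_mem_toSubmodule := fun g v hv => by
        rw [Submodule.mem_comap, LinearMap.comp_apply] at hv ⊢
        rw [← repQ_cls_liftAntideriv 𝒪 hr ha₁ ha₁' hcong]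
        exact W.apply_mem_toSubmodule g hv }
  have hU : U.toSubmodule = ⊤ := by
    refine eq_top_of_mon_zero_mem _ (by simp; omega) (by simp; omega) U ?_
    rw [Submodule.mem_comap, LinearMap.comp_apply, cls_liftAntideriv_mon_zero]
    exact cls_monB_one_mem 𝒪 hr ha₁ ha₁' hcong W hx hx0
  rintro _ ⟨f, rfl⟩
  have hf : f ∈ U.toSubmodule := hU ▸ Submodule.mem_top
  exact hf

end Socle

section Minimal

variable {k H V : Type*} [Field k] [Monoid H] [AddCommGroup V] [Module k V]
  {ρ : Representation k H V}

/-- A nonzero subrepresentation that is contained in all others is the socle. -/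
theorem socle_eq_of_le (S : Subrepresentation ρ) (hS : S.toSubmodule ≠ ⊥)
    (h : ∀ W : Subrepresentation ρ, W.toSubmodule ≠ ⊥ → S.toSubmodule ≤ W.toSubmodule) :
    socle ρ = S := by
  apply Subrepresentation.toSubmodule_injective
  apply le_antisymm
  · refine iSup_le fun W => ?_
    have hW := W.2
    let U : Subrepresentation W.1.toRepresentation :=
      { toSubmodule := S.toSubmodule.comap W.1.toSubmodule.subtype
        apply_mem_toSubmodule := fun g v hv => S.apply_mem_toSubmodule g hv }
    have hWne : W.1.toSubmodule ≠ ⊥ := by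
      intro h0
      have : Subsingleton W.1.toSubmodule := by rw [h0]; infer_instance
      exact bot_ne_top (α := Subrepresentation W.1.toRepresentation)
        (Subrepresentation.toSubmodule_injective (Subsingleton.elim _ _))
    have hle := h W.1 hWne
    rcases hW.eq_bot_or_eq_top U with hU | hU
    · exfalso
      obtain ⟨x, hx, hx0⟩ := Submodule.exists_mem_ne_zero_of_ne_bot hS
      have h1 : (⟨x, hle hx⟩ : W.1.toSubmodule) ∈ U.toSubmodule := hx
      rw [hU] at h1
      exact hx0 (congrArg Subtype.val ((Submodule.mem_bot k).mp h1))
    · intro x hx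
      have h1 : (⟨x, hx⟩ : W.1.toSubmodule) ∈ U.toSubmodule := by
        rw [hU]
        exact Submodule.mem_top
      exact h1
  · have hirr : S.toRepresentation.IsIrreducible :=
      { exists_pair_ne := by
          refine ⟨⊥, ⊤, fun h0 => hS ?_⟩
          rw [Submodule.eq_bot_iff]
          intro x hx
          have h1 : (⟨x, hx⟩ : S.toSubmodule) ∈ (⊥ : Subrepresentation S.toRepresentation).toSubmodule := by
            rw [h0]
            exact Submodule.mem_top
          exact congrArg Subtype.val ((Submodule.mem_bot k).mp h1)
        eq_bot_or_eq_top := fun U => by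
          by_cases hU : U.toSubmodule = ⊥
          · exact Or.inl (Subrepresentation.toSubmodule_injective hU)
          · right
            let U' : Subrepresentation ρ :=
              { toSubmodule := U.toSubmodule.map S.toSubmodule.subtype
                apply_mem_toSubmodule := by
                  rintro g _ ⟨x, hx, rfl⟩
                  exact ⟨_, U.apply_mem_toSubmodule g hx, rfl⟩ }
            have hU' : U'.toSubmodule ≠ ⊥ := fun h0 => hU
              (Submodule.map_injective_of_injective S.toSubmodule.injective_subtype
                (h0.trans (Submodule.map_bot _).symm))
            apply Subrepresentation.toSubmodule_injective
            refine eq_top_iff.mpr fun x _ => ?_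
            obtain ⟨y, hy, hyx⟩ := h U' hU' x.2
            rwa [← Subtype.ext hyx] }
    exact le_iSup (fun W : {W : Subrepresentation ρ // W.toRepresentation.IsIrreducible} =>
      W.1.toSubmodule) ⟨S, hirr⟩

end Minimal

section SocleEquiv

open IsLocalRing

variable {p : ℕ} [Fact p.Prime] (𝒪 : Type*) [CommRing 𝒪] [Algebra (Zq p) 𝒪] [IsLocalRing 𝒪]
  [Module.Finite (Zq p) 𝒪] {r : Fin 2 → ℕ}

/-- The socle of `Q` is isomorphic to `(p-2, a₁-1) ⊗ D`. -/
theorem nonempty_equiv_socle (hr : ∀ i, p ^ 2 ≤ r i) {a₁ : ℕ} (ha₁ : 1 ≤ a₁) (ha₁' : a₁ ≤ p - 1)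
    (hcong : r 0 + p * r 1 ≡ p * a₁ [MOD p ^ 2 - 1]) :
    Nonempty ((symRep (p := p) (ResidueField 𝒪) ![p - 2, a₁ - 1] 1).Equiv
      (socle (repQ (p := p) 𝒪 r)).toRepresentation) := by
  have hinj := cls_liftAntideriv_injective 𝒪 hr ha₁ ha₁' hcong
  rw [socle_eq_of_le (rangeAntideriv 𝒪 hr ha₁ ha₁' hcong) ?_
    (rangeAntideriv_le 𝒪 hr ha₁ ha₁' hcong)]
  · exact ⟨Representation.Equiv.mk (LinearEquiv.ofInjective _ hinj) fun g => LinearMap.ext fun f =>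
      Subtype.ext (repQ_cls_liftAntideriv 𝒪 hr ha₁ ha₁' hcong g f).symm⟩
  · intro h
    have h1 : (cls p 𝒪 r).comp (liftAntideriv p 𝒪 r a₁) (mon _ _ 0 0) = 0 := by
      rw [← Submodule.mem_bot (ResidueField 𝒪), ← h]
      exact ⟨_, rfl⟩
    have h2 := hinj (h1.trans (map_zero _).symm)
    have h3 := congrArg (coeffMon (ResidueField 𝒪) ![p - 2, a₁ - 1] 0 0) h2
    rw [coeffMon_mon (Nat.zero_le _) (Nat.zero_le _), if_pos ⟨rfl, rfl⟩, map_zero] at h3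
    exact one_ne_zero h3

end SocleEquiv

/-! ### Consequences of the bounds on the valuation. -/

section Valuation

open IsDiscreteValuationRing

variable {p : ℕ} {𝒪 : Type*} [CommRing 𝒪] [IsDomain 𝒪] [IsDiscreteValuationRing 𝒪]

theorem mul_mem_maximalIdeal_of_addVal_lt {x y : 𝒪} (h : addVal 𝒪 x < addVal 𝒪 y) :
    ∃ b ∈ IsLocalRing.maximalIdeal 𝒪, y = x * b := by
  obtain ⟨b, hb⟩ := (addVal_le_iff_dvd).mp h.le
  refine ⟨b, ?_, hb⟩
  rw [IsLocalRing.mem_maximalIdeal, mem_nonunits_iff]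
  intro hu
  rw [hb, addVal_mul, show addVal 𝒪 b = 0 from addVal_eq_zero_of_unit hu.unit] at h
  simp at h

theorem addVal_of_normVal_mem_Ioo {a : 𝒪} (ha : normVal p a ∈ Set.Ioo (1 / 2) 1) :
    (p : 𝒪) ≠ 0 ∧ addVal 𝒪 a < addVal 𝒪 (p : 𝒪) ∧ addVal 𝒪 (p : 𝒪) < addVal 𝒪 (a * a) := by
  rw [addVal_mul]
  obtain ⟨h1, h2⟩ := ha
  rw [normVal] at h1 h2
  have hp : (p : 𝒪) ≠ 0 := by
    intro h0
    rw [h0, addVal_zero] at h1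
    simp at h1
  have hp' : addVal 𝒪 (p : 𝒪) ≠ ⊤ := by rwa [Ne, addVal_eq_top_iff]
  have ha' : addVal 𝒪 a ≠ ⊤ := by
    intro h0
    rw [h0] at h2
    obtain ⟨n, hn⟩ := ENat.ne_top_iff_exists.mp hp'
    rw [← hn] at h2
    simp [ENNReal.top_div] at h2
  obtain ⟨n, hn⟩ := ENat.ne_top_iff_exists.mp hp'
  obtain ⟨m, hm⟩ := ENat.ne_top_iff_exists.mp ha'
  rw [← hn, ← hm] at h1 h2 ⊢
  refine ⟨hp, ?_⟩
  -- If `p` had valuation `0`, the quotient in `ENNReal` would be `0` or `⊤`; both are outside the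
  -- interval.
  have hn0 : n ≠ 0 := by
    rintro rfl
    rcases Nat.eq_zero_or_pos m with rfl | h
    · simp at h1
    · simp [ENNReal.div_zero (show (m : ENNReal) ≠ 0 by exact_mod_cast h.ne')] at h2
  simp only [ENat.toENNReal_coe] at h1 h2
  have hn1 : (n : ENNReal) ≠ 0 := by exact_mod_cast hn0
  rw [ENNReal.div_lt_iff (Or.inl hn1) (Or.inl (ENNReal.natCast_ne_top n)), one_mul] at h2
  rw [ENNReal.lt_div_iff_mul_lt (Or.inl hn1) (Or.inl (ENNReal.natCast_ne_top n)), mul_comm,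
    mul_one_div, ENNReal.div_lt_iff (Or.inl two_ne_zero) (Or.inl ENNReal.ofNat_ne_top)] at h1
  have h3 : m < n := by exact_mod_cast h2
  have h4 : n < m * 2 := by exact_mod_cast h1
  refine ⟨by exact_mod_cast h3, ?_⟩
  norm_cast
  omega

end Valuation

/-! ### Factorization through the induction of `Q`. -/

section Factorization

open IsLocalRing

variable {p : ℕ} [Fact p.Prime] (𝒪 E : Type*) [CommRing 𝒪] [IsLocalRing 𝒪] [Algebra (Zq p) 𝒪]
  [Module.Finite (Zq p) 𝒪] [Field E] [Algebra 𝒪 E] [Algebra (Zq p) E] [IsScalarTower (Zq p) 𝒪 E]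
  {r : Fin 2 → ℕ}

omit [Fact p.Prime] [Algebra (Zq p) 𝒪] [Module.Finite (Zq p) 𝒪] in
theorem coeffMap_residueField_surjective :
    Function.Surjective (coeffMap 𝒪 (ResidueField 𝒪) r) := by
  let S : Submodule (ResidueField 𝒪) (Sym (ResidueField 𝒪) r) :=
    { carrier := Set.range (coeffMap 𝒪 (ResidueField 𝒪) r)
      zero_mem' := ⟨0, map_zero _⟩
      add_mem' := by
        rintro _ _ ⟨v, rfl⟩ ⟨w, rfl⟩
        exact ⟨v + w, map_add _ _ _⟩
      smul_mem' := by
        rintro c _ ⟨v, rfl⟩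
        obtain ⟨c, rfl⟩ := residue_surjective c
        exact ⟨c • v, map_smul _ _ _⟩ }
  exact fun w => mem_of_mon_mem _ S (fun i j hi hj => ⟨mon 𝒪 r i j, coeffMap_mon 𝒪 hi hj⟩) w

theorem toIndQ_br (g : G p) (v : Sym 𝒪 r) : toIndQ 𝒪 p r (br _ g v) =
    br (repQ (p := p) 𝒪 r) g (cls p 𝒪 r (coeffMap 𝒪 (ResidueField 𝒪) r v)) :=
  indMap_br _ _ _ _ g v

theorem toIndQ_surjective : Function.Surjective (toIndQ 𝒪 p r) := by
  intro F
  refine mem_of_br_mem _ (LinearMap.range (toIndQ 𝒪 p r)).toAddSubgroup F fun g => ?_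
  obtain ⟨w, hw⟩ := Submodule.mkQ_surjective _ (F.1 g⁻¹)
  obtain ⟨v, rfl⟩ := coeffMap_residueField_surjective 𝒪 w
  refine ⟨br _ g v, ?_⟩
  rw [toIndQ_br, ← hw]
  rfl

variable [IsDomain 𝒪] [FaithfulSMul 𝒪 E] {a b : 𝒪} (hpR : (p : 𝒪) ≠ 0) (hp2 : Odd p)
  (hp𝔪 : (p : 𝒪) ∈ maximalIdeal 𝒪) (hr : ∀ i, p ^ 2 ≤ r i) (ha : a ∈ maximalIdeal 𝒪)
  (hb : b ∈ maximalIdeal 𝒪) (hab : (p : 𝒪) = a * b)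
include hpR hp2 hp𝔪 hr ha

omit [Module.Finite (Zq p) 𝒪] in
-- For a generator, `[g, h X^r] = [g h w, Y^r]`, which is already known to vanish in `Θ̄`.
theorem exists_lift_mem_kill {y : Sym (ResidueField 𝒪) r} (hy : y ∈ (Xr (p := p) 𝒪 r).toSubmodule) :
    ∃ v : Sym 𝒪 r, coeffMap 𝒪 (ResidueField 𝒪) r v = y ∧
      ∀ g, br (symRep (p := p) 𝒪 r 0) g v ∈ kill p 𝒪 E r a := by
  induction hy using Submodule.span_induction with
  | mem y hy =>
    obtain ⟨h, rfl⟩ := hy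
    refine ⟨symRep 𝒪 r 0 h (mon 𝒪 r (r 0) (r 1)), ?_, fun g => ?_⟩
    · rw [coeffMap_symRep, coeffMap_mon 𝒪 le_rfl le_rfl, topMonomial_eq]
    · rw [← br_mul_toG, ← matAct_swapMat_mon_zero (p := p), ← symRep_zero_apply, ← br_mul_toG]
      exact br_mon_zero_mem_kill 𝒪 E hpR hp2 hp𝔪 (hr 0) ha _
  | zero => exact ⟨0, map_zero _, fun g => by rw [map_zero]; exact Submodule.zero_mem _⟩
  | add y y' _ _ h h' =>
    obtain ⟨v, rfl, hv⟩ := h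
    obtain ⟨v', rfl, hv'⟩ := h'
    exact ⟨v + v', map_add _ _ _, fun g => by
      rw [map_add]
      exact Submodule.add_mem _ (hv g) (hv' g)⟩
  | smul c y _ h =>
    obtain ⟨v, rfl, hv⟩ := h
    obtain ⟨c, rfl⟩ := residue_surjective c
    exact ⟨c • v, map_smul _ _ _, fun g => by
      rw [map_smul]
      exact Submodule.smul_mem _ _ (hv g)⟩

include hb hab

theorem ker_toIndQ_le_kill : LinearMap.ker (toIndQ 𝒪 p r) ≤ kill p 𝒪 E r a := by
  intro F hF
  refine mem_of_br_mem _ (kill p 𝒪 E r a).toAddSubgroup F fun g => ?_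
  have h1 : coeffMap 𝒪 (ResidueField 𝒪) r (F.1 g⁻¹) ∈ (kerQ (p := p) 𝒪 r).toSubmodule := by
    have h2 := congrFun (congrArg Subtype.val hF) g⁻¹
    exact (Submodule.Quotient.mk_eq_zero _).mp h2
  obtain ⟨x, hx, y, hy, hxy⟩ := Submodule.mem_sup.mp h1
  obtain ⟨v, rfl, hv⟩ := exists_lift_mem_kill 𝒪 E hpR hp2 hp𝔪 hr ha hy
  have h2 : F.1 g⁻¹ - v ∈ (kill p 𝒪 E r a).comap (br (symRep (p := p) 𝒪 r 0) g) := by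
    refine mem_of_coeffMap_mem_Vstar (p := p) 𝒪 hr _ (fun w hw => ?_) (fun c hc w => ?_) ?_
    · exact br_binom_mem_kill 𝒪 E hpR hp2 hb hab g hw
    · rw [Submodule.mem_comap, map_smul]
      exact smul_mem_kill 𝒪 E hc _
    · rwa [map_sub, ← hxy, add_sub_cancel_right]
  rw [Submodule.mem_comap, map_sub] at h2
  have h3 := Submodule.add_mem _ h2 (hv g)
  rwa [sub_add_cancel] at h3

/-- The map `ind_{KZ}^G Q → Θ̄`. -/
theorem exists_factor_indQ : ∃ Ψ : ind (repQ (p := p) 𝒪 r) →ₗ[ResidueField 𝒪]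
    ThetaBar 𝒪 E p r (algebraMap 𝒪 E a),
    ∀ F, Ψ (toIndQ 𝒪 p r F) = toThetaBar 𝒪 E r (algebraMap 𝒪 E a) F := by
  have hker := ker_toIndQ_le_kill 𝒪 E hpR hp2 hp𝔪 hr ha hb hab
  let Ψ₀ : ind (repQ (p := p) 𝒪 r) →ₗ[𝒪] ThetaBar 𝒪 E p r (algebraMap 𝒪 E a) :=
    (Submodule.liftQ _ (toThetaBar 𝒪 E r (algebraMap 𝒪 E a)) hker).comp
      ((toIndQ 𝒪 p r).quotKerEquivOfSurjective (toIndQ_surjective 𝒪)).symm.toLinearMap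
  -- Since `𝒪` surjects onto the residue field, linearity over `𝒪` is linearity over the residue
  -- field.
  refine ⟨Ψ₀.extendScalarsOfSurjective residue_surjective, fun F => ?_⟩
  change Submodule.liftQ _ _ hker (((toIndQ 𝒪 p r).quotKerEquivOfSurjective _).symm _) = _
  have h : ((toIndQ 𝒪 p r).quotKerEquivOfSurjective (toIndQ_surjective 𝒪)).symm
      (toIndQ 𝒪 p r F) = Submodule.Quotient.mk F := by
    rw [LinearEquiv.symm_apply_eq]
    rfl
  rw [h]
  rfl

end Factorization

/-! ### The Hecke operator on the induction of the socle. -/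

section HeckeOnSocle

open IsLocalRing MvPolynomial

variable {p : ℕ} [Fact p.Prime]

/-- The matrix for `κ = w` sends `Y₀` to `p X₀ = 0`, while those for `κ = u(x)` fix `Y₀` and `Y₁`.
-/
theorem heckeT_br_mon_zero (k : Type*) [Field k] [Algebra (Zq p) k] [CharP k p] {r : Fin 2 → ℕ}
    (hr : r 0 ≠ 0) (s : ℕ) (g : G p) :
    heckeT k r s (br _ g (mon k r 0 0)) =
      ∑ x, br _ (g * toG p (lowerUnip (WittVector.teichmuller p x)) * alpha p) (mon k r 0 0) := by
  rw [heckeT_br, Fintype.sum_option]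
  have h0 : matAct k r (diagP p) (symRep k r s (cosetRep (p := p) none)⁻¹ (mon k r 0 0)) = 0 := by
    rw [symRep_apply, map_smul, ← Module.End.mul_apply, ← map_mul, cosetRep, diagP_mul_swapMat_inv]
    convert smul_zero _
    apply Sym.toPoly_injective
    rw [toPoly_matAct_mon k _ (Nat.zero_le _) (Nat.zero_le _), map_zero]
    simp [subst_X_zero, hr]
  have h1 : ∀ x : GaloisField p 2,
      matAct k r (diagP p) (symRep k r s (cosetRep (p := p) (some x))⁻¹ (mon k r 0 0)) =
      mon k r 0 0 := by
    intro x
    have hdet : ((lowerUnip (WittVector.teichmuller p x))⁻¹ : K p).1.det = 1 := by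
      change (!![1, 0; -_, 1] : Matrix (Fin 2) (Fin 2) (Zq p)).det = 1
      simp [Matrix.det_fin_two]
    rw [symRep_apply, map_smul, ← Module.End.mul_apply, ← map_mul, cosetRep, diagP_mul_lowerUnip_inv,
      hdet, map_one, one_pow, one_smul]
    apply Sym.toPoly_injective
    rw [toPoly_matAct_mon k _ (Nat.zero_le _) (Nat.zero_le _),
      toPoly_mon k (Nat.zero_le _) (Nat.zero_le _)]
    simp [subst_X_zero, subst_X_one]
  rw [h0, map_zero, zero_add]
  simp only [h1]
  rfl

variable (𝒪 : Type*) [CommRing 𝒪] [IsLocalRing 𝒪] [Algebra (Zq p) 𝒪] [Module.Finite (Zq p) 𝒪]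
  {r : Fin 2 → ℕ} (hr : ∀ i, p ^ 2 ≤ r i) {a₁ : ℕ} (ha₁ : 1 ≤ a₁) (ha₁' : a₁ ≤ p - 1)
  (hcong : r 0 + p * r 1 ≡ p * a₁ [MOD p ^ 2 - 1])
include hr ha₁ ha₁' hcong

/-- The twist by `D` gives `Y₀^{p-2} Y₁^{a₁-1}` the torus weight `t`. This handles every isomorphism
`ι` at once, without Schur's lemma. -/
theorem exists_equiv_socle_apply_mon_zero (ι : (symRep (p := p) (ResidueField 𝒪) ![p - 2, a₁ - 1] 1).Equiv
    (socle (repQ (p := p) 𝒪 r)).toRepresentation) :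
    ∃ c : ResidueField 𝒪, (ι.toLinearMap (mon _ _ 0 0)).1 = c • cls p 𝒪 r (monB p _ r 1) := by
  refine eq_smul_of_torus_weight 𝒪 hr ha₁ ha₁' hcong _ fun t => ?_
  have h1 := congrArg Subtype.val (LinearMap.congr_fun (ι.isIntertwining' (torus t))
    (mon (ResidueField 𝒪) ![p - 2, a₁ - 1] 0 0))
  have h2 : (torus t).1.det = WittVector.teichmuller p t.1 := by
    simp [torus, Matrix.det_fin_two]
  refine h1.symm.trans ?_
  rw [LinearMap.comp_apply, symRep_apply, matAct_torus_mon t (Nat.zero_le _) (Nat.zero_le _), mul_zero,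
    add_zero, pow_zero, one_smul, h2, pow_one, map_smul]
  rfl

/-- A map on `ind_{KZ}^G Q` that kills the sums `∑ [g u(x) α, X₀ Y₀^{r₀-1} Y₁^{r₁}]` kills the image
of the Hecke operator on the socle. -/
theorem comp_indSub_heckeT_eq_zero (hp : 2 < p) {M : Type*} [AddCommGroup M] [Module (ResidueField 𝒪) M]
    (Ψ : ind (repQ (p := p) 𝒪 r) →ₗ[ResidueField 𝒪] M)
    (hΨ : ∀ g, ∑ x, Ψ (br _ (g * toG p (lowerUnip (WittVector.teichmuller p x)) * alpha p)
      (cls p 𝒪 r (monB p _ r 1))) = 0)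
    (ι : (symRep (p := p) (ResidueField 𝒪) ![p - 2, a₁ - 1] 1).Equiv
      (socle (repQ (p := p) 𝒪 r)).toRepresentation) :
    LinearMap.range (heckeT (p := p) (ResidueField 𝒪) ![p - 2, a₁ - 1] 1) ≤
      LinearMap.ker (Ψ ∘ₗ indSub (socle (repQ (p := p) 𝒪 r)) ι) := by
  have := charP_residueField (p := p) 𝒪
  obtain ⟨c, hc⟩ := exists_equiv_socle_apply_mon_zero 𝒪 hr ha₁ ha₁' hcong ι
  set T := heckeT (p := p) (ResidueField 𝒪) ![p - 2, a₁ - 1] 1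
  set L := Ψ ∘ₗ indSub (socle (repQ (p := p) 𝒪 r)) ι with hL
  have hbr : ∀ g, L (br _ g (mon _ _ 0 0)) = c • Ψ (br _ g (cls p 𝒪 r (monB p _ r 1))) := by
    intro g
    have h1 : indSub (socle (repQ (p := p) 𝒪 r)) ι (br _ g (mon _ _ 0 0)) =
        br _ g (ι.toLinearMap (mon _ _ 0 0)).1 := by
      rw [indSub, LinearMap.comp_apply, indMap_br]
      exact indMap_br _ _ _ _ _ _
    rw [hL, LinearMap.comp_apply, h1, hc, map_smul, map_smul]
  -- The vectors whose brackets over all `g` die under `L ∘ T` form a subrepresentation, because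
  -- `[g, k v] = [g k, v]`; so one generator suffices.
  let W : Subrepresentation (symRep (p := p) (ResidueField 𝒪) ![p - 2, a₁ - 1] 1) :=
    { toSubmodule := ⨅ g, LinearMap.ker ((L ∘ₗ T) ∘ₗ br _ g)
      apply_mem_toSubmodule := fun k v hv => by
        rw [Submodule.mem_iInf] at hv ⊢
        intro g
        rw [LinearMap.mem_ker, LinearMap.comp_apply, ← br_mul_toG]
        exact hv _ }
  have hW : W.toSubmodule = ⊤ := by
    refine eq_top_of_mon_zero_mem _ (by simp; omega) (by simp; omega) W ?_
    refine Submodule.mem_iInf _ |>.mpr fun g => ?_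
    rw [LinearMap.mem_ker, LinearMap.comp_apply, LinearMap.comp_apply,
      heckeT_br_mon_zero _ (by simp; omega), map_sum]
    simp only [hbr]
    rw [← Finset.smul_sum, hΨ, smul_zero]
  rintro _ ⟨F, rfl⟩
  refine mem_of_br_mem _ (LinearMap.ker (L ∘ₗ T)).toAddSubgroup F fun g => ?_
  have h1 : F.1 g⁻¹ ∈ W.toSubmodule := hW ▸ Submodule.mem_top
  exact (Submodule.mem_iInf _).mp h1 g

end HeckeOnSocle

end HeckeGL2

/-! ### The theorem. -/

theorem mainTheorem7 (p : ℕ) [Fact p.Prime] (hp : 2 < p)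
    (𝒪 E : Type*) [CommRing 𝒪] [IsDomain 𝒪] [IsDiscreteValuationRing 𝒪] [Algebra (HeckeGL2.Zq p) 𝒪]
    [Module.Finite (HeckeGL2.Zq p) 𝒪]
    [Field E] [Algebra 𝒪 E] [IsFractionRing 𝒪 E] [Algebra (HeckeGL2.Zq p) E]
    [IsScalarTower (HeckeGL2.Zq p) 𝒪 E]
    (r : Fin 2 → ℕ) (hr : ∀ i, p ^ 2 ≤ r i)
    (a₁ : ℕ) (ha₁ : 1 ≤ a₁) (ha₁' : a₁ ≤ p - 1)
    (hcong : r 0 + p * r 1 ≡ p * a₁ [MOD p ^ 2 - 1])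
    (hr₀ : ¬ p ∣ r 0) (hr₁ : a₁ = 1 → p ∣ r 1)
    (a : 𝒪) (ha : HeckeGL2.normVal p a ∈ Set.Ioo (1 / 2) 1) :
    ∃ Ψ : HeckeGL2.ind (HeckeGL2.repQ (p := p) 𝒪 r) →ₗ[IsLocalRing.ResidueField 𝒪]
        HeckeGL2.ThetaBar 𝒪 E p r (algebraMap 𝒪 E a),
      (∀ F, Ψ (HeckeGL2.toIndQ 𝒪 p r F) = HeckeGL2.toThetaBar 𝒪 E r (algebraMap 𝒪 E a) F) ∧
      Nonempty ((HeckeGL2.symRep (p := p) (IsLocalRing.ResidueField 𝒪) ![p - 2, a₁ - 1] 1).Equiv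
        (HeckeGL2.socle (HeckeGL2.repQ (p := p) 𝒪 r)).toRepresentation) ∧
      ∀ ι : (HeckeGL2.symRep (p := p) (IsLocalRing.ResidueField 𝒪) ![p - 2, a₁ - 1] 1).Equiv
          (HeckeGL2.socle (HeckeGL2.repQ (p := p) 𝒪 r)).toRepresentation,
        ∃ Ψ' : (HeckeGL2.ind (HeckeGL2.symRep (p := p) (IsLocalRing.ResidueField 𝒪)
              ![p - 2, a₁ - 1] 1) ⧸
            LinearMap.range (HeckeGL2.heckeT (p := p) (IsLocalRing.ResidueField 𝒪)
              ![p - 2, a₁ - 1] 1)) →ₗ[IsLocalRing.ResidueField 𝒪]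
            HeckeGL2.ThetaBar 𝒪 E p r (algebraMap 𝒪 E a),
          Ψ' ∘ₗ Submodule.mkQ _ =
            Ψ ∘ₗ HeckeGL2.indSub (HeckeGL2.socle (HeckeGL2.repQ (p := p) 𝒪 r)) ι := by
  have hchar := HeckeGL2.charP_residueField (p := p) 𝒪
  obtain ⟨hpR, hv₁, hv₂⟩ := HeckeGL2.addVal_of_normVal_mem_Ioo ha
  -- The bound `v(a) < 1` gives `p = a b`, which is used for `V_r^*`; the bound `v(a) > 1/2` gives
  -- `a² = p b'`, which is used for the socle.
  obtain ⟨b, hb, hab⟩ := HeckeGL2.mul_mem_maximalIdeal_of_addVal_lt hv₁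
  obtain ⟨b', hb', hab'⟩ := HeckeGL2.mul_mem_maximalIdeal_of_addVal_lt hv₂
  have hp2 : Odd p := (Fact.out : p.Prime).odd_of_ne_two hp.ne'
  have hp𝔪 : (p : 𝒪) ∈ IsLocalRing.maximalIdeal 𝒪 := by
    rw [hab]
    exact Ideal.mul_mem_left _ _ hb
  have ha𝔪 : a ∈ IsLocalRing.maximalIdeal 𝒪 := by
    have h : a * a ∈ IsLocalRing.maximalIdeal 𝒪 := hab' ▸ Ideal.mul_mem_left _ _ hb'
    exact (Ideal.IsPrime.mem_or_mem inferInstance h).elim id id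
  have hr₀' : IsUnit (r 0 : 𝒪) := by
    rw [← IsLocalRing.residue_ne_zero_iff_isUnit, map_natCast, Ne,
      CharP.cast_eq_zero_iff (IsLocalRing.ResidueField 𝒪) p]
    exact hr₀
  obtain ⟨Ψ, hΨ⟩ := HeckeGL2.exists_factor_indQ (p := p) (r := r) 𝒪 E hpR hp2 hp𝔪 hr ha𝔪 hb hab
  refine ⟨Ψ, hΨ, HeckeGL2.nonempty_equiv_socle 𝒪 hr ha₁ ha₁' hcong, fun ι => ?_⟩
  have hle := HeckeGL2.comp_indSub_heckeT_eq_zero 𝒪 hr ha₁ ha₁' hcong hp Ψ (fun g => ?_) ι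
  · exact ⟨Submodule.liftQ _ _ hle, Submodule.liftQ_mkQ _ _ _⟩
  · have h0 := HeckeGL2.sum_br_mem_kill (r := r) (a := a) 𝒪 E hpR hp2 hp𝔪 ha𝔪 hp hr ha₁ ha₁' hr₁ hcong
      hb' hab' hr₀' g
    rw [HeckeGL2.kill, LinearMap.mem_ker, map_sum] at h0
    rw [← h0]
    refine Finset.sum_congr rfl fun x _ => ?_
    have hr0 := hr 0
    have hp2' : p ≤ p ^ 2 := Nat.le_self_pow two_ne_zero p
    rw [← hΨ, HeckeGL2.toIndQ_br, HeckeGL2.coeffMap_mon 𝒪 (by omega) (Nat.zero_le _),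
      HeckeGL2.monB, Nat.mod_eq_of_lt (by omega), Nat.div_eq_of_lt (by omega)]
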